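/- Setting. Let $E,F$ be Polish spaces with their Borel $\sigma$-fields and let $d$ be a metric inducing the topology of $E$. On a probability space $(\Omega,\mathcal A,\mathbb P)$ let $X=(X_t)_{t\in\mathbb Z}$ be a (strongly) stationary $F$-valued process and let $(\varepsilon_n)_{n\in\mathbb N}$ be i.i.d. $\mathbb R^k$-valued random variables, independent of $X$, with common law $m$. Let $f:E\times F\times\mathbb R^k\to E$ be measurable. Write $P_x(y,A)=\mathbb P(f(y,x,\varepsilon_0)\in A)$, let $\mu P_x$ and $P_{x_1}P_{x_2}$ denote the usual (left to right) compositions, and let $d_{TV}(\mu_1,\mu_2)=\inf_\kappa\int \mathbf 1_{u\ne v}\,\kappa(du,dv)$, the infimum being over all couplings $\kappa$ of $\mu_1$ and $\mu_2$. Assumption 1. There are $R>0$ and $\rho\in(0,1)$ with $d(f(y_1,x,e),f(y_2,x,e))\le\rho\, d(y_1,y_2)+R$ for all $y_1,y_2\in E$, $x\in F$, $e\in\mathbb R^k$. Assumption 2. There are a probability kernel $\nu$ from $F\times E^2$ to $E$, a measurable $\eta:F\to(0,1]$ and $K>0$ such that, for all $y_1,y_2\in E$ with $0<d(y_1,y_2)\le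 2R/(1-\rho)$, all $x\in F$, all Borel $A\subseteq E$ and $i=1,2$: $\mathbb P(f(y_i,x,\varepsilon_0)\in A)\ge\eta(x)\,\nu(x,y_1,y_2,A)$ and $\nu(x,y_1,y_2,\{u: d(u,y_i)\le K\})=1$. Log-moment condition. There are $y_0\in E$ and $\theta\in(0,1)$ with $\mathbb E\Big[\log^+\int d(y_0,f(y_0,X_0,u))^\theta\,m(du)\Big]<\infty$. Proposition. Under these assumptions the following hold. (1) There is a positive integer $N$ such that for all $y\ne y'$ in $E$ the following is true. Let $Y_0=y$, $Y'_0=y'$, $Y_n=f(Y_{n-1},X_{n-1},\varepsilon_n)$ and $Y'_n=f(Y'_{n-1},X_{n-1},\varepsilon_n)$ for $n\ge1$. On some extension of the probability space there are processes $(\tilde Y_n)_{n\ge0}$, $(\tilde Y'_n)_{n\ge0}$ such that $(X,\tilde Y)$ has the law of $(X,Y)$, $(X,\tilde Y')$ has the law of $(X,Y')$, and, for every $n\ge0$, almost surely $$d_{TV}\big(\delta_yP_{X_0}\cdots P_{X_{n-1}},\,\delta_{y'}P_{X_0}\cdots P_{X_{n-1}}\big)\le\mathbb P\big(\tilde Y_n\ne\tilde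 Y'_n\mid X\big)\le\mathbf 1_{d(y,y')\ge R/\rho^{\lfloor n/2\rfloor}}+\prod_{k=1}^{k^*(n)}\big(1-\eta(X_{\lfloor n/2\rfloor+kN-1})\big),$$ where $k^*(n)=\lfloor\lceil n/2\rceil/N\rfloor$. (2) There is a process $(\pi_t)_{t\in\mathbb Z}$ of identically distributed random probability measures on $E$ such that for all $t\in\mathbb Z$ and $y\in E$, almost surely $\lim_{n\to\infty}d_{TV}(\delta_yP_{X_{t-n}}\cdots P_{X_{t-1}},\pi_t)=0$. Moreover, for every $t$, $\pi_{t-1}P_{X_{t-1}}=\pi_t$ almost surely. (3) Call $(X',\varepsilon',Y^*)$, indexed by $\mathbb Z$ and defined on some probability space, a stationary solution if $X'$ has the law of $X$, $\varepsilon'$ is i.i.d. with marginal law $m$ and independent of $X'$, for every $t$ the pair $(X',Y^*_t)$ is independent of $(\varepsilon'_s)_{s>t}$, $Y^*_t=f(Y^*_{t-1},X'_{t-1},\varepsilon'_t)$ almost surely for every $t$, and $((X'_t,Y^*_t))_{t\in\mathbb Z}$ is stationary. Then on some extension of the given probability space there is a stationary solution with $X'=X$ and $\varepsilon'_n=\varepsilon_n$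 for all $n\in\mathbb N$; the law of $((X'_t,Y^*_t))_{t\in\mathbb Z}$ is the same for all stationary solutions; and if $X$ is ergodic, then so is $((X'_t,Y^*_t))_{t\in\mathbb Z}$. -/

import Mathlib

open MeasureTheory ProbabilityTheory Filter Topology
open scoped ENNReal

universe u v w z

/-- Total variation distance as an optimal coupling cost: the infimum of `κ {(x, y) | x ≠ y}`
over all couplings `κ` of `μ₁` and `μ₂`. -/
noncomputable def tvDist {E : Type*} [MeasurableSpace E] (μ₁ μ₂ : Measure E) : ℝ≥0∞ :=
  ⨅ (κ : Measure (E × E)) (_ : κ.map Prod.fst = μ₁ ∧ κ.map Prod.snd = μ₂),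
    κ {p | p.1 ≠ p.2}

/-- Law on path space of a two-sided process. -/
noncomputable def pathLaw {Ω H : Type*} [MeasurableSpace Ω] [MeasurableSpace H]
    (P : Measure Ω) (Z : ℤ → Ω → H) : Measure (ℤ → H) :=
  P.map fun ω t => Z t ω

/-- The left shift on two-sided sequences. -/
def pathShift {H : Type*} (z : ℤ → H) : ℤ → H := fun t => z (t + 1)

/-- (Strong) stationarity: the law on path space is shift invariant. -/
def IsStationaryProcess {Ω H : Type*} [MeasurableSpace Ω] [MeasurableSpace H]
    (P : Measure Ω) (Z : ℤ → Ω → H) : Prop :=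
  MeasurePreserving pathShift (pathLaw P Z) (pathLaw P Z)

/-- Ergodicity: the shift is measure preserving and ergodic for the law on path space. -/
def IsErgodicProcess {Ω H : Type*} [MeasurableSpace Ω] [MeasurableSpace H]
    (P : Measure Ω) (Z : ℤ → Ω → H) : Prop :=
  Ergodic pathShift (pathLaw P Z)

/-- Contractivity modulo a constant. -/
structure ContractiveModConst {E F V : Type*} [MetricSpace E]
    (f : E → F → V → E) (R ρ : ℝ) : Prop where
  R_pos : 0 < R
  ρ_pos : 0 < ρ
  ρ_lt_one : ρ < 1
  dist_le : ∀ (y₁ y₂ : E) (x : F) (e : V), dist (f y₁ x e) (f y₂ x e) ≤ ρ * dist y₁ y₂ + R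

/-- Minorization within bounded distance, with minorization function `η`; `m` is the law of the
noise. -/
structure LocalMinorization {E F V : Type*} [MetricSpace E] [MeasurableSpace E]
    [MeasurableSpace F] [MeasurableSpace V]
    (f : E → F → V → E) (m : Measure V) (R ρ : ℝ) (η : F → ℝ) : Prop where
  measurable_η : Measurable η
  η_mem : ∀ x, η x ∈ Set.Ioc (0 : ℝ) 1
  exists_kernel : ∃ K : ℝ, 0 < K ∧ ∃ ν : Kernel (F × E × E) E, IsMarkovKernel ν ∧
    ∀ (y₁ y₂ : E), 0 < dist y₁ y₂ → dist y₁ y₂ ≤ 2 * R / (1 - ρ) → ∀ x : F,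
      (∀ A : Set E, MeasurableSet A →
        ENNReal.ofReal (η x) * ν (x, y₁, y₂) A ≤ m {e | f y₁ x e ∈ A} ∧
        ENNReal.ofReal (η x) * ν (x, y₁, y₂) A ≤ m {e | f y₂ x e ∈ A}) ∧
      ν (x, y₁, y₂) (Metric.closedBall y₁ K) = 1 ∧
      ν (x, y₁, y₂) (Metric.closedBall y₂ K) = 1

/-- The kernel `P_x(y, A) = m {e | f y x e ∈ A}` on `E`, where `m` is the law of the noise. -/
noncomputable def transKernel {E F V : Type*} [MeasurableSpace E] [MeasurableSpace V]
    (f : E → F → V → E) (m : Measure V) (x : F) : Kernel E E :=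
  (Kernel.id ×ₖ Kernel.const E m).map fun p => f p.1 x p.2

theorem transKernel_apply {E F V : Type*} [MeasurableSpace E] [MeasurableSpace F]
    [MeasurableSpace V] (f : E → F → V → E)
    (hf : Measurable fun p : E × F × V => f p.1 p.2.1 p.2.2) (m : Measure V) [SFinite m]
    (x : F) (y : E) (A : Set E) (hA : MeasurableSet A) :
    transKernel f m x y A = m {e | f y x e ∈ A} := by
  have h1 : Measurable fun p : E × V => f p.1 x p.2 :=
    hf.comp (measurable_fst.prodMk (measurable_const.prodMk measurable_snd))
  rw [transKernel, Kernel.map_apply' _ h1 _ hA, Kernel.prod_apply, Kernel.id_apply,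
    Kernel.const_apply, Measure.dirac_prod, Measure.map_apply measurable_prodMk_left (h1 hA)]
  rfl

/-- The product `P_{x_s} P_{x_{s+1}} ⋯ P_{x_{s+n-1}}` of `n` kernels, applied in this
chronological order (`κ ∘ₖ κ'` applies `κ'` first). -/
noncomputable def prodKernel {E F V : Type*} [MeasurableSpace E] [MeasurableSpace V]
    (f : E → F → V → E) (m : Measure V) (x : ℤ → F) (s : ℤ) : ℕ → Kernel E E
  | 0 => Kernel.id
  | n + 1 => transKernel f m (x (s + n)) ∘ₖ prodKernel f m x s n

/-- The probability `δ_y P_{x_s} P_{x_{s+1}} ⋯ P_{x_{s+n-1}}`. -/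
noncomputable def quenchedLaw {E F V : Type*} [MeasurableSpace E] [MeasurableSpace V]
    (f : E → F → V → E) (m : Measure V) (x : ℤ → F) (s : ℤ) (n : ℕ) (y : E) : Measure E :=
  (Measure.dirac y).bind (prodKernel f m x s n)

/-- The Markov chain in random environment started at `y`:
`Y 0 = y`, `Y (n + 1) = f (Y n) (X n) (ε (n + 1))`. -/
def chain {E F V Ω : Type*} (f : E → F → V → E) (X : ℤ → Ω → F) (ε : ℕ → Ω → V) (y : E) :
    ℕ → Ω → E
  | 0 => fun _ => y
  | n + 1 => fun ω => f (chain f X ε y n ω) (X n ω) (ε (n + 1) ω)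

/-- `E[log⁺ Z] < ∞` for a random variable `Z` with values in `[0, ∞]`
(in particular `Z < ∞` almost surely). -/
def HasLogMoment {Ω : Type*} [MeasurableSpace Ω] (P : Measure Ω) (Z : Ω → ℝ≥0∞) : Prop :=
  (∀ᵐ ω ∂P, Z ω ≠ ∞) ∧ Integrable (fun ω => Real.posLog (Z ω).toReal) P

/-- `Y` is a stationary solution of the recursion `Y t = f (Y (t-1)) (X (t-1)) (ε t)`, `t ∈ ℤ`,
where `X` is an environment with law `envLaw` and `ε` is a two-sided i.i.d. noise with marginal
law `m`, independent of `X`. The field `causal` says that the state at time `t` (jointly with the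
environment) is independent of the noise after time `t`. -/
structure IsStationarySolution {E F V Ω : Type*} [MeasurableSpace E] [MeasurableSpace F]
    [MeasurableSpace V] [MeasurableSpace Ω] (f : E → F → V → E) (m : Measure V)
    (envLaw : Measure (ℤ → F)) (P : Measure Ω)
    (X : ℤ → Ω → F) (ε : ℤ → Ω → V) (Y : ℤ → Ω → E) : Prop where
  isProbabilityMeasure : IsProbabilityMeasure P
  measurable_X : ∀ t, Measurable (X t)
  measurable_ε : ∀ t, Measurable (ε t)
  measurable_Y : ∀ t, Measurable (Y t)
  law_X : pathLaw P X = envLaw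
  law_ε : ∀ t, P.map (ε t) = m
  iIndep_ε : iIndepFun ε P
  indep_env : IndepFun (fun ω t => ε t ω) (fun ω t => X t ω) P
  causal : ∀ t : ℤ, IndepFun (fun ω => ((fun s => X s ω : ℤ → F), Y t ω))
    (fun ω (j : ℕ) => ε (t + 1 + j) ω) P
  recursion : ∀ t : ℤ, ∀ᵐ ω ∂P, Y t ω = f (Y (t - 1) ω) (X (t - 1) ω) (ε t ω)
  stationary : IsStationaryProcess P fun t ω => (X t ω, Y t ω)

/-! Everything rests on one merging estimate for quenched laws, stated dually: rather than coupling
two copies, one follows how much a test function can vary over points at distance at most r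
(`MergesWithin`). Two copies driven by the same noise contract to the scale R/(1-ρ), so a bound at a
moderate scale pulls back to a much larger one. Once the copies are within 2R/(1-ρ), the
minorization makes them coincide with probability η. If this fails they are still within a fixed
distance D, because ν lives near both starting points (`exists_mergesWithin_attempt`). A block of N
steps consists of the steps needed to return from D to 2R/(1-ρ), then one attempt. Contracting
during the first half of the n steps and running blocks during the second gives
`exists_hasMergingTime`.

Coupling: a single coupling has to serve all n at once. `exists_maximal_coupling` provides it for
whole trajectories above a common environment: the probability that they still differ after time n
is bounded by a difference of probabilities of one event of the future from n. By the Markov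
property these probabilities are integrals of one [0,1]-valued function of the state at time n
against the two quenched laws, which is what the merging estimate controls.

Backward limit: the law started at time -n-p is a mixture of laws started at -n. By the log-moment
condition and Borel-Cantelli, the θ-moments of the mixing laws grow more slowly than the θ-power of
the distance R/ρ^⌊n/2⌋ that the merging estimate tolerates, and the products of 1 - η vanish by
Poincaré recurrence, without ergodicity. Hence the laws are Cauchy uniformly on events
(`exists_quenched_limit`), with a limit Φ(x) satisfying Φ(x) P_{x_0} = Φ(shift x).

Stationary solutions: if the law of Y_t does not depend on t, then Y_{-n} may be replaced by y₀ with
vanishing error, so Y_0 has conditional law Φ(X) (`IsWeakSolution.map_state`); the fresh noise then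
determines the whole law. This needs only `IsWeakSolution`, a notion with two useful features.
Stationarity follows from uniqueness applied to a shifted solution. When the environment is ergodic,
conditioning on an invariant event of positive probability yields another weak solution, so by
uniqueness that event has probability one, which is ergodicity. Existence comes from the natural
extension of the skew product, which preserves μ ⊗ Φ ⊗ noise. -/

set_option linter.unusedSectionVars false

/-! ### Quenched laws and the Chapman-Kolmogorov identities -/

section Quenched

variable {E F V : Type*} [MeasurableSpace E] [MeasurableSpace F] [MeasurableSpace V]
  {f : E → F → V → E} {m : Measure V}

theorem measurable_step (hf : Measurable fun p : E × F × V => f p.1 p.2.1 p.2.2) (y : E) (x : F) :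
    Measurable (f y x) :=
  hf.comp (measurable_const.prodMk (measurable_const.prodMk measurable_id))

theorem isMarkovKernel_transKernel (hf : Measurable fun p : E × F × V => f p.1 p.2.1 p.2.2)
    [IsProbabilityMeasure m] (x : F) : IsMarkovKernel (transKernel f m x) := by
  have h1 : Measurable fun p : E × V => f p.1 x p.2 :=
    hf.comp (measurable_fst.prodMk (measurable_const.prodMk measurable_snd))
  exact Kernel.IsMarkovKernel.map _ h1

theorem isMarkovKernel_prodKernel (hf : Measurable fun p : E × F × V => f p.1 p.2.1 p.2.2)
    [IsProbabilityMeasure m] (x : ℤ → F) (s : ℤ) (n : ℕ) :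
    IsMarkovKernel (prodKernel f m x s n) := by
  induction n with
  | zero => exact inferInstanceAs (IsMarkovKernel Kernel.id)
  | succ n ih =>
    have := isMarkovKernel_transKernel (m := m) hf (x (s + n))
    exact inferInstanceAs (IsMarkovKernel (transKernel f m (x (s + n)) ∘ₖ prodKernel f m x s n))

theorem lintegral_transKernel (hf : Measurable fun p : E × F × V => f p.1 p.2.1 p.2.2)
    [IsProbabilityMeasure m] (x : F) (y : E) {g : E → ℝ≥0∞} (hg : Measurable g) :
    ∫⁻ z, g z ∂(transKernel f m x y) = ∫⁻ e, g (f y x e) ∂m := by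
  have h1 : Measurable fun p : E × V => f p.1 x p.2 :=
    hf.comp (measurable_fst.prodMk (measurable_const.prodMk measurable_snd))
  have h2 : Measurable fun p : E × V => g (f p.1 x p.2) := hg.comp h1
  rw [transKernel, Kernel.map_apply _ h1, Kernel.prod_apply, Kernel.id_apply, Kernel.const_apply,
    Measure.dirac_prod, lintegral_map hg h1, lintegral_map h2 measurable_prodMk_left]

theorem quenchedLaw_eq_prodKernel (x : ℤ → F) (s : ℤ) (n : ℕ) (y : E) :
    quenchedLaw f m x s n y = prodKernel f m x s n y :=
  Measure.dirac_bind (Kernel.measurable _) y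

theorem measurable_quenchedLaw (x : ℤ → F) (s : ℤ) (n : ℕ) :
    Measurable (quenchedLaw f m x s n) := by
  simp_rw [funext (quenchedLaw_eq_prodKernel (f := f) (m := m) x s n)]
  exact Kernel.measurable _

theorem isProbabilityMeasure_quenchedLaw (hf : Measurable fun p : E × F × V => f p.1 p.2.1 p.2.2)
    [IsProbabilityMeasure m] (x : ℤ → F) (s : ℤ) (n : ℕ) (y : E) :
    IsProbabilityMeasure (quenchedLaw f m x s n y) := by
  have := isMarkovKernel_prodKernel (m := m) hf x s n
  rw [quenchedLaw_eq_prodKernel]; infer_instance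

theorem quenchedLaw_zero (x : ℤ → F) (s : ℤ) (y : E) :
    quenchedLaw f m x s 0 y = Measure.dirac y := by
  rw [quenchedLaw_eq_prodKernel, prodKernel, Kernel.id_apply]

theorem quenchedLaw_succ (x : ℤ → F) (s : ℤ) (n : ℕ) (y : E) :
    quenchedLaw f m x s (n + 1) y =
      (quenchedLaw f m x s n y).bind (transKernel f m (x (s + n))) := by
  rw [quenchedLaw_eq_prodKernel, quenchedLaw_eq_prodKernel, prodKernel, Kernel.comp_apply]

theorem quenchedLaw_add (x : ℤ → F) (s : ℤ) (n p : ℕ) (y : E) :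
    quenchedLaw f m x s (n + p) y =
      (quenchedLaw f m x s n y).bind (quenchedLaw f m x (s + n) p) := by
  induction p with
  | zero =>
    simp_rw [funext (quenchedLaw_zero (f := f) (m := m) x (s + n))]
    exact (Measure.bind_dirac).symm
  | succ p ih =>
    rw [← add_assoc, quenchedLaw_succ, ih, Measure.bind_bind]
    · congr 1
      ext1 z
      rw [quenchedLaw_succ]
      push_cast
      rw [add_assoc]
    · exact (measurable_quenchedLaw _ _ _).aemeasurable
    · exact (Kernel.measurable _).aemeasurable

theorem lintegral_quenchedLaw_add (x : ℤ → F) (s : ℤ) (n p : ℕ) (y : E) {g : E → ℝ≥0∞}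
    (hg : Measurable g) :
    ∫⁻ z, g z ∂(quenchedLaw f m x s (n + p) y) =
      ∫⁻ z, ∫⁻ u, g u ∂(quenchedLaw f m x (s + n) p z) ∂(quenchedLaw f m x s n y) := by
  rw [quenchedLaw_add, Measure.lintegral_bind (measurable_quenchedLaw _ _ _).aemeasurable
    hg.aemeasurable]

theorem measurable_lintegral_quenchedLaw (x : ℤ → F) (s : ℤ) (n : ℕ) {g : E → ℝ≥0∞}
    (hg : Measurable g) : Measurable fun y => ∫⁻ u, g u ∂(quenchedLaw f m x s n y) :=
  (Measure.measurable_lintegral hg).comp (measurable_quenchedLaw x s n)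

theorem lintegral_quenchedLaw_succ (hf : Measurable fun p : E × F × V => f p.1 p.2.1 p.2.2)
    [IsProbabilityMeasure m] (x : ℤ → F) (s : ℤ) (n : ℕ) (y : E) {g : E → ℝ≥0∞}
    (hg : Measurable g) :
    ∫⁻ z, g z ∂(quenchedLaw f m x s (n + 1) y) =
      ∫⁻ z, ∫⁻ e, g (f z (x (s + n)) e) ∂m ∂(quenchedLaw f m x s n y) := by
  rw [quenchedLaw_succ, Measure.lintegral_bind (Kernel.measurable _).aemeasurable hg.aemeasurable]
  simp_rw [lintegral_transKernel hf _ _ hg]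

end Quenched

/-! ### Merging of quenched laws: contraction and minorization -/

theorem lintegral_le_one {E : Type*} [MeasurableSpace E] {μ : Measure E} [IsProbabilityMeasure μ]
    {g : E → ℝ≥0∞} (hg : ∀ u, g u ≤ 1) : ∫⁻ u, g u ∂μ ≤ 1 :=
  (lintegral_mono hg).trans (by simp)

/-- A density, bounded by one and supported in a set carrying the smaller measure. -/
theorem exists_density_of_le {E : Type*} [MeasurableSpace E] {μ ν : Measure E}
    [IsFiniteMeasure μ] (h : ν ≤ μ) {S : Set E} (hS : MeasurableSet S) (hνS : ν Sᶜ = 0) :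
    ∃ a : E → ℝ≥0∞, Measurable a ∧ (∀ u, a u ≤ 1) ∧ (∀ u, a u ≠ 0 → u ∈ S) ∧
      ∀ g : E → ℝ≥0∞, Measurable g → ∫⁻ u, g u * a u ∂μ = ∫⁻ u, g u ∂ν := by
  have : IsFiniteMeasure ν := isFiniteMeasure_of_le μ h
  set d : E → ℝ≥0∞ := ν.rnDeriv μ
  have hd : Measurable d := Measure.measurable_rnDeriv _ _
  refine ⟨S.indicator fun u => min (d u) 1, (hd.min measurable_const).indicator hS, ?_, ?_, ?_⟩
  · intro u
    by_cases hu : u ∈ S <;> simp [hu]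
  · intro u hu
    by_contra hn
    simp [hn] at hu
  · intro g hg
    have h1 : ∀ᵐ u ∂μ, d u ≤ 1 := Measure.rnDeriv_le_one_of_le h
    have h2 : ∫⁻ u, g u * S.indicator (fun u => min (d u) 1) u ∂μ = ∫⁻ u in S, d u * g u ∂μ := by
      rw [← lintegral_indicator hS]
      refine lintegral_congr_ae ?_
      filter_upwards [h1] with u hu
      by_cases hS : u ∈ S <;> simp [hS, min_eq_left hu, mul_comm]
    rw [h2, setLIntegral_rnDeriv_mul h.absolutelyContinuous hg.aemeasurable hS]
    rw [Measure.restrict_eq_self_of_ae_mem]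
    exact hνS

/-- The values of `g` at points at distance at most `r` differ by at most `c`. -/
def MergesWithin {E : Type*} [PseudoMetricSpace E] (g : E → ℝ≥0∞) (r : ℝ) (c : ℝ≥0∞) : Prop :=
  ∀ y₁ y₂, dist y₁ y₂ ≤ r → g y₁ ≤ g y₂ + c

section Merging

variable {E F V : Type*} [MetricSpace E] [MeasurableSpace E] [BorelSpace E]
  [MeasurableSpace F] [MeasurableSpace V] {f : E → F → V → E} {m : Measure V} {R ρ : ℝ} {η : F → ℝ}

/-- Synchronous coupling: with the same noise, points within r are sent to points within ρ r + R. -/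
theorem MergesWithin.step [IsProbabilityMeasure m] (hf : Measurable fun p : E × F × V => f p.1 p.2.1 p.2.2)
    (hc : ContractiveModConst f R ρ) {g : E → ℝ≥0∞} (hgm : Measurable g) {r r' : ℝ} {c : ℝ≥0∞}
    (hg : MergesWithin g r' c) (hr : ρ * r + R ≤ r') (x : F) :
    MergesWithin (fun y => ∫⁻ e, g (f y x e) ∂m) r c := by
  intro y₁ y₂ h
  calc ∫⁻ e, g (f y₁ x e) ∂m ≤ ∫⁻ e, (g (f y₂ x e) + c) ∂m := by
        refine lintegral_mono fun e => hg _ _ ?_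
        have := hc.dist_le y₁ y₂ x e
        nlinarith [hc.ρ_pos]
    _ = _ := by
        have h2 : Measurable fun e => g (f y₂ x e) := hgm.comp (measurable_step hf y₂ x)
        rw [lintegral_add_left h2, lintegral_const, measure_univ, mul_one]

/-- Iterating r ↦ ρ r + R, whose fixed point is R/(1-ρ), takes r to at most ρ^n r + R/(1-ρ) in n
steps. -/
theorem MergesWithin.quenchedLaw [IsProbabilityMeasure m]
    (hf : Measurable fun p : E × F × V => f p.1 p.2.1 p.2.2)
    (hc : ContractiveModConst f R ρ) (x : ℤ → F) (s : ℤ) (n : ℕ) {g : E → ℝ≥0∞}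
    (hgm : Measurable g) {r r' : ℝ} {c : ℝ≥0∞}
    (hg : MergesWithin g r' c) (hr : ρ ^ n * r + R / (1 - ρ) ≤ r') :
    MergesWithin (fun y => ∫⁻ u, g u ∂(quenchedLaw f m x s n y)) r c := by
  have h1ρ : 0 < 1 - ρ := by linarith [hc.ρ_lt_one]
  induction n generalizing g r' with
  | zero =>
    intro y₁ y₂ h
    simp only [quenchedLaw_zero, lintegral_dirac' _ hgm]
    apply hg
    have := div_pos hc.R_pos h1ρ
    simp at hr
    linarith
  | succ n ih =>
    simp_rw [lintegral_quenchedLaw_succ hf x s n _ hgm]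
    refine ih ?_ (r' := ρ ^ n * r + R / (1 - ρ)) ?_ le_rfl
    · exact (hgm.comp (hf.comp (measurable_fst.prodMk
        (measurable_const.prodMk measurable_snd)))).lintegral_prod_right'
    · refine hg.step hf hc hgm ?_ _
      refine le_trans (le_of_eq ?_) hr
      field_simp
      ring

/-- A coupling written in dual form. Mass η is sent through ν from both points and cancels exactly;
on the remaining mass 1 - η the images stay within D, where g varies by at most c. -/
theorem exists_mergesWithin_attempt [IsProbabilityMeasure m]
    (hf : Measurable fun p : E × F × V => f p.1 p.2.1 p.2.2)
    (hc : ContractiveModConst f R ρ) (hm : LocalMinorization f m R ρ η) :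
    ∃ D : ℝ, 2 * R / (1 - ρ) ≤ D ∧ ∀ (x : F) (g : E → ℝ≥0∞) (c : ℝ≥0∞), Measurable g →
      MergesWithin g D c →
      MergesWithin (fun y => ∫⁻ e, g (f y x e) ∂m) (2 * R / (1 - ρ))
        (ENNReal.ofReal (1 - η x) * c) := by
  obtain ⟨K, hK, ν, hν, H⟩ := hm.exists_kernel
  have h1ρ : 0 < 1 - ρ := by linarith [hc.ρ_lt_one]
  have hρ := hc.ρ_pos
  have hR := hc.R_pos
  set D₀ := 2 * R / (1 - ρ) with hD₀
  have hD₀pos : 0 < D₀ := by positivity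
  -- Each unmatched image will lie within K + (ρ D₀ + R) of the opposite starting point, and the
  -- starting points are within D₀ of each other.
  refine ⟨2 * (K + (ρ * D₀ + R)) + D₀, by nlinarith [mul_pos hρ hD₀pos], ?_⟩
  intro x g c hg hgD y₁ y₂ hy
  rcases eq_or_ne y₁ y₂ with rfl | hne
  · exact le_self_add
  obtain ⟨hA, hB1, hB2⟩ := H y₁ y₂ (dist_pos.mpr hne) hy x
  have hηx := hm.η_mem x
  have hf1 := measurable_step hf y₁ x
  have hf2 := measurable_step hf y₂ x
  set lam : Measure E := ENNReal.ofReal (η x) • ν (x, y₁, y₂) with hlam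
  have hle1 : lam ≤ m.map (f y₁ x) := by
    refine Measure.le_iff.2 fun A hAm => ?_
    rw [Measure.map_apply hf1 hAm]
    exact (hA A hAm).1
  have hle2 : lam ≤ m.map (f y₂ x) := by
    refine Measure.le_iff.2 fun A hAm => ?_
    rw [Measure.map_apply hf2 hAm]
    exact (hA A hAm).2
  have hnull : ∀ S : Set E, MeasurableSet S → ν (x, y₁, y₂) S = 1 → lam Sᶜ = 0 := by
    intro S hS h1
    rw [hlam, Measure.smul_apply, (prob_compl_eq_zero_iff hS).2 h1, smul_zero]
  have : IsProbabilityMeasure (m.map (f y₁ x)) := Measure.isProbabilityMeasure_map hf1.aemeasurable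
  have : IsProbabilityMeasure (m.map (f y₂ x)) := Measure.isProbabilityMeasure_map hf2.aemeasurable
  obtain ⟨a', ha'm, ha'1, ha'S, ha'g⟩ := exists_density_of_le hle1 Metric.isClosed_closedBall.measurableSet
    (hnull _ Metric.isClosed_closedBall.measurableSet hB1)
  obtain ⟨b', hb'm, hb'1, hb'S, hb'g⟩ := exists_density_of_le hle2 Metric.isClosed_closedBall.measurableSet
    (hnull _ Metric.isClosed_closedBall.measurableSet hB2)
  -- Densities on the noise space: a·m pushed by f y₁ x and b·m pushed by f y₂ x both equal η ν, so
  -- these parts merge. The remaining weights 1 - a and 1 - b share k, which uses the same noise for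
  -- both points, and leave excesses w₁, w₂ of equal mass.
  set a : V → ℝ≥0∞ := fun e => a' (f y₁ x e) with ha
  set b : V → ℝ≥0∞ := fun e => b' (f y₂ x e) with hb
  have ham : Measurable a := ha'm.comp hf1
  have hbm : Measurable b := hb'm.comp hf2
  have ha1 : ∀ e, a e ≤ 1 := fun e => ha'1 _
  have hb1 : ∀ e, b e ≤ 1 := fun e => hb'1 _
  set g₁ : V → ℝ≥0∞ := fun e => g (f y₁ x e) with hg₁
  set g₂ : V → ℝ≥0∞ := fun e => g (f y₂ x e) with hg₂
  have hg₁m : Measurable g₁ := hg.comp hf1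
  have hg₂m : Measurable g₂ := hg.comp hf2
  have hIa : ∫⁻ e, g₁ e * a e ∂m = ∫⁻ e, g₂ e * b e ∂m := by
    have e1 := ha'g g hg
    have e2 := hb'g g hg
    rw [lintegral_map (by fun_prop) hf1] at e1
    rw [lintegral_map (by fun_prop) hf2] at e2
    exact e1.trans e2.symm
  have hlam1 : lam Set.univ = ENNReal.ofReal (η x) := by
    rw [hlam, Measure.smul_apply, measure_univ, smul_eq_mul, mul_one]
  have hMa : ∫⁻ e, a e ∂m = ENNReal.ofReal (η x) := by
    have e1 := ha'g (fun _ => 1) measurable_const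
    rw [lintegral_map (by fun_prop) hf1] at e1
    simpa [hlam1] using e1
  have hMb : ∫⁻ e, b e ∂m = ENNReal.ofReal (η x) := by
    have e1 := hb'g (fun _ => 1) measurable_const
    rw [lintegral_map (by fun_prop) hf2] at e1
    simpa [hlam1] using e1
  have hdist : ∀ e, dist (f y₁ x e) (f y₂ x e) ≤ ρ * D₀ + R := fun e =>
    (hc.dist_le y₁ y₂ x e).trans (by nlinarith)
  have hpos : 0 < ρ * D₀ + R := by positivity
  -- common part and the two excess parts
  set k : V → ℝ≥0∞ := fun e => 1 - max (a e) (b e) with hk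
  set w₁ : V → ℝ≥0∞ := fun e => b e - a e with hw₁
  set w₂ : V → ℝ≥0∞ := fun e => a e - b e with hw₂
  have hkm : Measurable k := measurable_const.sub (ham.max hbm)
  have hw₁m : Measurable w₁ := hbm.sub ham
  have hw₂m : Measurable w₂ := ham.sub hbm
  have hsum : ∀ p q : ℝ≥0∞, p ≤ 1 → q ≤ 1 → p + ((1 - max p q) + (q - p)) = 1 := by
    intro p q hp hq
    rcases le_total p q with h | h
    · rw [max_eq_right h, add_comm (1 - q), ← add_assoc, add_tsub_cancel_of_le h,
        add_tsub_cancel_of_le hq]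
    · rw [max_eq_left h, tsub_eq_zero_of_le h, add_zero, add_tsub_cancel_of_le hp]
  have hs1 : ∀ e, a e + (k e + w₁ e) = 1 := fun e => hsum _ _ (ha1 e) (hb1 e)
  have hs2 : ∀ e, b e + (k e + w₂ e) = 1 := fun e => by
    have := hsum _ _ (hb1 e) (ha1 e)
    rwa [max_comm] at this
  have hη1 : ENNReal.ofReal (η x) ≠ ∞ := ENNReal.ofReal_ne_top
  have hmass1 : ENNReal.ofReal (η x) + (∫⁻ e, k e ∂m + ∫⁻ e, w₁ e ∂m) = 1 := by
    rw [← hMa, ← lintegral_add_left hkm, ← lintegral_add_left ham]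
    simp [hs1]
  have hmass2 : ENNReal.ofReal (η x) + (∫⁻ e, k e ∂m + ∫⁻ e, w₂ e ∂m) = 1 := by
    rw [← hMb, ← lintegral_add_left hkm, ← lintegral_add_left hbm]
    simp [hs2]
  have hres : ∫⁻ e, k e ∂m + ∫⁻ e, w₁ e ∂m = ENNReal.ofReal (1 - η x) := by
    rw [ENNReal.ofReal_sub _ hηx.1.le, ENNReal.ofReal_one]
    exact ENNReal.eq_sub_of_add_eq hη1 (by rw [add_comm]; exact hmass1)
  have hkfin : ∫⁻ e, k e ∂m ≠ ∞ := by
    intro h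
    rw [h] at hmass1
    simp at hmass1
  have hw12 : ∫⁻ e, w₁ e ∂m = ∫⁻ e, w₂ e ∂m := by
    have := hmass1.trans hmass2.symm
    rw [ENNReal.add_right_inj hη1, ENNReal.add_right_inj hkfin] at this
    exact this
  set δ := ∫⁻ e, w₁ e ∂m with hδ
  have hδfin : δ ≠ ∞ := by
    intro h
    rw [h] at hmass1
    simp at hmass1
  -- If w₁ e ≠ 0 then b e ≠ 0, so noise e keeps the second copy within K of y₂, and by contraction
  -- puts the first copy near y₂. Symmetrically w₂ e' ≠ 0 puts the second copy near y₁. This is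
  -- where the support condition on ν enters.
  have hpair : ∀ e e', w₁ e ≠ 0 → w₂ e' ≠ 0 → g₁ e ≤ g₂ e' + c := by
    intro e e' h1 h2
    have hbe : b e ≠ 0 := fun h => h1 (by simp [hw₁, h])
    have hae : a e' ≠ 0 := fun h => h2 (by simp [hw₂, h])
    have hb2 := Metric.mem_closedBall.1 (hb'S _ hbe)
    have ha2 := Metric.mem_closedBall.1 (ha'S _ hae)
    refine hgD _ _ ?_
    have t1 := hdist e
    have t2 := hdist e'
    have t3 := dist_triangle (f y₁ x e) (f y₂ x e) y₂
    have t4 := dist_triangle (f y₁ x e) y₂ y₁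
    have t5 := dist_triangle (f y₁ x e) y₁ (f y₂ x e')
    have t6 := dist_triangle y₁ (f y₁ x e') (f y₂ x e')
    rw [dist_comm y₁ (f y₁ x e')] at t6
    rw [dist_comm y₂ y₁] at t4
    linarith
  have m1k : Measurable fun e => g₁ e * k e := hg₁m.mul hkm
  have m2k : Measurable fun e => g₂ e * k e := hg₂m.mul hkm
  have m1a : Measurable fun e => g₁ e * a e := hg₁m.mul ham
  have m2b : Measurable fun e => g₂ e * b e := hg₂m.mul hbm
  have m1w : Measurable fun e => g₁ e * w₁ e := hg₁m.mul hw₁m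
  have m2w : Measurable fun e => g₂ e * w₂ e := hg₂m.mul hw₂m
  have mcw : Measurable fun e => c * w₂ e := hw₂m.const_mul c
  have hk1 : ∫⁻ e, g₁ e * k e ∂m ≤ ∫⁻ e, g₂ e * k e ∂m + c * ∫⁻ e, k e ∂m := by
    rw [← lintegral_const_mul _ hkm, ← lintegral_add_left m2k]
    refine lintegral_mono fun e => ?_
    rw [← add_mul]
    gcongr
    exact hgD _ _ ((hdist e).trans (by linarith))
  have hw1 : ∫⁻ e, g₁ e * w₁ e ∂m ≤ ∫⁻ e, g₂ e * w₂ e ∂m + c * δ := by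
    rcases eq_or_ne δ 0 with h0 | h0
    · have : ∫⁻ e, g₁ e * w₁ e ∂m = 0 := by
        rw [lintegral_eq_zero_iff m1w]
        rw [hδ, lintegral_eq_zero_iff hw₁m] at h0
        filter_upwards [h0] with e he
        simp_all
      simp [this]
    · have hstep1 : ∀ e', w₂ e' ≠ 0 → ∫⁻ e, g₁ e * w₁ e ∂m ≤ (g₂ e' + c) * δ := by
        intro e' he'
        rw [hδ, ← lintegral_const_mul _ hw₁m]
        refine lintegral_mono fun e => ?_
        rcases eq_or_ne (w₁ e) 0 with h | h
        · simp [h]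
        · gcongr
          exact hpair e e' h he'
      -- Product coupling of the two excesses, kept multiplied by their common mass δ, which is
      -- cancelled at the end since it is neither 0 nor ∞.
      have hstep2 : (∫⁻ e, g₁ e * w₁ e ∂m) * δ ≤ (∫⁻ e, g₂ e * w₂ e ∂m + c * δ) * δ := by
        calc (∫⁻ e, g₁ e * w₁ e ∂m) * δ = ∫⁻ e', (∫⁻ e, g₁ e * w₁ e ∂m) * w₂ e' ∂m := by
              rw [lintegral_const_mul _ hw₂m, ← hw12]
          _ ≤ ∫⁻ e', δ * (g₂ e' * w₂ e' + c * w₂ e') ∂m := by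
              refine lintegral_mono fun e' => ?_
              rcases eq_or_ne (w₂ e') 0 with h | h
              · simp [h]
              · calc _ ≤ ((g₂ e' + c) * δ) * w₂ e' := by gcongr; exact hstep1 e' h
                  _ = _ := by ring
          _ = _ := by
              rw [lintegral_const_mul _ (show Measurable fun e => g₂ e * w₂ e + c * w₂ e from m2w.add mcw),
                lintegral_add_left m2w, lintegral_const_mul _ hw₂m, ← hw12, mul_comm]
      exact (ENNReal.mul_le_mul_iff_left h0 hδfin).1 hstep2
  calc ∫⁻ e, g₁ e ∂m = ∫⁻ e, g₁ e * a e ∂m + (∫⁻ e, g₁ e * k e ∂m + ∫⁻ e, g₁ e * w₁ e ∂m) := by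
        rw [← lintegral_add_left m1k, ← lintegral_add_left m1a]
        refine lintegral_congr fun e => ?_
        rw [← mul_add, ← mul_add, hs1, mul_one]
    _ ≤ ∫⁻ e, g₂ e * b e ∂m + ((∫⁻ e, g₂ e * k e ∂m + c * ∫⁻ e, k e ∂m) +
          (∫⁻ e, g₂ e * w₂ e ∂m + c * δ)) := by
        rw [hIa]
        gcongr
    _ = (∫⁻ e, g₂ e * b e ∂m + (∫⁻ e, g₂ e * k e ∂m + ∫⁻ e, g₂ e * w₂ e ∂m)) +
          (∫⁻ e, k e ∂m + δ) * c := by ring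
    _ = ∫⁻ e, g₂ e ∂m + ENNReal.ofReal (1 - η x) * c := by
        rw [hres]
        congr 1
        rw [← lintegral_add_left m2k, ← lintegral_add_left m2b]
        refine lintegral_congr fun e => ?_
        rw [← mul_add, ← mul_add, hs2, mul_one]

/-- The bound on the total variation distance of two quenched laws after `n` steps. -/
noncomputable def mergingBound (η : F → ℝ) (R ρ : ℝ) (N : ℕ) (x : ℤ → F) (s : ℤ) (n : ℕ)
    (r : ℝ) : ℝ≥0∞ :=
  (if R / ρ ^ (n / 2) ≤ r then 1 else 0) +
    ∏ j ∈ Finset.Icc 1 (((n + 1) / 2) / N),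
      ENNReal.ofReal (1 - η (x (s + ((n / 2 + j * N - 1 : ℕ) : ℤ))))

/-- `N` is a number of steps for which the quenched laws merge at the stated rate. -/
def HasMergingTime (f : E → F → V → E) (m : Measure V) (R ρ : ℝ) (η : F → ℝ) (N : ℕ) : Prop :=
  ∀ (x : ℤ → F) (s : ℤ) (n : ℕ) (y y' : E) (g : E → ℝ≥0∞), Measurable g → (∀ u, g u ≤ 1) →
    ∫⁻ u, g u ∂(quenchedLaw f m x s n y) ≤
      ∫⁻ u, g u ∂(quenchedLaw f m x s n y') + mergingBound η R ρ N x s n (dist y y')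

/-- Oscillation at scale D is multiplied by 1 - η in every block of N steps, the attempt being the
last step of the block; the first half of the time brings the starting points within D. -/
theorem exists_hasMergingTime [IsProbabilityMeasure m]
    (hf : Measurable fun p : E × F × V => f p.1 p.2.1 p.2.2)
    (hc : ContractiveModConst f R ρ) (hm : LocalMinorization f m R ρ η) :
    ∃ N : ℕ, 0 < N ∧ HasMergingTime f m R ρ η N := by
  obtain ⟨D, hD, hatt⟩ := exists_mergesWithin_attempt hf hc hm
  have h1ρ : 0 < 1 - ρ := by linarith [hc.ρ_lt_one]
  have hρ := hc.ρ_pos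
  have hR := hc.R_pos
  have hRρ : 0 < R / (1 - ρ) := div_pos hR h1ρ
  have h2 : 2 * R / (1 - ρ) = R / (1 - ρ) + R / (1 - ρ) := by ring
  have hDpos : 0 < D := by linarith
  -- N₀ synchronous steps bring points from distance D to within 2R/(1-ρ).
  obtain ⟨N₀, hN₀⟩ := exists_pow_lt_of_lt_one (div_pos hRρ hDpos) hc.ρ_lt_one
  have hND : ρ ^ N₀ * D + R / (1 - ρ) ≤ 2 * R / (1 - ρ) := by
    rw [lt_div_iff₀ hDpos] at hN₀
    linarith
  have hblock : ∀ (x : ℤ → F) (s : ℤ) (g : E → ℝ≥0∞) (c : ℝ≥0∞), Measurable g →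
      MergesWithin g D c → MergesWithin (fun y => ∫⁻ u, g u ∂(quenchedLaw f m x s (N₀ + 1) y)) D
        (ENNReal.ofReal (1 - η (x (s + N₀))) * c) := by
    intro x s g c hg hgD
    simp_rw [lintegral_quenchedLaw_succ hf x s N₀ _ hg]
    refine MergesWithin.quenchedLaw hf hc x s N₀ ?_ (hatt (x (s + N₀)) g c hg hgD) hND
    exact (hg.comp (hf.comp (measurable_fst.prodMk
        (measurable_const.prodMk measurable_snd)))).lintegral_prod_right'
  have hblocks : ∀ (x : ℤ → F) (s : ℤ) (q : ℕ) (g : E → ℝ≥0∞) (c : ℝ≥0∞), Measurable g →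
      MergesWithin g D c →
      MergesWithin (fun y => ∫⁻ u, g u ∂(quenchedLaw f m x s (q * (N₀ + 1)) y)) D
        ((∏ j ∈ Finset.Icc 1 q, ENNReal.ofReal (1 - η (x (s + ((j * (N₀ + 1) - 1 : ℕ) : ℤ))))) * c) := by
    intro x s q
    induction q with
    | zero =>
      intro g c hg hgD
      simpa [quenchedLaw_zero, lintegral_dirac' _ hg] using hgD
    | succ q ih =>
      intro g c hg hgD
      -- Test functions are pulled back from the final time, so the last block is treated first and
      -- the induction hypothesis handles the earlier ones.
      rw [Nat.succ_mul]
      simp_rw [lintegral_quenchedLaw_add x s (q * (N₀ + 1)) (N₀ + 1) _ hg]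
      have := ih _ _ (measurable_lintegral_quenchedLaw x _ (N₀ + 1) hg)
        (hblock x (s + (q * (N₀ + 1) : ℕ)) g c hg hgD)
      rw [Finset.prod_Icc_succ_top (by omega), mul_assoc]
      convert this using 7
      have : (q + 1) * (N₀ + 1) - 1 = q * (N₀ + 1) + N₀ := by
        rw [Nat.succ_mul]; omega
      rw [this]
      push_cast
      ring
  refine ⟨N₀ + 1, by omega, ?_⟩
  intro x s n y y' g hg hg1
  have := isProbabilityMeasure_quenchedLaw (m := m) hf x s n y
  rcases le_or_gt (R / ρ ^ (n / 2)) (dist y y') with h | h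
  · refine (lintegral_le_one hg1).trans ?_
    rw [mergingBound, if_pos h]
    exact le_add_left le_self_add
  · rw [mergingBound, if_neg (not_le.2 h), zero_add]
    set q := ((n + 1) / 2) / (N₀ + 1) with hq
    have hqn : q * (N₀ + 1) ≤ (n + 1) / 2 := Nat.div_mul_le_self _ _
    set r := (n + 1) / 2 - q * (N₀ + 1) with hr
    -- Contraction for n/2 steps, then q blocks, then r leftover steps for which the trivial
    -- oscillation bound 1 suffices.
    have hn : n = n / 2 + (q * (N₀ + 1) + r) := by omega
    have hD1 : MergesWithin (fun z => ∫⁻ u, g u ∂(quenchedLaw f m x (s + (n / 2 : ℕ) +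
        (q * (N₀ + 1) : ℕ)) r z)) D 1 := by
      intro y₁ y₂ _
      have := isProbabilityMeasure_quenchedLaw (m := m) hf x (s + (n / 2 : ℕ) +
        (q * (N₀ + 1) : ℕ)) r y₁
      exact le_add_left (lintegral_le_one hg1)
    have hD2 := hblocks x (s + (n / 2 : ℕ)) q _ _ (measurable_lintegral_quenchedLaw x _ r hg) hD1
    have hD3 := MergesWithin.quenchedLaw (m := m) hf hc x s (n / 2)
      (measurable_lintegral_quenchedLaw x _ _ (measurable_lintegral_quenchedLaw x _ r hg)) hD2
      (r := dist y y') ?_ y y' le_rfl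
    · simp_rw [← lintegral_quenchedLaw_add x _ _ _ _ hg, ← hn] at hD3
      refine hD3.trans ?_
      gcongr
      rw [mul_one]
      refine le_of_eq (Finset.prod_congr rfl fun j hj => ?_)
      have hj1 := (Finset.mem_Icc.1 hj).1
      have : 1 ≤ j * (N₀ + 1) := Nat.one_le_iff_ne_zero.2 (by positivity)
      rw [Nat.add_sub_assoc this]
      push_cast
      rw [add_assoc]
    -- After the first half the distance is below R + R/(1-ρ) ≤ 2R/(1-ρ) ≤ D.
    · rw [lt_div_iff₀ (pow_pos hρ _)] at h
      have : R ≤ R / (1 - ρ) := by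
        rw [le_div_iff₀ h1ρ]; nlinarith
      linarith

end Merging

/-! ### Common parts of measures, couplings and total variation -/

section Decomposition

/-- Two finite measures are the sum of a common part and two mutually singular parts. -/
theorem exists_common_part {S : Type*} [MeasurableSpace S] (μ ν : Measure S) [IsFiniteMeasure μ]
    [IsFiniteMeasure ν] :
    ∃ γ α β : Measure S, γ + α = μ ∧ γ + β = ν ∧
      ∃ B, MeasurableSet B ∧ α Bᶜ = 0 ∧ β B = 0 := by
  -- On B one has ν ≤ μ, off B the reverse, so the minimum of the two measures is ν on B and μ off
  -- B.
  obtain ⟨B, hB⟩ := exists_isHahnDecomposition ν μ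
  have hBm := hB.measurableSet
  refine ⟨ν.restrict B + μ.restrict Bᶜ, μ.restrict B - ν.restrict B,
    ν.restrict Bᶜ - μ.restrict Bᶜ, ?_, ?_, B, hBm, ?_, ?_⟩
  · rw [add_comm (ν.restrict B), add_assoc, add_comm (ν.restrict B),
      Measure.sub_add_cancel_of_le hB.le_on, add_comm, Measure.restrict_add_restrict_compl hBm]
  · rw [add_assoc, add_comm (μ.restrict Bᶜ), Measure.sub_add_cancel_of_le hB.ge_on_compl,
      Measure.restrict_add_restrict_compl hBm]
  · exact le_antisymm ((Measure.sub_le Bᶜ).trans (by simp [Measure.restrict_apply hBm.compl]))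
      zero_le
  · exact le_antisymm ((Measure.sub_le B).trans (by simp [Measure.restrict_apply hBm])) zero_le

/-- A decomposition of an image measure lifts to the measure itself. -/
theorem exists_lift_of_map_eq_add {S W : Type*} [MeasurableSpace S] [MeasurableSpace W]
    {L : Measure S} [IsFiniteMeasure L] {φ : S → W} (hφ : Measurable φ) {γ α : Measure W}
    (h : γ + α = L.map φ) :
    ∃ M M' : Measure S, M + M' = L ∧ M.map φ = γ ∧ M'.map φ = α := by
  have hle : γ ≤ L.map φ := h ▸ Measure.le_add_right le_rfl
  have : IsFiniteMeasure γ := isFiniteMeasure_of_le _ hle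
  obtain ⟨a, ham, ha1, -, hag⟩ := exists_density_of_le hle MeasurableSet.univ (by simp)
  have hφa : Measurable fun s => a (φ s) := ham.comp hφ
  have h1 : (L.withDensity fun s => a (φ s)).map φ = γ := by
    ext A hA
    rw [Measure.map_apply hφ hA, withDensity_apply _ (hφ hA), ← lintegral_indicator (hφ hA)]
    have := hag (A.indicator 1) (measurable_one.indicator hA)
    rw [lintegral_map (by fun_prop) hφ, lintegral_indicator_one hA] at this
    rw [← this]
    refine lintegral_congr fun s => ?_
    by_cases hs : φ s ∈ A <;> simp [Set.indicator, hs]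
  have h2 : (L.withDensity fun s => a (φ s)) + (L.withDensity fun s => 1 - a (φ s)) = L := by
    rw [← withDensity_add_left hφa]
    convert withDensity_one (μ := L) using 2
    ext s
    simp [add_tsub_cancel_of_le (ha1 (φ s))]
  refine ⟨_, _, h2, h1, ?_⟩
  have h3 := congrArg (fun μ => μ.map φ) h2
  simp only [Measure.map_add _ _ hφ, h1] at h3
  rw [← h] at h3
  exact (Measure.add_right_inj _ _ _).1 h3

/-- Two measures with the same image under `φ` admit a coupling living on `{φ s = φ s'}`. -/
theorem exists_coupling_of_map_eq {S W : Type*} [MeasurableSpace S] [StandardBorelSpace S]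
    [MeasurableSpace W] [StandardBorelSpace W] {M M' : Measure S} [IsFiniteMeasure M]
    [IsFiniteMeasure M'] {φ : S → W} (hφ : Measurable φ) (h : M.map φ = M'.map φ) :
    ∃ κ : Measure (S × S), κ.map Prod.fst = M ∧ κ.map Prod.snd = M' ∧
      ∀ᵐ p ∂κ, φ p.1 = φ p.2 := by
  rcases isEmpty_or_nonempty S with hS | hS
  · exact ⟨0, by simp [Measure.eq_zero_of_isEmpty M], by simp [Measure.eq_zero_of_isEmpty M'],
      by simp⟩
  -- Both measures are disintegrated over φ; the coupling draws the two points conditionally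
  -- independently above a common value of φ.
  have key : ∀ M : Measure S, IsFiniteMeasure M → ∃ k : Kernel W S, IsMarkovKernel k ∧
      (M.map φ) ⊗ₘ k = M.map fun s => (φ s, s) := by
    intro M _
    refine ⟨(M.map fun s => (φ s, s)).condKernel, inferInstance, ?_⟩
    have : (M.map fun s => (φ s, s)).fst = M.map φ := by
      rw [Measure.fst, Measure.map_map measurable_fst (by fun_prop)]
      rfl
    rw [← this]
    exact Measure.disintegrate _ _
  obtain ⟨k, hk, hkM⟩ := key M inferInstance
  obtain ⟨k', hk', hkM'⟩ := key M' inferInstance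
  have hgm : Measurable fun s => (φ s, s) := hφ.prodMk measurable_id
  set ν := M.map φ with hν
  have hf : (ν ⊗ₘ (k ×ₖ k')).map (fun q : W × S × S => (q.1, q.2.1)) =
      M.map fun s => (φ s, s) := by
    rw [← hkM]
    have : (fun q : W × S × S => (q.1, q.2.1)) = Prod.map id Prod.fst := rfl
    rw [this, ← Measure.compProd_map measurable_fst, ← Kernel.fst_eq, Kernel.fst_prod]
  have hs : (ν ⊗ₘ (k ×ₖ k')).map (fun q : W × S × S => (q.1, q.2.2)) =
      M'.map fun s => (φ s, s) := by
    rw [← hkM', ← h]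
    have : (fun q : W × S × S => (q.1, q.2.2)) = Prod.map id Prod.snd := rfl
    rw [this, ← Measure.compProd_map measurable_snd, ← Kernel.snd_eq, Kernel.snd_prod]
  have hae : ∀ (N : Measure S), ∀ᵐ q ∂(N.map fun s => (φ s, s)), φ q.2 = q.1 := by
    intro N
    rw [ae_map_iff hgm.aemeasurable (measurableSet_eq_fun (by fun_prop) (by fun_prop))]
    simp
  refine ⟨(ν ⊗ₘ (k ×ₖ k')).map Prod.snd, ?_, ?_, ?_⟩
  · have := congrArg (fun N => N.map Prod.snd) hf
    rw [Measure.map_map measurable_snd (by fun_prop), Measure.map_map measurable_snd hgm] at this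
    rw [Measure.map_map measurable_fst measurable_snd]
    exact this.trans Measure.map_id
  · have := congrArg (fun N => N.map Prod.snd) hs
    rw [Measure.map_map measurable_snd (by fun_prop), Measure.map_map measurable_snd hgm] at this
    rw [Measure.map_map measurable_snd measurable_snd]
    exact this.trans Measure.map_id
  · rw [ae_map_iff measurable_snd.aemeasurable (measurableSet_eq_fun (by fun_prop) (by fun_prop))]
    have h1 := hae M
    rw [← hf] at h1
    have h2 := hae M'
    rw [← hs] at h2
    filter_upwards [ae_of_ae_map (by fun_prop) h1, ae_of_ae_map (by fun_prop) h2] with q h1 h2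
    exact h1.trans h2.symm

end Decomposition

/-- Total variation is dominated by the supremum of the differences on events. -/
theorem tvDist_le_of_forall {E : Type*} [MeasurableSpace E] [MeasurableEq E]
    {μ ν : Measure E} [IsProbabilityMeasure μ] [IsProbabilityMeasure ν] {c : ℝ≥0∞}
    (h : ∀ A, MeasurableSet A → μ A ≤ ν A + c) : tvDist μ ν ≤ c := by
  obtain ⟨γ, α, β, h1, h2, B, hB, hαB, hβB⟩ := exists_common_part μ ν
  have hγ : IsFiniteMeasure γ := isFiniteMeasure_of_le μ (h1 ▸ Measure.le_add_right le_rfl)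
  have hα : IsFiniteMeasure α := isFiniteMeasure_of_le μ (h1 ▸ Measure.le_add_left le_rfl)
  have hβ : IsFiniteMeasure β := isFiniteMeasure_of_le ν (h2 ▸ Measure.le_add_left le_rfl)
  have hαuniv : α Set.univ ≤ c := by
    have e1 : α Set.univ = α B := by
      rw [← measure_add_measure_compl hB, hαB, add_zero]
    have e2 := h B hB
    rw [← h1, ← h2, Measure.add_apply, Measure.add_apply, hβB, add_zero] at e2
    rw [e1]
    exact ENNReal.le_of_add_le_add_left (measure_ne_top γ B) e2
  have hαβ : α Set.univ = β Set.univ := by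
    have e1 : μ Set.univ = ν Set.univ := by simp
    rw [← h1, ← h2, Measure.add_apply, Measure.add_apply] at e1
    exact (ENNReal.add_right_inj (measure_ne_top γ _)).1 e1
  have hdiag : Measurable fun u : E => (u, u) := measurable_id.prodMk measurable_id
  have hne : MeasurableSet {p : E × E | p.1 ≠ p.2} :=
    (measurableSet_eq_fun measurable_fst measurable_snd).compl
  set a := α Set.univ with ha
  have ha_top : a ≠ ∞ := measure_ne_top _ _
  -- The common part stays on the diagonal and the excesses, of equal mass a, are coupled
  -- independently. If a = 0 the infinite factor a⁻¹ is harmless because both excesses vanish.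
  set κ : Measure (E × E) := γ.map (fun u => (u, u)) + a⁻¹ • α.prod β with hκ
  have hsing : a ≠ 0 ∨ (α = 0 ∧ β = 0) := by
    by_cases h0 : a = 0
    · exact Or.inr ⟨Measure.measure_univ_eq_zero.1 h0, Measure.measure_univ_eq_zero.1 (hαβ ▸ h0)⟩
    · exact Or.inl h0
  have hfst : κ.map Prod.fst = μ := by
    rw [hκ, Measure.map_add _ _ measurable_fst, Measure.map_map measurable_fst hdiag,
      Measure.map_smul, Measure.map_fst_prod, ← hαβ, ← h1]
    congr 1
    · exact Measure.map_id
    · rcases hsing with h0 | ⟨h0, -⟩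
      · rw [smul_smul, ENNReal.inv_mul_cancel h0 ha_top, one_smul]
      · simp [h0]
  have hsnd : κ.map Prod.snd = ν := by
    rw [hκ, Measure.map_add _ _ measurable_snd, Measure.map_map measurable_snd hdiag,
      Measure.map_smul, Measure.map_snd_prod, ← ha, ← h2]
    congr 1
    · exact Measure.map_id
    · rcases hsing with h0 | ⟨-, h0⟩
      · rw [smul_smul, ENNReal.inv_mul_cancel h0 ha_top, one_smul]
      · simp [h0]
  refine (iInf₂_le κ ⟨hfst, hsnd⟩).trans ?_
  · rw [hκ, Measure.add_apply, Measure.map_apply hdiag hne]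
    simp only [Set.preimage_ofPred_eq, ne_eq, not_true_eq_false, Set.ofPred_false,
      measure_empty, zero_add, Measure.smul_apply, smul_eq_mul]
    calc a⁻¹ * (α.prod β) {p | ¬ p.1 = p.2} ≤ a⁻¹ * (α.prod β) Set.univ := by
          gcongr; exact Set.subset_univ _
      _ = a⁻¹ * a * a := by
          rw [← Set.univ_prod_univ, Measure.prod_prod, ← hαβ, ← ha, mul_assoc]
      _ ≤ 1 * a := by gcongr; exact ENNReal.inv_mul_le_one a
      _ ≤ c := by rwa [one_mul]

/-- A sequence of probability measures that is uniformly Cauchy on events has a limit. -/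
theorem exists_limit_of_uniform_cauchy {E : Type*} [MeasurableSpace E] {μ : ℕ → Measure E}
    (hμ : ∀ n, IsProbabilityMeasure (μ n)) {c : ℕ → ℝ≥0∞} (hc : Tendsto c atTop (𝓝 0))
    (h : ∀ n p A, MeasurableSet A → μ (n + p) A ≤ μ n A + c n) :
    ∃ π : Measure E, IsProbabilityMeasure π ∧
      (∀ n A, MeasurableSet A → π A ≤ μ n A + c n) ∧
      (∀ n A, MeasurableSet A → μ n A ≤ π A + c n) := by
  -- Passing to complements reverses the inequality.
  have h' : ∀ n p A, MeasurableSet A → μ n A ≤ μ (n + p) A + c n := by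
    intro n p A hA
    have h1 := h n p Aᶜ hA.compl
    rw [prob_compl_eq_one_sub hA, prob_compl_eq_one_sub hA] at h1
    rw [tsub_le_iff_right, add_right_comm] at h1
    have h2 : 1 - μ n A + μ n A = 1 := tsub_add_cancel_of_le prob_le_one
    have h3 : 1 - μ n A + μ n A ≤ 1 - μ n A + (c n + μ (n + p) A) := by
      rw [h2, add_comm (c n), ← add_assoc]; exact h1
    rw [add_comm]
    exact ENNReal.le_of_add_le_add_left (by simp) h3
  have hlim : ∀ A, MeasurableSet A → Tendsto (fun n => μ n A) atTop
      (𝓝 (limsup (fun n => μ n A) atTop)) := by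
    intro A hA
    refine tendsto_of_le_liminf_of_limsup_le ?_ le_rfl
    have h1 : ∀ n, limsup (fun n => μ n A) atTop ≤ μ n A + c n := fun n =>
      limsup_le_of_le (by isBoundedDefault) (eventually_atTop.2 ⟨n, fun k hk => by
        obtain ⟨p, rfl⟩ := Nat.exists_eq_add_of_le hk
        exact h n p A hA⟩)
    have h2 : Tendsto (fun n => limsup (fun n => μ n A) atTop - c n) atTop
        (𝓝 (limsup (fun n => μ n A) atTop)) := by
      have := ENNReal.Tendsto.sub (tendsto_const_nhds (x := limsup (fun n => μ n A) atTop)) hc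
        (Or.inr ENNReal.zero_ne_top)
      rwa [tsub_zero] at this
    rw [← h2.liminf_eq]
    exact liminf_le_liminf (Eventually.of_forall fun n => tsub_le_iff_right.2 (h1 n))
  set v : Set E → ℝ≥0∞ := fun A => limsup (fun n => μ n A) atTop with hv
  have hv1 : ∀ n A, MeasurableSet A → v A ≤ μ n A + c n := fun n A hA =>
    le_of_tendsto (hlim A hA) (eventually_atTop.2 ⟨n, fun k hk => by
      obtain ⟨p, rfl⟩ := Nat.exists_eq_add_of_le hk
      exact h n p A hA⟩)
  have hv2 : ∀ n A, MeasurableSet A → μ n A ≤ v A + c n := fun n A hA =>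
    ge_of_tendsto ((hlim A hA).add_const (c n)) (eventually_atTop.2 ⟨n, fun k hk => by
      obtain ⟨p, rfl⟩ := Nat.exists_eq_add_of_le hk
      exact h' n p A hA⟩)
  have hadd : ∀ A B, MeasurableSet A → MeasurableSet B → Disjoint A B →
      v (A ∪ B) = v A + v B := by
    intro A B hA hB hAB
    refine tendsto_nhds_unique (hlim _ (hA.union hB)) ?_
    simp_rw [measure_union hAB hB]
    exact (hlim A hA).add (hlim B hB)
  have hempty : v ∅ = 0 := by simp [hv]
  have hsum : ∀ (A : ℕ → Set E), (∀ i, MeasurableSet (A i)) → Pairwise (Function.onFun Disjoint A) →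
      v (⋃ i, A i) = ∑' i, v (A i) := by
    intro A hA hAd
    set tail : ℕ → Set E := fun k => ⋃ i ≥ k, A i with htail
    have htm : ∀ k, MeasurableSet (tail k) := fun k =>
      MeasurableSet.iUnion fun i => MeasurableSet.iUnion fun _ => hA i
    have hsplit : ∀ k, v (⋃ i, A i) = ∑ i ∈ Finset.range k, v (A i) + v (tail k) := by
      intro k
      induction k with
      | zero => simp [htail]
      | succ k ih =>
        have hd : Disjoint (A k) (tail (k + 1)) := by
          simp only [htail, Set.disjoint_iUnion_right]
          intro i hi
          exact hAd (by omega)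
        have hu : tail k = A k ∪ tail (k + 1) := by
          ext u
          simp only [htail, Set.mem_iUnion, Set.mem_union]
          constructor
          · rintro ⟨i, hi, hu⟩
            rcases Nat.eq_or_lt_of_le hi with rfl | hlt
            · exact Or.inl hu
            · exact Or.inr ⟨i, hlt, hu⟩
          · rintro (hu | ⟨i, hi, hu⟩)
            · exact ⟨k, le_rfl, hu⟩
            · exact ⟨i, Nat.le_of_succ_le hi, hu⟩
        rw [ih, hu, hadd _ _ (hA k) (htm _) hd, Finset.sum_range_succ, add_assoc]
    -- Countable additivity of the limit: the error c n is uniform over events, so continuity at ∅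
    -- of a single μ n controls the tails.
    have htail0 : Tendsto (fun k => v (tail k)) atTop (𝓝 0) := by
      refine ENNReal.tendsto_nhds_zero.2 fun ε hε => ?_
      obtain ⟨n, hn⟩ := (ENNReal.tendsto_nhds_zero.1 hc (ε / 2)
        (ENNReal.half_pos hε.ne')).exists
      have hmt : Tendsto (fun k => μ n (tail k)) atTop (𝓝 0) := by
        have hanti : Antitone tail := fun a b hab =>
          Set.biUnion_subset_biUnion_left fun i hi => le_trans hab hi
        have hint : ⋂ k, tail k = ∅ := by
          rw [Set.eq_empty_iff_forall_notMem]
          intro u hu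
          simp only [htail, Set.mem_iInter, Set.mem_iUnion] at hu
          obtain ⟨i, -, hi⟩ := hu 0
          obtain ⟨j, hj, hj'⟩ := hu (i + 1)
          exact Set.disjoint_left.1 (hAd (show i ≠ j by omega)) hi hj'
        have := tendsto_measure_iInter_atTop (μ := μ n) (fun k => (htm k).nullMeasurableSet) hanti
          ⟨0, measure_ne_top _ _⟩
        rwa [hint, measure_empty] at this
      filter_upwards [ENNReal.tendsto_nhds_zero.1 hmt (ε / 2) (ENNReal.half_pos hε.ne')] with k hk
      calc v (tail k) ≤ μ n (tail k) + c n := hv1 n _ (htm k)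
        _ ≤ ε / 2 + ε / 2 := by gcongr
        _ = ε := ENNReal.add_halves ε
    refine tendsto_nhds_unique (f := fun k : ℕ => v (⋃ i, A i)) (l := atTop) tendsto_const_nhds ?_
    refine ((ENNReal.tendsto_nat_tsum fun i => v (A i)).add htail0).congr' ?_ |>.trans (by simp)
    exact Eventually.of_forall fun k => (hsplit k).symm
  refine ⟨Measure.ofMeasurable (fun A _ => v A) hempty fun A hA hd => hsum A hA hd, ⟨?_⟩, ?_, ?_⟩
  · rw [Measure.ofMeasurable_apply _ MeasurableSet.univ]
    simp [hv]
  · intro n A hA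
    rw [Measure.ofMeasurable_apply _ hA]
    exact hv1 n A hA
  · intro n A hA
    rw [Measure.ofMeasurable_apply _ hA]
    exact hv2 n A hA

/-! ### A coupling that is maximal at all times simultaneously -/

section MaximalCoupling

/-- The common part of the two images is lifted to S and removed. Nothing further can be matched,
since the images of what is left are mutually singular. -/
theorem exists_split_step {S W : Type*} [MeasurableSpace S] [MeasurableSpace W]
    (R R' : Measure S) [IsFiniteMeasure R] [IsFiniteMeasure R'] {φ : S → W} (hφ : Measurable φ) :
    ∃ M M' R₁ R₁' : Measure S, M + R₁ = R ∧ M' + R₁' = R' ∧ M.map φ = M'.map φ ∧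
      ∃ B, MeasurableSet B ∧ R₁ (φ ⁻¹' Bᶜ) = 0 ∧ R₁' (φ ⁻¹' B) = 0 := by
  obtain ⟨γ, α, β, h1, h2, B, hB, hα, hβ⟩ := exists_common_part (R.map φ) (R'.map φ)
  obtain ⟨M, R₁, hM, hMγ, hRα⟩ := exists_lift_of_map_eq_add hφ h1
  obtain ⟨M', R₁', hM', hMγ', hRβ⟩ := exists_lift_of_map_eq_add hφ h2
  refine ⟨M, M', R₁, R₁', hM, hM', hMγ.trans hMγ'.symm, B, hB, ?_, ?_⟩
  · rw [← Measure.map_apply hφ hB.compl, hRα, hα]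
  · rw [← Measure.map_apply hφ hB, hRβ, hβ]

/-- The residual part of a measure after removing the terms of a series bounded by it. -/
theorem exists_residual {S : Type*} [MeasurableSpace S] {L : Measure S} [IsFiniteMeasure L]
    {M r : ℕ → Measure S} (h : ∀ n, ∑ j ∈ Finset.range n, M j + r n = L) :
    ∃ ρ : Measure S, Measure.sum M + ρ = L := by
  have hle : Measure.sum M ≤ L := by
    refine Measure.le_iff.2 fun A hA => ?_
    rw [Measure.sum_apply _ hA]
    refine ENNReal.tsum_le_of_sum_range_le fun n => ?_
    rw [← h n, Measure.add_apply, Measure.finsetSum_apply]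
    exact le_self_add
  have : IsFiniteMeasure (Measure.sum M) := isFiniteMeasure_of_le L hle
  exact ⟨L - Measure.sum M, by rw [add_comm]; exact Measure.sub_add_cancel_of_le hle⟩

/-- Bookkeeping for unmerged mass: the first n pieces do not charge D, and the marginals of all
later pieces, together with ρ, add up to the residual r on C. -/
theorem sum_add_apply_le_residual {S T : Type*} [MeasurableSpace S] [MeasurableSpace T]
    {κ : ℕ → Measure T} {κ' : Measure T} {M : ℕ → Measure S} {ρ r L : Measure S}
    [hM : ∀ j, IsFiniteMeasure (M j)] {n : ℕ} (hsum : ∑ j ∈ Finset.range n, M j + r = L)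
    (hρ : Measure.sum M + ρ = L) {D : Set T} {C : Set S} (hD : MeasurableSet D)
    (hC : MeasurableSet C) (hzero : ∀ j < n, κ j D = 0) (hle : ∀ j, κ j D ≤ M j C)
    (hle' : κ' D ≤ ρ C) : (Measure.sum κ + κ') D ≤ r C := by
  have hkey : ∑ j ∈ Finset.range n, M j C + (Measure.sum κ + κ') D ≤
      ∑ j ∈ Finset.range n, M j C + r C := by
    have e1 : (Measure.sum κ + κ') D = ∑' j, κ (j + n) D + κ' D := by
      rw [Measure.add_apply, Measure.sum_apply _ hD,
        ← Summable.sum_add_tsum_nat_add' (f := fun j => κ j D) (k := n) ENNReal.summable,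
        Finset.sum_eq_zero fun j hj => hzero j (Finset.mem_range.1 hj), zero_add]
    have e2 : (Measure.sum M + ρ) C = ∑ j ∈ Finset.range n, M j C +
        (∑' j, M (j + n) C + ρ C) := by
      rw [Measure.add_apply, Measure.sum_apply _ hC, ← add_assoc,
        Summable.sum_add_tsum_nat_add' (f := fun j => M j C) (k := n) ENNReal.summable]
    have e3 : (Measure.sum M + ρ) C = ∑ j ∈ Finset.range n, M j C + r C := by
      rw [hρ, ← hsum, Measure.add_apply, Measure.finsetSum_apply]
    rw [← e3, e2, e1]
    gcongr with j
    exact hle _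
  exact ENNReal.le_of_add_le_add_left (ENNReal.sum_ne_top.2 fun j _ => measure_ne_top (M j) _) hkey

/-- Maximal coupling along the iterates of `ψ`: the event that the iterates of order `n` have not
merged has the smallest possible probability, simultaneously for all `n`. The map `χ` is an
invariant of `ψ` and the coupling lives above its diagonal. -/
theorem exists_maximal_coupling {S X : Type*} [MeasurableSpace S] [StandardBorelSpace S]
    [MeasurableSpace X] [StandardBorelSpace X] {L L' : Measure S} [IsFiniteMeasure L]
    [IsFiniteMeasure L'] {ψ : S → S} (hψ : Measurable ψ) {χ : S → X} (hχ : Measurable χ)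
    (hχψ : ∀ s, χ (ψ s) = χ s) (h : L.map χ = L'.map χ) :
    ∃ κ : Measure (S × S), κ.map Prod.fst = L ∧ κ.map Prod.snd = L' ∧
      (∀ᵐ p ∂κ, χ p.1 = χ p.2) ∧
      ∀ n : ℕ, ∃ B, MeasurableSet B ∧ ∀ A, MeasurableSet A →
        κ {p | ψ^[n] p.1 ≠ ψ^[n] p.2 ∧ χ p.1 ∈ A} + L' {s | ψ^[n] s ∈ B ∧ χ s ∈ A} ≤
          L {s | ψ^[n] s ∈ B ∧ χ s ∈ A} := by
  have hψn : ∀ n, Measurable (ψ^[n]) := fun n => hψ.iterate n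
  have hχn : ∀ n s, χ (ψ^[n] s) = χ s := by
    intro n s
    induction n generalizing s with
    | zero => rfl
    | succ n ih => rw [Function.iterate_succ_apply, ih, hχψ]
  -- Greedy extraction: at stage n, as much as possible of the current residuals is matched through
  -- ψ^[n].
  have step : ∀ (n : ℕ) (p : {p : Measure S × Measure S // IsFiniteMeasure p.1 ∧ IsFiniteMeasure p.2}),
      ∃ (q : Measure S × Measure S)
        (p' : {p : Measure S × Measure S // IsFiniteMeasure p.1 ∧ IsFiniteMeasure p.2}) (B : Set S),
        q.1 + p'.1.1 = p.1.1 ∧ q.2 + p'.1.2 = p.1.2 ∧ q.1.map (ψ^[n]) = q.2.map (ψ^[n]) ∧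
        MeasurableSet B ∧ p'.1.1 (ψ^[n] ⁻¹' Bᶜ) = 0 ∧ p'.1.2 (ψ^[n] ⁻¹' B) = 0 := by
    rintro n ⟨⟨R, R'⟩, hR, hR'⟩
    obtain ⟨M, M', R₁, R₁', h1, h2, h3, B, hB, h4, h5⟩ := exists_split_step R R' (hψn n)
    exact ⟨(M, M'), ⟨(R₁, R₁'), isFiniteMeasure_of_le R (h1 ▸ Measure.le_add_left le_rfl),
      isFiniteMeasure_of_le R' (h2 ▸ Measure.le_add_left le_rfl)⟩, B, h1, h2, h3, hB, h4, h5⟩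
  choose Q next Bs hQ1 hQ2 hQ3 hBs hB1 hB2 using step
  set r : ℕ → {p : Measure S × Measure S // IsFiniteMeasure p.1 ∧ IsFiniteMeasure p.2} :=
    fun n => Nat.rec ⟨(L, L'), inferInstance, inferInstance⟩ (fun n p => next n p) n with hr
  have hrs : ∀ n, r (n + 1) = next n (r n) := fun n => rfl
  have hfin1 : ∀ n, IsFiniteMeasure (r n).1.1 := fun n => (r n).2.1
  have hfin2 : ∀ n, IsFiniteMeasure (r n).1.2 := fun n => (r n).2.2
  set M : ℕ → Measure S := fun n => (Q n (r n)).1 with hM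
  set M' : ℕ → Measure S := fun n => (Q n (r n)).2 with hM'
  have hMr : ∀ n, M n + (r (n + 1)).1.1 = (r n).1.1 := fun n => hQ1 n (r n)
  have hMr' : ∀ n, M' n + (r (n + 1)).1.2 = (r n).1.2 := fun n => hQ2 n (r n)
  have hMM : ∀ n, (M n).map (ψ^[n]) = (M' n).map (ψ^[n]) := fun n => hQ3 n (r n)
  have hsum : ∀ n, ∑ j ∈ Finset.range n, M j + (r n).1.1 = L := by
    intro n
    induction n with
    | zero => simp [hr]
    | succ n ih => rw [Finset.sum_range_succ, add_assoc, hMr, ih]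
  have hsum' : ∀ n, ∑ j ∈ Finset.range n, M' j + (r n).1.2 = L' := by
    intro n
    induction n with
    | zero => simp [hr]
    | succ n ih => rw [Finset.sum_range_succ, add_assoc, hMr', ih]
  have hMfin : ∀ n, IsFiniteMeasure (M n) := fun n =>
    isFiniteMeasure_of_le (r n).1.1 (hMr n ▸ Measure.le_add_right le_rfl)
  have hMfin' : ∀ n, IsFiniteMeasure (M' n) := fun n =>
    isFiniteMeasure_of_le (r n).1.2 (hMr' n ▸ Measure.le_add_right le_rfl)
  obtain ⟨ρ, hρ⟩ := exists_residual hsum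
  obtain ⟨ρ', hρ'⟩ := exists_residual hsum'
  have hρfin : IsFiniteMeasure ρ := isFiniteMeasure_of_le L (hρ ▸ Measure.le_add_left le_rfl)
  have hρfin' : IsFiniteMeasure ρ' := isFiniteMeasure_of_le L' (hρ' ▸ Measure.le_add_left le_rfl)
  -- Pieces that have merged remain merged under further iteration.
  have hMfac : ∀ j k, j ≤ k → (M j).map (ψ^[k]) = (M' j).map (ψ^[k]) := by
    intro j k hjk
    obtain ⟨d, rfl⟩ := Nat.exists_eq_add_of_le hjk
    rw [add_comm j d, Function.iterate_add, ← Measure.map_map (hψn d) (hψn j),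
      ← Measure.map_map (hψn d) (hψn j), hMM]
  have hMχ : ∀ j, (M j).map χ = (M' j).map χ := by
    intro j
    have : χ = χ ∘ ψ^[j] := funext fun s => (hχn j s).symm
    rw [this, ← Measure.map_map hχ (hψn j), ← Measure.map_map hχ (hψn j), hMM]
  have hρχ : ρ.map χ = ρ'.map χ := by
    have e1 : (Measure.sum M).map χ + ρ.map χ = (Measure.sum M').map χ + ρ'.map χ := by
      rw [← Measure.map_add _ _ hχ, ← Measure.map_add _ _ hχ, hρ, hρ', h]
    have e2 : (Measure.sum M).map χ = (Measure.sum M').map χ := by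
      rw [Measure.map_sum hχ.aemeasurable, Measure.map_sum hχ.aemeasurable]
      simp_rw [hMχ]
    have : IsFiniteMeasure (Measure.sum M') :=
      isFiniteMeasure_of_le L' (hρ' ▸ Measure.le_add_right le_rfl)
    rw [e2] at e1
    exact (Measure.add_right_inj _ _ _).1 e1
  have hcoup := fun j => exists_coupling_of_map_eq (hψn j) (hMM j)
  choose κ hκ1 hκ2 hκ3 using hcoup
  -- Mass that is never matched still has equal images under χ, and is coupled above the diagonal of
  -- χ.
  obtain ⟨κr, hκr1, hκr2, hκr3⟩ := exists_coupling_of_map_eq hχ hρχ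
  have hκχ : ∀ j, ∀ᵐ p ∂(κ j), χ p.1 = χ p.2 := by
    intro j
    filter_upwards [hκ3 j] with p hp
    rw [← hχn j p.1, hp, hχn]
  refine ⟨Measure.sum κ + κr, ?_, ?_, ?_, ?_⟩
  · rw [Measure.map_add _ _ measurable_fst, Measure.map_sum measurable_fst.aemeasurable, hκr1]
    simp_rw [hκ1]
    exact hρ
  · rw [Measure.map_add _ _ measurable_snd, Measure.map_sum measurable_snd.aemeasurable, hκr2]
    simp_rw [hκ2]
    exact hρ'
  · rw [ae_add_measure_iff]
    exact ⟨Measure.ae_sum_iff.2 hκχ, hκr3⟩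
  · intro n
    refine ⟨Bs n (r n), hBs n (r n), fun A hA => ?_⟩
    set B := Bs n (r n) with hBdef
    have hBm : MeasurableSet B := hBs n (r n)
    have hr1 : (r (n + 1)).1.1 (ψ^[n] ⁻¹' Bᶜ) = 0 := hB1 n (r n)
    have hr2 : (r (n + 1)).1.2 (ψ^[n] ⁻¹' B) = 0 := hB2 n (r n)
    have hAm : MeasurableSet (χ ⁻¹' A) := hχ hA
    set C : Set S := {s | ψ^[n] s ∈ B ∧ χ s ∈ A} with hC
    have hCm : MeasurableSet C := (hψn n hBm).inter hAm
    set D : Set (S × S) := {p | ψ^[n] p.1 ≠ ψ^[n] p.2 ∧ χ p.1 ∈ A} with hD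
    have hDm : MeasurableSet D :=
      (measurableSet_eq_fun ((hψn n).comp measurable_fst)
        ((hψn n).comp measurable_snd)).compl.inter (measurable_fst hAm)
    -- the part of `C` carried by the merged pieces
    have hMC : ∀ j ≤ n, M j C = M' j C := by
      intro j hj
      have hCeq : C = ψ^[n] ⁻¹' (B ∩ χ ⁻¹' A) := by
        ext s; simp [hC, hχn]
      rw [hCeq, ← Measure.map_apply (hψn n) (hBm.inter hAm),
        ← Measure.map_apply (hψn n) (hBm.inter hAm), hMfac j n hj]
    -- On C the pieces matched up to stage n cancel, and singularity puts the residual of L inside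
    -- ψ^[n] ⁻¹' B and that of L' outside; the gap between L C and L' C is thus exactly residual
    -- mass.
    have hLC : L C = L' C + (r (n + 1)).1.1 (χ ⁻¹' A) := by
      have e1 : (r (n + 1)).1.2 C = 0 := measure_mono_null (fun s hs => hs.1) hr2
      have e2 : (r (n + 1)).1.1 C = (r (n + 1)).1.1 (χ ⁻¹' A) := by
        refine measure_congr ?_
        have : ∀ᵐ s ∂(r (n + 1)).1.1, ψ^[n] s ∈ B := by
          rw [ae_iff]; exact hr1
        filter_upwards [this] with s hs
        exact propext ⟨fun h => h.2, fun h => ⟨hs, h⟩⟩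
      calc L C = (∑ j ∈ Finset.range (n + 1), M j + (r (n + 1)).1.1) C := by rw [hsum]
        _ = (∑ j ∈ Finset.range (n + 1), M' j + (r (n + 1)).1.2) C + (r (n + 1)).1.1 (χ ⁻¹' A) := by
            rw [Measure.add_apply, Measure.add_apply, e1, e2, add_zero, Measure.finsetSum_apply,
              Measure.finsetSum_apply]
            congr 1
            exact Finset.sum_congr rfl fun j hj => hMC j (Nat.lt_succ_iff.1 (Finset.mem_range.1 hj))
        _ = _ := by rw [hsum']
    rw [hLC, add_comm]
    gcongr
    -- the unmerged pieces
    have hfst : ∀ j, κ j D ≤ M j (χ ⁻¹' A) := by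
      intro j
      rw [← hκ1 j, Measure.map_apply measurable_fst hAm]
      exact measure_mono fun p hp => hp.2
    have hzero : ∀ j ≤ n, κ j D = 0 := by
      intro j hj
      refine measure_mono_null (fun p hp => ?_) (hκ3 j)
      intro heq
      obtain ⟨d, rfl⟩ := Nat.exists_eq_add_of_le hj
      apply hp.1
      rw [add_comm j d, Function.iterate_add_apply, Function.iterate_add_apply]
      exact congrArg _ heq
    have hrest : κr D ≤ ρ (χ ⁻¹' A) := by
      rw [← hκr1, Measure.map_apply measurable_fst hAm]
      exact measure_mono fun p hp => hp.2
    exact sum_add_apply_le_residual (hsum (n + 1)) hρ hDm hAm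
      (fun j hj => hzero j (Nat.lt_succ_iff.1 hj)) hfst hrest

end MaximalCoupling

/-! ### Extending a probability space -/

section Extension

/-- A probability space carrying a variable `Z` can be extended by a variable in such a way that
the joint law is a prescribed measure with first marginal the law of `Z`. -/
theorem exists_extension {Ω A B : Type*} [MeasurableSpace Ω] [MeasurableSpace A]
    [MeasurableSpace B] [StandardBorelSpace B] [Nonempty B] (P : Measure Ω) [IsProbabilityMeasure P]
    {Z : Ω → A} (hZ : Measurable Z) (M : Measure (A × B)) [IsProbabilityMeasure M]
    (h : M.map Prod.fst = P.map Z) :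
    ∃ P' : Measure (Ω × B), IsProbabilityMeasure P' ∧ MeasurePreserving Prod.fst P' P ∧
      P'.map (fun ω => (Z ω.1, ω.2)) = M := by
  -- The new variable is drawn from the conditional law under M given the value of Z.
  refine ⟨P ⊗ₘ (M.condKernel.comap Z hZ), inferInstance, ⟨measurable_fst, ?_⟩, ?_⟩
  · exact Measure.fst_compProd _ _
  · have hm : Measurable fun ω : Ω × B => (Z ω.1, ω.2) := by fun_prop
    conv_rhs => rw [← M.disintegrate M.condKernel, Measure.fst, h]
    ext s hs
    rw [Measure.map_apply hm hs, Measure.compProd_apply (hm hs), Measure.compProd_apply hs,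
      lintegral_map (Kernel.measurable_kernel_prodMk_left hs) hZ]
    rfl

end Extension

/-! ### I.i.d. sequences and noise independent of the past -/

section Noise

/-- The law of a one-sided sequence of independent variables of law `m`. -/
noncomputable def noiseLaw {V : Type*} [MeasurableSpace V] (m : Measure V)
    [IsProbabilityMeasure m] : Measure (ℕ → V) :=
  Measure.infinitePi fun _ => m

variable {V : Type*} [MeasurableSpace V] {m : Measure V} [IsProbabilityMeasure m]

instance : IsProbabilityMeasure (noiseLaw m) := by
  rw [noiseLaw]; infer_instance

/-- The sequence with first term removed. -/
def seqTail {V : Type*} (e : ℕ → V) : ℕ → V := fun j => e (j + 1)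

@[fun_prop]
theorem measurable_seqTail : Measurable (seqTail : (ℕ → V) → ℕ → V) :=
  measurable_pi_lambda _ fun j => measurable_pi_apply (j + 1)

theorem noiseLaw_map_cons : (noiseLaw m).map (fun e => (e 0, seqTail e)) = m.prod (noiseLaw m) := by
  set cons : V × (ℕ → V) → ℕ → V := fun p i => Nat.casesOn i p.1 p.2 with hcons
  have hcm : Measurable cons := by
    refine measurable_pi_lambda _ fun i => ?_
    cases i with
    | zero => exact measurable_fst
    | succ i => exact (measurable_pi_apply i).comp measurable_snd
  have key : (m.prod (noiseLaw m)).map cons = noiseLaw m := by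
    refine Measure.eq_infinitePi _ fun s t ht => ?_
    classical
    obtain ⟨n, hn⟩ := s.exists_nat_subset_range
    -- Padding the box with full factors turns its index set into an initial segment, so that
    -- coordinate 0 splits off.
    set t' : ℕ → Set V := fun i => if i ∈ s then t i else Set.univ with ht'
    have ht'm : ∀ i, MeasurableSet (t' i) := fun i => by
      by_cases h : i ∈ s <;> simp [ht', h, ht]
    have hpi : Set.pi (s : Set ℕ) t = Set.pi (Finset.range (n + 1) : Set ℕ) t' := by
      ext e
      simp only [Set.mem_pi, Finset.mem_coe]
      constructor
      · intro h i _
        by_cases hi : i ∈ s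
        · simpa [ht', hi] using h i hi
        · simp [ht', hi]
      · intro h i hi
        have := h i (Finset.range_subset_range.2 (Nat.le_succ n) (hn hi))
        simpa [ht', hi] using this
    have hprod : ∏ i ∈ s, m (t i) = ∏ i ∈ Finset.range (n + 1), m (t' i) := by
      rw [← Finset.prod_subset (hn.trans (Finset.range_subset_range.2 (Nat.le_succ n)))]
      · exact Finset.prod_congr rfl fun i hi => by simp [ht', hi]
      · intro i _ hi
        simp [ht', hi]
    have hpre : cons ⁻¹' (Set.pi (Finset.range (n + 1) : Set ℕ) t') =
        t' 0 ×ˢ Set.pi (Finset.range n : Set ℕ) (fun i => t' (i + 1)) := by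
      ext p
      simp only [Set.mem_preimage, Set.mem_pi, Finset.mem_coe, Finset.mem_range, Set.mem_prod]
      constructor
      · intro h
        exact ⟨h 0 (by omega), fun i hi => h (i + 1) (by omega)⟩
      · rintro ⟨h0, h1⟩ i hi
        cases i with
        | zero => exact h0
        | succ i => exact h1 i (by omega)
    rw [hpi, hprod, Measure.map_apply hcm, hpre, Measure.prod_prod, noiseLaw,
      Measure.infinitePi_pi, Finset.prod_range_succ', mul_comm]
    · exact fun i _ => ht'm _
    · exact MeasurableSet.pi (Set.to_countable _) fun i _ => ht'm i
  have hm : Measurable fun e : ℕ → V => (e 0, seqTail e) := by fun_prop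
  conv_lhs => rw [← key]
  rw [Measure.map_map hm hcm]
  exact Measure.map_id

variable {Ω U : Type*} [MeasurableSpace Ω] [MeasurableSpace U] {P : Measure Ω}
  [IsProbabilityMeasure P]

/-- The sequence `e` is a noise of law `m`, independent of the variable `u`. -/
def IsFreshNoise (P : Measure Ω) (m : Measure V) [IsProbabilityMeasure m] (u : Ω → U)
    (e : Ω → ℕ → V) : Prop :=
  P.map (fun ω => (u ω, e ω)) = (P.map u).prod (noiseLaw m)

theorem IsFreshNoise.comp {u : Ω → U} {e : Ω → ℕ → V} (h : IsFreshNoise P m u e)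
    (hu : Measurable u) (he : Measurable e) {U' : Type*} [MeasurableSpace U'] {g : U → U'}
    (hg : Measurable g) : IsFreshNoise P m (fun ω => g (u ω)) e := by
  have := congrArg (fun μ => μ.map (Prod.map g id)) h
  rw [Measure.map_map (hg.prodMap measurable_id) (hu.prodMk he),
    ← Measure.map_prod_map _ _ hg measurable_id, Measure.map_id, Measure.map_map hg hu] at this
  exact this

theorem IsFreshNoise.congr {u u' : Ω → U} {e : Ω → ℕ → V} (h : IsFreshNoise P m u e)
    (huu : u =ᵐ[P] u') : IsFreshNoise P m u' e := by
  unfold IsFreshNoise at *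
  rw [← Measure.map_congr huu, ← h]
  exact Measure.map_congr (by filter_upwards [huu] with ω hω; rw [hω])

theorem IsFreshNoise.map_head {u : Ω → U} {e : Ω → ℕ → V} (h : IsFreshNoise P m u e)
    (hu : Measurable u) (he : Measurable e) :
    P.map (fun ω => (u ω, e ω 0)) = (P.map u).prod m := by
  have hhead : (noiseLaw m).map (fun e => e 0) = m := by
    have := congrArg (fun μ => μ.map Prod.fst) (noiseLaw_map_cons (m := m))
    rw [Measure.map_map measurable_fst (by fun_prop), Measure.map_fst_prod, measure_univ,
      one_smul] at this
    exact this
  have := congrArg (fun μ => μ.map (Prod.map id fun e : ℕ → V => e 0)) h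
  rw [Measure.map_map (by fun_prop) (hu.prodMk he),
    ← Measure.map_prod_map _ _ measurable_id (by fun_prop), Measure.map_id, hhead] at this
  exact this

/-- The first noise variable may be moved into the known part, by associativity of products. This
drives the inductions along time. -/
theorem IsFreshNoise.tail {u : Ω → U} {e : Ω → ℕ → V} (h : IsFreshNoise P m u e)
    (hu : Measurable u) (he : Measurable e) :
    IsFreshNoise P m (fun ω => (u ω, e ω 0)) (fun ω => seqTail (e ω)) := by
  unfold IsFreshNoise
  rw [h.map_head hu he]
  have := Measure.isProbabilityMeasure_map (μ := P) hu.aemeasurable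
  have h1 := congrArg (fun μ => μ.map (Prod.map id fun e : ℕ → V => (e 0, seqTail e))) h
  rw [Measure.map_map (by fun_prop) (hu.prodMk he),
    ← Measure.map_prod_map _ _ measurable_id (by fun_prop), Measure.map_id, noiseLaw_map_cons] at h1
  have h2 := congrArg (fun μ => μ.map MeasurableEquiv.prodAssoc.symm) h1
  rw [Measure.map_map (MeasurableEquiv.measurable _) (by fun_prop)] at h2
  refine Eq.trans ?_ (h2.trans ?_)
  · rfl
  · exact ((measurePreserving_prodAssoc (P.map u) m (noiseLaw m)).symm _).map_eq

end Noise

/-! ### Natural extension of a measure preserving map -/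

section NaturalExtension

open unitInterval in
/-- The natural extension of a measure preserving map of a standard Borel space. -/
theorem exists_natural_extension {S : Type*} [MeasurableSpace S] [StandardBorelSpace S]
    {μ : Measure S} [IsProbabilityMeasure μ] {p : S → S} (hp : MeasurePreserving p μ μ) :
    ∃ Q : Measure (ℤ → S), IsProbabilityMeasure Q ∧ (∀ t, Q.map (fun w => w t) = μ) ∧
      ∀ t, ∀ᵐ w ∂Q, w (t + 1) = p (w t) := by
  have hpm := hp.measurable
  have : Nonempty S := μ.nonempty_of_neZero
  -- The kernel k draws a random preimage under p: it is the conditional law of a point given its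
  -- image.
  set k : Kernel S S := condDistrib id p μ with hk
  have hkμ : μ ⊗ₘ k = μ.map fun s => (p s, s) := by
    have := compProd_map_condDistrib (mβ := ‹MeasurableSpace S›) (X := p) (Y := id) (μ := μ)
      aemeasurable_id
    rw [hp.map_eq] at this
    exact this
  -- Realizing k as a function of a uniform variable makes the past of the orbit a recursion driven
  -- by i.i.d. noise.
  obtain ⟨G, hG, hGk⟩ := Kernel.exists_measurable_map_eq_unitInterval k
  have hGm : Measurable fun q : S × I => G q.1 q.2 := hG
  have hjoint : (μ.prod (volume : Measure I)).map (fun q => (q.1, G q.1 q.2)) =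
      μ.map fun s => (p s, s) := by
    rw [← hkμ]
    ext A hA
    rw [Measure.map_apply (by fun_prop) hA, Measure.compProd_apply hA,
      Measure.prod_apply ((measurable_fst.prodMk hGm) hA)]
    refine lintegral_congr fun s => ?_
    rw [← hGk, Measure.map_apply (show Measurable (G s) from hG.comp measurable_prodMk_left)
      (measurable_prodMk_left hA)]
    rfl
  have hGlaw : (μ.prod (volume : Measure I)).map (fun q => G q.1 q.2) = μ := by
    have := congrArg (fun ν => ν.map Prod.snd) hjoint
    rw [Measure.map_map measurable_snd (by fun_prop),
      Measure.map_map measurable_snd (by fun_prop)] at this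
    exact this.trans Measure.map_id
  have hGp : ∀ᵐ q ∂(μ.prod (volume : Measure I)), p (G q.1 q.2) = q.1 := by
    have h1 : ∀ᵐ q ∂(μ.map fun s => (p s, s)), p q.2 = q.1 := by
      rw [ae_map_iff (by fun_prop) (measurableSet_eq_fun (by fun_prop) (by fun_prop))]
      simp
    rw [← hjoint] at h1
    exact ae_of_ae_map (by fun_prop) h1
  set W : Measure (S × (ℕ → I)) := μ.prod (noiseLaw volume) with hW
  set past : ℕ → S × (ℕ → I) → S := fun n q =>
    Nat.rec q.1 (fun i s => G s (q.2 i)) n with hpast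
  have hpast_succ : ∀ n q, past (n + 1) q = G (past n q) (q.2 n) := fun n q => rfl
  have hpastm : ∀ n, Measurable (past n) := by
    intro n
    induction n with
    | zero => exact measurable_fst
    | succ n ih =>
      have : Measurable fun q : S × (ℕ → I) => (past n q, q.2 n) := ih.prodMk (by fun_prop)
      exact hGm.comp this
  set e : ℕ → S × (ℕ → I) → ℕ → I := fun n q j => q.2 (n + j) with he
  have hem : ∀ n, Measurable (e n) := fun n => by fun_prop
  have hfresh : ∀ n, W.map (past n) = μ ∧ IsFreshNoise W volume (past n) (e n) := by
    intro n
    induction n with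
    | zero =>
      have h1 : W.map (past 0) = μ := by
        change W.map Prod.fst = μ
        rw [hW, Measure.map_fst_prod, measure_univ, one_smul]
      refine ⟨h1, ?_⟩
      unfold IsFreshNoise
      rw [h1, ← hW]
      have : (fun q => (past 0 q, e 0 q)) = id := by
        ext q <;> simp [hpast, he]
      rw [this, Measure.map_id]
    | succ n ih =>
      obtain ⟨ih1, ih2⟩ := ih
      have h0 := ih2.map_head (hpastm n) (hem n)
      have hcomp : past (n + 1) = (fun q : S × I => G q.1 q.2) ∘ fun q => (past n q, e n q 0) := by
        ext q
        simp [hpast_succ, he]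
      have htail : e (n + 1) = fun q => seqTail (e n q) := by
        ext q j
        simp only [he, seqTail, add_assoc, add_comm 1 j]
      have hmm : Measurable fun q => (past n q, e n q 0) := (hpastm n).prodMk (by fun_prop)
      refine ⟨?_, ?_⟩
      · rw [hcomp, ← Measure.map_map hGm hmm, h0, ih1, hGlaw]
      · rw [htail, hcomp]
        exact (ih2.tail (hpastm n) (hem n)).comp hmm (by fun_prop) hGm
  have hpp : ∀ n, ∀ᵐ q ∂W, p (past (n + 1) q) = past n q := by
    intro n
    have h0 := (hfresh n).2.map_head (hpastm n) (hem n)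
    rw [(hfresh n).1] at h0
    have h1 := hGp
    rw [← h0] at h1
    have hmm : Measurable fun q => (past n q, e n q 0) := (hpastm n).prodMk (by fun_prop)
    filter_upwards [ae_of_ae_map hmm.aemeasurable h1] with q hq
    exact hq
  -- Forward iterates at nonnegative times and successive random preimages at negative ones;
  -- truncation by `toNat` makes the other operation trivial.
  set orbit : S × (ℕ → I) → ℤ → S := fun q t => p^[t.toNat] (past (-t).toNat q) with horb
  have horbm : Measurable orbit :=
    measurable_pi_lambda _ fun t => (hpm.iterate _).comp (hpastm _)
  refine ⟨W.map orbit, Measure.isProbabilityMeasure_map horbm.aemeasurable, fun t => ?_, fun t => ?_⟩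
  · rw [Measure.map_map (measurable_pi_apply t) horbm]
    have : (fun w : ℤ → S => w t) ∘ orbit = p^[t.toNat] ∘ past (-t).toNat := rfl
    rw [this, ← Measure.map_map (hpm.iterate _) (hpastm _), (hfresh _).1, (hp.iterate _).map_eq]
  · rw [ae_map_iff horbm.aemeasurable (measurableSet_eq_fun (by fun_prop) (by fun_prop))]
    rcases le_or_gt 0 t with ht | ht
    · refine Eventually.of_forall fun q => ?_
      have e1 : (-t).toNat = 0 := by omega
      have e2 : (-(t + 1)).toNat = 0 := by omega
      have e3 : (t + 1).toNat = t.toNat + 1 := by omega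
      simp only [horb, e1, e2, e3, Function.iterate_succ_apply']
    · filter_upwards [hpp (-(t + 1)).toNat] with q hq
      have e1 : t.toNat = 0 := by omega
      have e2 : (t + 1).toNat = 0 := by omega
      have e3 : (-t).toNat = (-(t + 1)).toNat + 1 := by omega
      simp only [horb, e1, e2, e3, Function.iterate_zero, id]
      exact hq.symm

end NaturalExtension

/-! ### Shifts of two-sided sequences -/

section Shift

/-- The shift of a two-sided sequence by `t`. -/
def shiftBy {H : Type*} (t : ℤ) (x : ℤ → H) : ℤ → H := fun s => x (s + t)

theorem shiftBy_shiftBy {H : Type*} (s t : ℤ) (x : ℤ → H) :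
    shiftBy s (shiftBy t x) = shiftBy (s + t) x := by
  ext u; simp [shiftBy, add_assoc]

theorem shiftBy_zero {H : Type*} (x : ℤ → H) : shiftBy 0 x = x := by
  ext u; simp [shiftBy]

theorem shiftBy_iterate {H : Type*} (t : ℤ) (n : ℕ) (x : ℤ → H) :
    (shiftBy t)^[n] x = shiftBy (n * t) x := by
  induction n with
  | zero => simp [shiftBy_zero]
  | succ n ih =>
    rw [Function.iterate_succ_apply', ih, shiftBy_shiftBy]
    congr 1
    push_cast
    ring

variable {H : Type*} [MeasurableSpace H]

@[fun_prop]
theorem measurable_shiftBy (t : ℤ) : Measurable (shiftBy t : (ℤ → H) → ℤ → H) :=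
  measurable_pi_lambda _ fun s => measurable_pi_apply (s + t)

theorem measurePreserving_shiftBy {μ : Measure (ℤ → H)} (h : MeasurePreserving pathShift μ μ)
    (t : ℤ) : MeasurePreserving (shiftBy t) μ μ := by
  have h1 : MeasurePreserving (shiftBy 1) μ μ := h
  have h2 : MeasurePreserving (shiftBy (-1)) μ μ := by
    refine ⟨measurable_shiftBy _, ?_⟩
    conv_lhs => rw [← h1.map_eq]
    rw [Measure.map_map (measurable_shiftBy _) (measurable_shiftBy _)]
    have : shiftBy (-1) ∘ shiftBy 1 = (id : (ℤ → H) → ℤ → H) := by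
      ext x : 1
      simp [shiftBy_shiftBy, shiftBy_zero]
    rw [this, Measure.map_id]
  induction t with
  | zero =>
    have : (shiftBy 0 : (ℤ → H) → ℤ → H) = id := funext shiftBy_zero
    rw [this]
    exact MeasurePreserving.id μ
  | succ n ih =>
    have : (shiftBy (n + 1) : (ℤ → H) → ℤ → H) = shiftBy n ∘ shiftBy 1 :=
      funext fun x => (shiftBy_shiftBy _ _ _).symm
    rw [this]
    exact ih.comp h1
  | pred n ih =>
    have : (shiftBy (-n - 1) : (ℤ → H) → ℤ → H) = shiftBy (-n) ∘ shiftBy (-1) :=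
      funext fun x => (shiftBy_shiftBy _ _ _).symm
    rw [this]
    exact ih.comp h2

end Shift

/-! ### Quenched laws as laws of random iterations -/

section Forward

variable {E F V : Type*} [MeasurableSpace E] [MeasurableSpace F] [MeasurableSpace V]
  {f : E → F → V → E} {m : Measure V}

/-- The state at time `n` of the recursion started at `y`, driven by the environment `x` and the
noise `e`. -/
def forwardPath {E F V : Type*} (f : E → F → V → E) (x : ℤ → F) (y : E) (e : ℕ → V) : ℕ → E
  | 0 => y
  | n + 1 => f (forwardPath f x y e n) (x n) (e n)

theorem forwardPath_add {E F V : Type*} (f : E → F → V → E) (x : ℤ → F) (y : E) (e : ℕ → V)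
    (n j : ℕ) : forwardPath f x y e (n + j) =
      forwardPath f (shiftBy n x) (forwardPath f x y e n) (fun i => e (n + i)) j := by
  induction j with
  | zero => rfl
  | succ j ih =>
    rw [← add_assoc, forwardPath, ih, forwardPath]
    congr 1
    simp [shiftBy, add_comm]

theorem forwardPath_one_add {E F V : Type*} (f : E → F → V → E) (x : ℤ → F) (y : E) (e : ℕ → V)
    (n : ℕ) : forwardPath f x y e (1 + n) =
      forwardPath f (shiftBy 1 x) (f y (x 0) (e 0)) (seqTail e) n := by
  rw [forwardPath_add]
  simp only [forwardPath, add_comm 1]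
  rfl

theorem chain_eq_forwardPath {E F V Ω : Type*} (f : E → F → V → E) (X : ℤ → Ω → F)
    (ε : ℕ → Ω → V) (y : E) (n : ℕ) (ω : Ω) :
    chain f X ε y n ω = forwardPath f (fun t => X t ω) y (fun j => ε (j + 1) ω) n := by
  induction n with
  | zero => rfl
  | succ n ih =>
    change f (chain f X ε y n ω) (X n ω) (ε (n + 1) ω) = _
    rw [ih, forwardPath]

theorem measurable_forwardPath (hf : Measurable fun p : E × F × V => f p.1 p.2.1 p.2.2) (n : ℕ) :
    Measurable fun p : (ℤ → F) × E × (ℕ → V) => forwardPath f p.1 p.2.1 p.2.2 n := by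
  induction n with
  | zero => exact measurable_snd.fst
  | succ n ih =>
    exact hf.comp (ih.prodMk (by fun_prop :
      Measurable fun p : (ℤ → F) × E × (ℕ → V) => (p.1 (n : ℤ), p.2.2 n)))

/-- Induction on the first step: the state after it is the new starting point, and the tail of the
noise is again i.i.d., which is why s and y are kept general. -/
theorem lintegral_quenchedLaw (hf : Measurable fun p : E × F × V => f p.1 p.2.1 p.2.2)
    [IsProbabilityMeasure m] (x : ℤ → F) (s : ℤ) (n : ℕ) (y : E) {g : E → ℝ≥0∞}
    (hg : Measurable g) : ∫⁻ u, g u ∂(quenchedLaw f m x s n y) =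
      ∫⁻ e, g (forwardPath f (shiftBy s x) y e n) ∂(noiseLaw m) := by
  induction n generalizing s y with
  | zero => simp [quenchedLaw_zero, forwardPath, lintegral_dirac' _ hg]
  | succ n ih =>
    have hG : Measurable fun p : V × (ℕ → V) =>
        g (forwardPath f (shiftBy (s + 1) x) (f y (x s) p.1) p.2 n) :=
      hg.comp ((measurable_forwardPath hf n).comp (measurable_const.prodMk
        (((measurable_step hf y (x s)).comp measurable_fst).prodMk measurable_snd)))
    have hcons : Measurable fun e : ℕ → V => (e 0, seqTail e) := by fun_prop
    have h1 : ∀ z, ∫⁻ u, g u ∂(quenchedLaw f m x (s + (1 : ℕ)) n z) =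
        ∫⁻ e, g (forwardPath f (shiftBy (s + 1) x) z e n) ∂(noiseLaw m) := fun z => by
      rw [ih]; rfl
    have h2 : Measurable fun z => ∫⁻ e, g (forwardPath f (shiftBy (s + 1) x) z e n) ∂(noiseLaw m) := by
      simp_rw [← h1]
      exact measurable_lintegral_quenchedLaw x _ n hg
    rw [add_comm n 1, lintegral_quenchedLaw_add x s 1 n y hg]
    simp_rw [h1]
    rw [show 1 = 0 + 1 from rfl, lintegral_quenchedLaw_succ hf x s 0 y h2, quenchedLaw_zero,
      lintegral_dirac']
    · simp_rw [zero_add, forwardPath_one_add, shiftBy_shiftBy]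
      have h3 := lintegral_map (μ := noiseLaw m) hG hcons
      rw [noiseLaw_map_cons, lintegral_prod _ hG.aemeasurable] at h3
      simp only [Nat.cast_zero, add_zero]
      rw [h3]
      refine lintegral_congr fun e => ?_
      simp only [shiftBy, zero_add, add_comm 1 s]
    · exact (h2.comp (hf.comp (measurable_fst.prodMk
        (measurable_const.prodMk measurable_snd)))).lintegral_prod_right'

theorem quenchedLaw_eq_map (hf : Measurable fun p : E × F × V => f p.1 p.2.1 p.2.2)
    [IsProbabilityMeasure m] (x : ℤ → F) (s : ℤ) (n : ℕ) (y : E) :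
    quenchedLaw f m x s n y = (noiseLaw m).map fun e => forwardPath f (shiftBy s x) y e n := by
  have hm : Measurable fun e => forwardPath f (shiftBy s x) y e n :=
    (measurable_forwardPath hf n).comp (measurable_const.prodMk
      (measurable_const.prodMk measurable_id))
  ext A hA
  rw [← lintegral_indicator_one hA, ← lintegral_indicator_one hA,
    lintegral_quenchedLaw hf x s n y (measurable_one.indicator hA),
    lintegral_map (measurable_one.indicator hA) hm]

theorem quenchedLaw_shiftBy (hf : Measurable fun p : E × F × V => f p.1 p.2.1 p.2.2)
    [IsProbabilityMeasure m] (x : ℤ → F) (t s : ℤ) (n : ℕ) (y : E) :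
    quenchedLaw f m (shiftBy t x) s n y = quenchedLaw f m x (s + t) n y := by
  rw [quenchedLaw_eq_map hf, quenchedLaw_eq_map hf, shiftBy_shiftBy]

/-- The noise representation makes joint measurability in environment and starting point a Fubini
statement. -/
theorem measurable_quenchedLaw_prod (hf : Measurable fun p : E × F × V => f p.1 p.2.1 p.2.2)
    [IsProbabilityMeasure m] (s : ℤ) (n : ℕ) :
    Measurable fun p : (ℤ → F) × E => quenchedLaw f m p.1 s n p.2 := by
  refine Measure.measurable_of_measurable_coe _ fun A hA => ?_
  have hm : Measurable fun q : ((ℤ → F) × E) × (ℕ → V) =>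
      forwardPath f (shiftBy s q.1.1) q.1.2 q.2 n :=
    (measurable_forwardPath hf n).comp (by fun_prop :
      Measurable fun q : ((ℤ → F) × E) × (ℕ → V) => (shiftBy s q.1.1, q.1.2, q.2))
  have := measurable_measure_prodMk_left (ν := noiseLaw m) (hm hA)
  convert this using 2 with p
  have hp : Measurable fun e => forwardPath f (shiftBy s p.1) p.2 e n :=
    hm.comp (measurable_prodMk_left (x := p))
  rw [quenchedLaw_eq_map hf, Measure.map_apply hp hA]
  rfl

end Forward

/-! ### Poincaré recurrence and vanishing products -/

section Recurrence

/-- Along almost every orbit of a measure preserving map of a finite measure space, the infinite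
product of `1 - h` vanishes if `h` takes its values in `(0, 1]`. -/
theorem ae_tendsto_prod_one_sub {S : Type*} [MeasurableSpace S] {μ : Measure S}
    [IsFiniteMeasure μ] {T : S → S} (hT : MeasurePreserving T μ μ) {h : S → ℝ} (hh : Measurable h)
    (h01 : ∀ s, h s ∈ Set.Ioc (0 : ℝ) 1) :
    ∀ᵐ s ∂μ, Tendsto (fun q : ℕ => ∏ i ∈ Finset.range q, ENNReal.ofReal (1 - h (T^[i] s)))
      atTop (𝓝 0) := by
  -- Poincaré recurrence for the sets {h > 1/(k+1)}, which exhaust the space since h > 0; ergodicity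
  -- is not needed.
  have hrec : ∀ k : ℕ, ∀ᵐ s ∂μ, s ∈ {s | 1 / ((k : ℝ) + 1) < h s} →
      ∃ᶠ n in atTop, T^[n] s ∈ {s | 1 / ((k : ℝ) + 1) < h s} := fun k =>
    hT.conservative.ae_mem_imp_frequently_image_mem
      (measurableSet_lt measurable_const hh).nullMeasurableSet
  filter_upwards [ae_all_iff.2 hrec] with s hs
  obtain ⟨k, hk⟩ := exists_nat_one_div_lt (h01 s).1
  have hfreq := hs k hk
  set c : ℝ := 1 / ((k : ℝ) + 1) with hc
  have hcpos : 0 < c := by positivity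
  set a : ℕ → ℝ≥0∞ := fun q => ∏ i ∈ Finset.range q, ENNReal.ofReal (1 - h (T^[i] s)) with ha
  have hle1 : ∀ u, ENNReal.ofReal (1 - h u) ≤ 1 := fun u => by
    rw [ENNReal.ofReal_le_one]; linarith [(h01 u).1]
  have hanti : Antitone a := antitone_nat_of_succ_le fun q => by
    rw [ha]
    simp only [Finset.prod_range_succ]
    exact mul_le_of_le_one_right' (hle1 _)
  have ha1 : ∀ q, a q ≤ 1 := fun q => Finset.prod_le_one' fun i _ => hle1 _
  have hlim := tendsto_atTop_iInf hanti
  set l := ⨅ q, a q with hl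
  have hltop : l ≠ ∞ := ((iInf_le a 0).trans (ha1 0)).trans_lt ENNReal.one_lt_top |>.ne
  -- Infinitely many factors are at most 1 - c, so the limit l of the decreasing products satisfies
  -- l ≤ l (1 - c), forcing l = 0.
  have hlle : l ≤ l * ENNReal.ofReal (1 - c) := by
    have h2 : Tendsto (fun q => a q * ENNReal.ofReal (1 - c)) atTop
        (𝓝 (l * ENNReal.ofReal (1 - c))) :=
      ENNReal.Tendsto.mul_const hlim (Or.inr ENNReal.ofReal_ne_top)
    refine ge_of_tendsto_of_frequently h2 ?_
    refine hfreq.mono fun q hq => ?_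
    calc l ≤ a (q + 1) := iInf_le _ _
      _ = a q * ENNReal.ofReal (1 - h (T^[q] s)) := by simp only [ha, Finset.prod_range_succ]
      _ ≤ a q * ENNReal.ofReal (1 - c) := by
          gcongr
  have hl0 : l = 0 := by
    by_contra hne
    have h3 : l * ENNReal.ofReal (1 - c) < l * 1 := by
      refine ENNReal.mul_lt_mul_right hne hltop ?_
      rw [ENNReal.ofReal_lt_one]; linarith
    rw [mul_one] at h3
    exact absurd hlle (not_le.2 h3)
  rw [← hl0]
  exact hlim

variable {F : Type*} [MeasurableSpace F] {μ : Measure (ℤ → F)} [IsProbabilityMeasure μ]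

/-- The product in the merging bound for the window `[-n, 0)`. -/
noncomputable def backwardProd (η : F → ℝ) (N : ℕ) (x : ℤ → F) (n : ℕ) : ℝ≥0∞ :=
  ∏ j ∈ Finset.Icc 1 (((n + 1) / 2) / N),
    ENNReal.ofReal (1 - η (x (-n + ((n / 2 + j * N - 1 : ℕ) : ℤ))))

theorem backwardProd_le_one {η : F → ℝ} (h01 : ∀ x, η x ∈ Set.Ioc (0 : ℝ) 1) (N : ℕ) (x : ℤ → F)
    (n : ℕ) : backwardProd η N x n ≤ 1 :=
  Finset.prod_le_one' fun _ _ => ENNReal.ofReal_le_one.2 (sub_le_self _ (h01 _).1.le)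

theorem measurable_backwardProd {η : F → ℝ} (hη : Measurable η) (N n : ℕ) :
    Measurable fun x : ℤ → F => backwardProd η N x n := by
  unfold backwardProd
  refine Finset.measurable_prod _ fun j _ => ?_
  exact (measurable_const.sub (hη.comp (measurable_pi_apply _))).ennreal_ofReal

/-- Write ⌈n/2⌉ = qN + r with r < N. Factor j sits at time -(r+1) - (q-j)N, so the product runs
along an orbit of the shift by -N, read at coordinate -(r+1). As r varies with n, the product is
bounded by the sum over all N residues. -/
theorem ae_tendsto_backwardProd (hμ : MeasurePreserving pathShift μ μ) {η : F → ℝ}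
    (hη : Measurable η) (h01 : ∀ x, η x ∈ Set.Ioc (0 : ℝ) 1) {N : ℕ} (hN : 0 < N) :
    ∀ᵐ x ∂μ, Tendsto (backwardProd η N x) atTop (𝓝 0) := by
  have h1 : ∀ r : ℕ, ∀ᵐ x ∂μ, Tendsto (fun q : ℕ => ∏ i ∈ Finset.range q,
      ENNReal.ofReal (1 - η ((shiftBy (-(N : ℤ)))^[i] x (-((r : ℤ) + 1))))) atTop (𝓝 0) := fun r =>
    ae_tendsto_prod_one_sub (h := fun x : ℤ → F => η (x (-((r : ℤ) + 1))))
      (measurePreserving_shiftBy hμ (-(N : ℤ)))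
      (hη.comp (measurable_pi_apply (-((r : ℤ) + 1)))) fun s => h01 _
  filter_upwards [ae_all_iff.2 h1] with x hx
  have hsum : Tendsto (fun q : ℕ => ∑ r ∈ Finset.range N, ∏ i ∈ Finset.range q,
      ENNReal.ofReal (1 - η ((shiftBy (-(N : ℤ)))^[i] x (-((r : ℤ) + 1))))) atTop (𝓝 0) := by
    have := tendsto_finsetSum (Finset.range N) fun r _ => hx r
    simpa using this
  have hq : Tendsto (fun n : ℕ => ((n + 1) / 2) / N) atTop atTop := by
    refine tendsto_atTop.2 fun b => eventually_atTop.2 ⟨2 * (b * N), fun n hn => ?_⟩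
    rw [Nat.le_div_iff_mul_le hN]
    omega
  refine tendsto_of_tendsto_of_tendsto_of_le_of_le tendsto_const_nhds (hsum.comp hq)
    (fun _ => zero_le) fun n => ?_
  set l := (n + 1) / 2 with hl
  have hr : l % N ∈ Finset.range N := Finset.mem_range.2 (Nat.mod_lt _ hN)
  refine le_trans (le_of_eq ?_) (Finset.single_le_sum (f := fun r : ℕ =>
    ∏ i ∈ Finset.range (l / N),
      ENNReal.ofReal (1 - η ((shiftBy (-(N : ℤ)))^[i] x (-((r : ℤ) + 1))))) (fun _ _ => zero_le) hr)
  rw [backwardProd, ← hl]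
  refine Finset.prod_nbij' (fun j => l / N - j) (fun i => l / N - i) ?_ ?_ ?_ ?_ ?_
  · intro j hj
    have := Finset.mem_Icc.1 hj
    exact Finset.mem_range.2 (by omega)
  · intro i hi
    have := Finset.mem_range.1 hi
    exact Finset.mem_Icc.2 (by omega)
  · intro j hj
    have := Finset.mem_Icc.1 hj
    omega
  · intro i hi
    have := Finset.mem_range.1 hi
    omega
  · intro j hj
    have hj := Finset.mem_Icc.1 hj
    rw [shiftBy_iterate]
    simp only [shiftBy]
    congr 4
    have h2 : l = N * (l / N) + l % N := (Nat.div_add_mod l N).symm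
    have h3 : 1 ≤ j * N := Nat.one_le_iff_ne_zero.2 (Nat.mul_ne_zero (by omega) hN.ne')
    have h4 : n = n / 2 + l := by omega
    rw [Nat.cast_sub hj.2, Nat.cast_sub (by omega)]
    zify at h2 h4
    push_cast
    nth_rewrite 1 [h4]
    have h5 : (l : ℤ) = N * (l / N) + l % N := h2
    linear_combination -h5

end Recurrence

/-! ### Convergence uniform on events -/

theorem tendsto_of_le_add {a c : ℕ → ℝ≥0∞} {b : ℝ≥0∞} (hc : Tendsto c atTop (𝓝 0))
    (h1 : ∀ n, a n ≤ b + c n) (h2 : ∀ n, b ≤ a n + c n) : Tendsto a atTop (𝓝 b) := by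
  have h3 : Tendsto (fun n => b - c n) atTop (𝓝 b) := by
    have := ENNReal.Tendsto.sub (tendsto_const_nhds (x := b)) hc (Or.inr ENNReal.zero_ne_top)
    rwa [tsub_zero] at this
  have h4 : Tendsto (fun n => b + c n) atTop (𝓝 b) := by simpa using hc.const_add b
  exact tendsto_of_tendsto_of_tendsto_of_le_of_le h3 h4 (fun n => tsub_le_iff_right.2 (h2 n)) h1

/-- Uniform convergence on events of a sequence of measures. -/
def ConvergesUniformly {E : Type*} [MeasurableSpace E] (ν : ℕ → Measure E) (π : Measure E) : Prop :=
  ∃ c : ℕ → ℝ≥0∞, Tendsto c atTop (𝓝 0) ∧ ∀ n A, MeasurableSet A →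
    ν n A ≤ π A + c n ∧ π A ≤ ν n A + c n

theorem ConvergesUniformly.tendsto_tvDist {E : Type*} [MeasurableSpace E] [MeasurableEq E]
    {ν : ℕ → Measure E} {π : Measure E} [∀ n, IsProbabilityMeasure (ν n)] [IsProbabilityMeasure π]
    (h : ConvergesUniformly ν π) : Tendsto (fun n => tvDist (ν n) π) atTop (𝓝 0) := by
  obtain ⟨c, hc, hcA⟩ := h
  exact tendsto_of_tendsto_of_tendsto_of_le_of_le tendsto_const_nhds hc (fun _ => zero_le)
    fun n => tvDist_le_of_forall fun A hA => (hcA n A hA).1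

theorem ConvergesUniformly.tendsto_apply {E : Type*} [MeasurableSpace E] {ν : ℕ → Measure E}
    {π : Measure E} [IsFiniteMeasure π] (h : ConvergesUniformly ν π) {A : Set E}
    (hA : MeasurableSet A) : Tendsto (fun n => ν n A) atTop (𝓝 (π A)) := by
  obtain ⟨c, hc, hcA⟩ := h
  exact tendsto_of_le_add hc (fun n => (hcA n A hA).1) fun n => (hcA n A hA).2

theorem measurable_of_tendsto_apply {S E : Type*} [MeasurableSpace S] [MeasurableSpace E]
    {q : ℕ → S → Measure E} (hq : ∀ n, Measurable (q n)) {Φ : S → Measure E}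
    (h : ∀ x A, MeasurableSet A → Tendsto (fun n => q n x A) atTop (𝓝 (Φ x A))) :
    Measurable Φ := by
  refine Measure.measurable_of_measurable_coe _ fun A hA => ?_
  exact measurable_of_tendsto_metrizable (fun n => (Measure.measurable_coe hA).comp (hq n))
    (tendsto_pi_nhds.2 fun x => h x A hA)

/-- The excess of μ over ν is carried by one event B, so its whole mass is at most c; this passes
from events to functions bounded by 1 without loss. -/
theorem lintegral_le_add_of_forall {E : Type*} [MeasurableSpace E] {μ ν : Measure E}
    [IsFiniteMeasure μ] [IsFiniteMeasure ν] {c : ℝ≥0∞}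
    (h : ∀ A, MeasurableSet A → μ A ≤ ν A + c) {g : E → ℝ≥0∞} (hg : ∀ u, g u ≤ 1) :
    ∫⁻ u, g u ∂μ ≤ ∫⁻ u, g u ∂ν + c := by
  obtain ⟨γ, α, β, h1, h2, B, hB, hαB, hβB⟩ := exists_common_part μ ν
  have hγ : IsFiniteMeasure γ := isFiniteMeasure_of_le μ (h1 ▸ Measure.le_add_right le_rfl)
  have hα : α Set.univ ≤ c := by
    have e1 : α Set.univ = α B := by
      rw [← measure_add_measure_compl hB, hαB, add_zero]
    have e2 := h B hB
    rw [← h1, ← h2, Measure.add_apply, Measure.add_apply, hβB, add_zero] at e2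
    rw [e1]
    exact ENNReal.le_of_add_le_add_left (measure_ne_top γ B) e2
  calc ∫⁻ u, g u ∂μ = ∫⁻ u, g u ∂γ + ∫⁻ u, g u ∂α := by rw [← h1, lintegral_add_measure]
    _ ≤ ∫⁻ u, g u ∂ν + ∫⁻ _, 1 ∂α := by
        gcongr with u
        · rw [← h2]; exact Measure.le_add_right le_rfl
        · exact hg u
    _ ≤ _ := by rw [lintegral_one]; gcongr

theorem ConvergesUniformly.bind {E : Type*} [MeasurableSpace E] {ν : ℕ → Measure E}
    {π : Measure E} [∀ n, IsFiniteMeasure (ν n)] [IsFiniteMeasure π]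
    (h : ConvergesUniformly ν π) (k : Kernel E E) [IsMarkovKernel k] :
    ConvergesUniformly (fun n => (ν n).bind k) (π.bind k) := by
  obtain ⟨c, hc, hcA⟩ := h
  refine ⟨c, hc, fun n A hA => ?_⟩
  rw [Measure.bind_apply hA k.measurable.aemeasurable, Measure.bind_apply hA k.measurable.aemeasurable]
  exact ⟨lintegral_le_add_of_forall (fun A hA => (hcA n A hA).1) fun u => prob_le_one,
    lintegral_le_add_of_forall (fun A hA => (hcA n A hA).2) fun u => prob_le_one⟩

/-! ### Consequences of the log-moment condition -/

section LogMoment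

/-- Borel-Cantelli: {g ∘ T n > n} has the measure of {g > n}, which is summable as g is integrable.
The T n need not be iterates of one map. -/
theorem ae_eventually_le_nat {S : Type*} [MeasurableSpace S] {μ : Measure S}
    [IsProbabilityMeasure μ] {g : S → ℝ} (hg : Integrable g μ) (hg0 : 0 ≤ g) {T : ℕ → S → S}
    (hT : ∀ n, MeasurePreserving (T n) μ μ) :
    ∀ᵐ s ∂μ, ∀ᶠ n : ℕ in atTop, g (T n s) ≤ n := by
  have h1 : ∑' n : ℕ, μ {s | g s ∈ Set.Ioi (n : ℝ)} < ∞ :=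
    @tsum_prob_mem_Ioi_lt_top S ⟨μ⟩ _ g hg hg0
  have h2 : ∀ n : ℕ, μ {s | g (T n s) ∈ Set.Ioi (n : ℝ)} = μ {s | g s ∈ Set.Ioi (n : ℝ)} := by
    intro n
    exact (hT n).measure_preimage (s := {s | g s ∈ Set.Ioi (n : ℝ)})
      (hg.aemeasurable.nullMeasurable measurableSet_Ioi)
  have h3 : ∑' n : ℕ, μ {s | g (T n s) ∈ Set.Ioi (n : ℝ)} ≠ ∞ := by
    simp_rw [h2]
    exact h1.ne
  filter_upwards [ae_eventually_notMem h3] with s hs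
  filter_upwards [hs] with n hn
  simpa using hn

/-- Borel-Cantelli for log⁺ W / log r⁻¹ bounds all but finitely many terms by r⁻ⁿ; the constant
absorbs the exceptional ones. -/
theorem ae_exists_geometric_bound {F : Type*} [MeasurableSpace F] {μ : Measure (ℤ → F)}
    [IsProbabilityMeasure μ] (hμ : MeasurePreserving pathShift μ μ) {W : F → ℝ≥0∞}
    (hW : HasLogMoment μ fun x => W (x 0)) {r : ℝ} (hr0 : 0 < r) (hr1 : r < 1) :
    ∀ᵐ x ∂μ, ∃ C : ℝ, 0 ≤ C ∧ ∀ n : ℕ, W (x (-n - 1)) ≤ ENNReal.ofReal (C * (r⁻¹) ^ n) := by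
  have hL : 0 < Real.log r⁻¹ := Real.log_pos ((one_lt_inv₀ hr0).2 hr1)
  have hT : ∀ n : ℕ, MeasurePreserving (shiftBy (-(n : ℤ) - 1)) μ μ := fun n =>
    measurePreserving_shiftBy hμ _
  have h1 := ae_eventually_le_nat (hW.2.div_const (Real.log r⁻¹))
    (fun x => div_nonneg Real.posLog_nonneg hL.le) hT
  have h2 : ∀ᵐ x ∂μ, ∀ n : ℕ, W (x (-n - 1)) ≠ ∞ := by
    refine ae_all_iff.2 fun n => ?_
    have := (hT n).quasiMeasurePreserving.ae hW.1
    filter_upwards [this] with x hx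
    simpa [shiftBy] using hx
  filter_upwards [h1, h2] with x h1 h2
  obtain ⟨n₀, hn₀⟩ := eventually_atTop.1 h1
  have hS : 0 ≤ ∑ i ∈ Finset.range n₀, (W (x (-i - 1))).toReal :=
    Finset.sum_nonneg fun i _ => ENNReal.toReal_nonneg
  refine ⟨1 + ∑ i ∈ Finset.range n₀, (W (x (-i - 1))).toReal, by linarith, fun n => ?_⟩
  rw [← ENNReal.ofReal_toReal (h2 n)]
  refine ENNReal.ofReal_le_ofReal ?_
  have hone : 1 ≤ (r⁻¹) ^ n := one_le_pow₀ ((one_lt_inv₀ hr0).2 hr1).le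
  rcases lt_or_ge n n₀ with hn | hn
  · have h3 : (W (x (-n - 1))).toReal ≤ ∑ i ∈ Finset.range n₀, (W (x (-i - 1))).toReal :=
      Finset.single_le_sum (f := fun i : ℕ => (W (x (-i - 1))).toReal)
        (fun i _ => ENNReal.toReal_nonneg) (Finset.mem_range.2 hn)
    nlinarith
  · have h3 := hn₀ n hn
    simp only [shiftBy, zero_add] at h3
    rw [div_le_iff₀ hL] at h3
    set w := (W (x (-n - 1))).toReal with hw
    have h4 : w ≤ (r⁻¹) ^ n := by
      rcases le_or_gt w 0 with h0 | h0
      · linarith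
      · rw [← Real.log_le_log_iff h0 (by positivity), Real.log_pow]
        exact (le_max_right _ _).trans h3
    nlinarith

end LogMoment

/-! ### The pullback limit of the quenched laws -/

section Backward

variable {E F V : Type*} [MetricSpace E] [PolishSpace E] [MeasurableSpace E] [BorelSpace E]
  [MeasurableSpace F] [MeasurableSpace V] {f : E → F → V → E} {m : Measure V}
  [IsProbabilityMeasure m] {R ρ : ℝ} {η : F → ℝ}

/-- The moment of order `θ` of the displacement of `y₀` in one step. -/
noncomputable def stepMoment (f : E → F → V → E) (m : Measure V) (y₀ : E) (θ : ℝ) (x : F) : ℝ≥0∞ :=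
  ∫⁻ e, ENNReal.ofReal (dist y₀ (f y₀ x e) ^ θ) ∂m

theorem ofReal_rpow_add_le {a b θ : ℝ} (ha : 0 ≤ a) (hb : 0 ≤ b) (hθ : θ ∈ Set.Ioo (0 : ℝ) 1) :
    ENNReal.ofReal ((a + b) ^ θ) ≤ ENNReal.ofReal (a ^ θ) + ENNReal.ofReal (b ^ θ) := by
  rw [← ENNReal.ofReal_rpow_of_nonneg (by positivity) hθ.1.le,
    ← ENNReal.ofReal_rpow_of_nonneg ha hθ.1.le, ← ENNReal.ofReal_rpow_of_nonneg hb hθ.1.le,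
    ENNReal.ofReal_add ha hb]
  exact ENNReal.rpow_add_le_add_rpow _ _ hθ.1.le hθ.2.le

theorem measurable_dist_rpow (y₀ : E) (θ : ℝ) :
    Measurable fun z : E => ENNReal.ofReal (dist y₀ z ^ θ) :=
  ((measurable_const.dist measurable_id).pow_const θ).ennreal_ofReal

theorem lintegral_dist_rpow_step (hf : Measurable fun p : E × F × V => f p.1 p.2.1 p.2.2)
    (hc : ContractiveModConst f R ρ) {θ : ℝ} (hθ : θ ∈ Set.Ioo (0 : ℝ) 1) (y₀ z : E) (x : F) :
    ∫⁻ e, ENNReal.ofReal (dist y₀ (f z x e) ^ θ) ∂m ≤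
      stepMoment f m y₀ θ x + (ENNReal.ofReal (R ^ θ) +
        ENNReal.ofReal (ρ ^ θ) * ENNReal.ofReal (dist y₀ z ^ θ)) := by
  have hρ := hc.ρ_pos
  have hR := hc.R_pos
  calc ∫⁻ e, ENNReal.ofReal (dist y₀ (f z x e) ^ θ) ∂m
      ≤ ∫⁻ e, (ENNReal.ofReal (dist y₀ (f y₀ x e) ^ θ) + (ENNReal.ofReal (R ^ θ) +
        ENNReal.ofReal (ρ ^ θ) * ENNReal.ofReal (dist y₀ z ^ θ))) ∂m := by
        refine lintegral_mono fun e => ?_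
        have h1 : dist y₀ (f z x e) ≤ dist y₀ (f y₀ x e) + (R + ρ * dist y₀ z) := by
          have := dist_triangle y₀ (f y₀ x e) (f z x e)
          have := hc.dist_le y₀ z x e
          linarith
        have h2 : 0 ≤ ρ * dist y₀ z := by positivity
        calc ENNReal.ofReal (dist y₀ (f z x e) ^ θ)
            ≤ ENNReal.ofReal ((dist y₀ (f y₀ x e) + (R + ρ * dist y₀ z)) ^ θ) :=
              ENNReal.ofReal_le_ofReal (Real.rpow_le_rpow dist_nonneg h1 hθ.1.le)
          _ ≤ _ := ofReal_rpow_add_le dist_nonneg (by positivity) hθ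
          _ ≤ _ := by
              gcongr
              refine (ofReal_rpow_add_le hR.le h2 hθ).trans (le_of_eq ?_)
              rw [Real.mul_rpow hρ.le dist_nonneg, ENNReal.ofReal_mul (by positivity)]
    _ = _ := by
        have : Measurable fun e => ENNReal.ofReal (dist y₀ (f y₀ x e) ^ θ) :=
          (measurable_dist_rpow y₀ θ).comp (measurable_step hf y₀ x)
        rw [lintegral_add_left this, lintegral_const, measure_univ, mul_one, stepMoment]

/-- The rate r⁻ⁿ reproduces itself: the contracted earlier moment contributes r⁴ · B r⁻ⁿ⁻¹ ≤ r · B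
r⁻ⁿ, and B (1 - r) = C + R^θ pays for the new terms. The induction on p keeps n free because
removing the last step moves the final time from -n to -n-1. -/
theorem lintegral_dist_rpow_quenchedLaw (hf : Measurable fun p : E × F × V => f p.1 p.2.1 p.2.2)
    (hc : ContractiveModConst f R ρ) {θ : ℝ} (hθ : θ ∈ Set.Ioo (0 : ℝ) 1) (y₀ : E) {x : ℤ → F}
    {C : ℝ} (hC : 0 ≤ C) {r : ℝ} (hr0 : 0 < r) (hr1 : r < 1) (hrρ : ρ ^ θ = r ^ 4)
    (hx : ∀ n : ℕ, stepMoment f m y₀ θ (x (-n - 1)) ≤ ENNReal.ofReal (C * (r⁻¹) ^ n)) (p n : ℕ) :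
    ∫⁻ z, ENNReal.ofReal (dist y₀ z ^ θ) ∂(quenchedLaw f m x (-n - p) p y₀) ≤
      ENNReal.ofReal ((C + R ^ θ) / (1 - r) * (r⁻¹) ^ n) := by
  have hg := measurable_dist_rpow y₀ θ
  have hR := hc.R_pos
  have h1r : 0 < 1 - r := by linarith
  have hRθ : 0 ≤ R ^ θ := by positivity
  set B := (C + R ^ θ) / (1 - r) with hB
  have hB0 : 0 ≤ B := by positivity
  induction p generalizing n with
  | zero =>
    rw [quenchedLaw_zero, lintegral_dirac' _ hg, dist_self, Real.zero_rpow hθ.1.ne']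
    simp
  | succ p ih =>
    have e1 : (-(n : ℤ) - (p + 1 : ℕ)) = -((n + 1 : ℕ) : ℤ) - p := by push_cast; ring
    have e2 : -((n + 1 : ℕ) : ℤ) - p + p = -n - 1 := by push_cast; ring
    rw [e1, lintegral_quenchedLaw_succ hf _ _ _ _ hg, e2]
    have := isProbabilityMeasure_quenchedLaw (m := m) hf x (-((n + 1 : ℕ) : ℤ) - p) p y₀
    have hone : 1 ≤ (r⁻¹) ^ n := one_le_pow₀ ((one_lt_inv₀ hr0).2 hr1).le
    calc ∫⁻ z, ∫⁻ e, ENNReal.ofReal (dist y₀ (f z (x (-n - 1)) e) ^ θ) ∂m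
          ∂(quenchedLaw f m x (-((n + 1 : ℕ) : ℤ) - p) p y₀)
        ≤ ∫⁻ z, (stepMoment f m y₀ θ (x (-n - 1)) + (ENNReal.ofReal (R ^ θ) +
            ENNReal.ofReal (ρ ^ θ) * ENNReal.ofReal (dist y₀ z ^ θ)))
            ∂(quenchedLaw f m x (-((n + 1 : ℕ) : ℤ) - p) p y₀) :=
          lintegral_mono fun z => lintegral_dist_rpow_step hf hc hθ y₀ z _
      _ = stepMoment f m y₀ θ (x (-n - 1)) + (ENNReal.ofReal (R ^ θ) + ENNReal.ofReal (ρ ^ θ) *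
            ∫⁻ z, ENNReal.ofReal (dist y₀ z ^ θ)
              ∂(quenchedLaw f m x (-((n + 1 : ℕ) : ℤ) - p) p y₀)) := by
          rw [lintegral_add_left measurable_const, lintegral_add_left measurable_const,
            lintegral_const_mul _ hg, lintegral_const, lintegral_const, measure_univ, mul_one,
            mul_one]
      _ ≤ ENNReal.ofReal (C * (r⁻¹) ^ n) + (ENNReal.ofReal (R ^ θ) + ENNReal.ofReal (ρ ^ θ) *
            ENNReal.ofReal (B * (r⁻¹) ^ (n + 1))) := by
          gcongr
          · exact hx n
          · exact ih (n + 1)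
      _ = ENNReal.ofReal (C * (r⁻¹) ^ n + (R ^ θ + r ^ 4 * (B * (r⁻¹) ^ (n + 1)))) := by
          rw [hrρ, ← ENNReal.ofReal_mul (by positivity), ← ENNReal.ofReal_add (by positivity)
            (by positivity), ← ENNReal.ofReal_add (by positivity) (by positivity)]
      _ ≤ ENNReal.ofReal (B * (r⁻¹) ^ n) := by
          refine ENNReal.ofReal_le_ofReal ?_
          have h4 : r ^ 4 * (B * (r⁻¹) ^ (n + 1)) = r ^ 3 * (B * (r⁻¹) ^ n) := by
            rw [pow_succ (r⁻¹)]
            field_simp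
          have h5 : r ^ 3 ≤ r := by
            nlinarith [pow_pos hr0 2, pow_le_one₀ hr0.le hr1.le (n := 2)]
          have h6 : B * (1 - r) = C + R ^ θ := by
            rw [hB]; field_simp
          have h7 : 0 ≤ B * (r⁻¹) ^ n := by positivity
          rw [h4]
          have h8 : r ^ 3 * (B * (r⁻¹) ^ n) ≤ r * (B * (r⁻¹) ^ n) := by gcongr
          have h9 : R ^ θ ≤ R ^ θ * (r⁻¹) ^ n := by nlinarith
          have h10 : B * (r⁻¹) ^ n - r * (B * (r⁻¹) ^ n) = (C + R ^ θ) * (r⁻¹) ^ n := by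
            rw [← h6]; ring
          nlinarith

/-- The event bound in terms of the backward window. -/
theorem quenchedLaw_le_of_hasMergingTime {N : ℕ} (hN : HasMergingTime f m R ρ η N) (x : ℤ → F)
    (n : ℕ) (y y' : E) {A : Set E} (hA : MeasurableSet A) :
    quenchedLaw f m x (-n) n y A ≤ quenchedLaw f m x (-n) n y' A +
      ((if R / ρ ^ (n / 2) ≤ dist y y' then 1 else 0) + backwardProd η N x n) := by
  have := hN x (-n) n y y' (A.indicator 1) (measurable_one.indicator hA) fun u => by
    by_cases hu : u ∈ A <;> simp [hu]
  rwa [lintegral_indicator_one hA, lintegral_indicator_one hA] at this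

theorem tendsto_div_pow_half {R ρ : ℝ} (hR : 0 < R) (hρ0 : 0 < ρ) (hρ1 : ρ < 1) :
    Tendsto (fun n : ℕ => R / ρ ^ (n / 2)) atTop atTop := by
  have h1 : Tendsto (fun n : ℕ => R * (ρ⁻¹) ^ n) atTop atTop :=
    (tendsto_pow_atTop_atTop_of_one_lt ((one_lt_inv₀ hρ0).2 hρ1)).const_mul_atTop hR
  have h2 : Tendsto (fun n : ℕ => n / 2) atTop atTop :=
    tendsto_atTop.2 fun b => eventually_atTop.2 ⟨2 * b, fun n hn => by omega⟩
  refine (h1.comp h2).congr fun n => ?_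
  simp [div_eq_mul_inv]

theorem tendsto_indicator_zero {R ρ : ℝ} (hR : 0 < R) (hρ0 : 0 < ρ) (hρ1 : ρ < 1) (d : ℝ) :
    Tendsto (fun n : ℕ => if R / ρ ^ (n / 2) ≤ d then (1 : ℝ≥0∞) else 0) atTop (𝓝 0) := by
  refine tendsto_const_nhds.congr' ?_
  filter_upwards [(tendsto_div_pow_half hR hρ0 hρ1).eventually_gt_atTop d] with n hn
  rw [if_neg (not_le.2 hn)]

/-- The law from time -n-p mixes the laws from -n over the state z at time -n. States z with d(z,
y₀) below R/ρ^⌊n/2⌋ are handled by merging, the others by Markov's inequality. -/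
theorem exists_quenched_limit (hf : Measurable fun p : E × F × V => f p.1 p.2.1 p.2.2)
    (hc : ContractiveModConst f R ρ) {N : ℕ} (hN : HasMergingTime f m R ρ η N)
    {θ : ℝ} (hθ : θ ∈ Set.Ioo (0 : ℝ) 1) (y₀ : E) {x : ℤ → F}
    (hprod : Tendsto (backwardProd η N x) atTop (𝓝 0))
    {C : ℝ} (hC : 0 ≤ C) {r : ℝ} (hr0 : 0 < r) (hr1 : r < 1) (hrρ : ρ ^ θ = r ^ 4)
    (hx : ∀ n : ℕ, stepMoment f m y₀ θ (x (-n - 1)) ≤ ENNReal.ofReal (C * (r⁻¹) ^ n)) :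
    ∃ π : Measure E, IsProbabilityMeasure π ∧
      ∀ y, ConvergesUniformly (fun n : ℕ => quenchedLaw f m x (-n) n y) π := by
  have hρ := hc.ρ_pos
  have hR := hc.R_pos
  have h1r : 0 < 1 - r := by linarith
  have hRθ : 0 < R ^ θ := by positivity
  set B := (C + R ^ θ) / (1 - r) with hB
  have hB0 : 0 ≤ B := by positivity
  have hprob : ∀ (n : ℕ) y, IsProbabilityMeasure (quenchedLaw f m x (-n) n y) := fun n y =>
    isProbabilityMeasure_quenchedLaw hf x _ n y
  -- Markov bound for a far state: a moment of order r⁻ⁿ against a threshold of order r⁻²ⁿ. Rounding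
  -- in n/2 costs the factor r⁻² below.
  set a : ℕ → ℝ≥0∞ := fun n => ENNReal.ofReal (B * (r⁻¹) ^ n) /
    ENNReal.ofReal ((R / ρ ^ (n / 2)) ^ θ) with ha
  have ha0 : Tendsto a atTop (𝓝 0) := by
    have h1 : Tendsto (fun n : ℕ => ENNReal.ofReal (B / R ^ θ * (r⁻¹) ^ 2 * r ^ n)) atTop (𝓝 0) := by
      have := ((tendsto_pow_atTop_nhds_zero_of_lt_one hr0.le hr1).const_mul
        (B / R ^ θ * (r⁻¹) ^ 2))
      rw [mul_zero] at this
      have := ENNReal.tendsto_ofReal this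
      rwa [ENNReal.ofReal_zero] at this
    refine tendsto_of_tendsto_of_tendsto_of_le_of_le tendsto_const_nhds h1 (fun _ => zero_le)
      fun n => ?_
    have hpos : 0 < (R / ρ ^ (n / 2)) ^ θ := by positivity
    change ENNReal.ofReal _ / ENNReal.ofReal _ ≤ _
    rw [← ENNReal.ofReal_div_of_pos hpos]
    refine ENNReal.ofReal_le_ofReal ?_
    have e1 : (R / ρ ^ (n / 2)) ^ θ = R ^ θ / r ^ (4 * (n / 2)) := by
      rw [Real.div_rpow hR.le (by positivity), ← Real.rpow_natCast_mul hρ.le,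
        mul_comm ((n / 2 : ℕ) : ℝ), Real.rpow_mul_natCast hρ.le, hrρ, ← pow_mul]
    rw [e1, div_div_eq_mul_div, mul_assoc]
    have e2 : (r⁻¹) ^ n * r ^ (4 * (n / 2)) ≤ (r⁻¹) ^ 2 * r ^ n := by
      rw [inv_pow, inv_pow, inv_mul_le_iff₀ (by positivity)]
      have : r ^ n * ((r ^ 2)⁻¹ * r ^ n) = r ^ (2 * n) / r ^ 2 := by
        rw [two_mul, pow_add]; field_simp
      rw [this, le_div_iff₀ (by positivity), ← pow_add]
      exact pow_le_pow_of_le_one hr0.le hr1.le (by omega)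
    calc B * ((r⁻¹) ^ n * r ^ (4 * (n / 2))) / R ^ θ
        ≤ B * ((r⁻¹) ^ 2 * r ^ n) / R ^ θ := by gcongr
      _ = _ := by ring
  set c : ℕ → ℝ≥0∞ := fun n => a n + backwardProd η N x n with hcdef
  have hc0 : Tendsto c atTop (𝓝 0) := by simpa using ha0.add hprod
  have hcauchy : ∀ n p A, MeasurableSet A →
      quenchedLaw f m x (-((n + p : ℕ) : ℤ)) (n + p) y₀ A ≤
        quenchedLaw f m x (-n) n y₀ A + c n := by
    intro n p A hA
    have e1 : (-((n + p : ℕ) : ℤ)) = -n - p := by push_cast; ring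
    have e2 : -(n : ℤ) - p + p = -n := by ring
    rw [e1, add_comm n p, quenchedLaw_add,
      Measure.bind_apply hA (measurable_quenchedLaw _ _ _).aemeasurable, e2]
    have := isProbabilityMeasure_quenchedLaw (m := m) hf x (-(n : ℤ) - p) p y₀
    set lam := quenchedLaw f m x (-(n : ℤ) - p) p y₀ with hlam
    have hset : MeasurableSet {z : E | R / ρ ^ (n / 2) ≤ dist z y₀} :=
      measurableSet_le measurable_const (measurable_id.dist measurable_const)
    calc ∫⁻ z, quenchedLaw f m x (-n) n z A ∂lam
        ≤ ∫⁻ z, (quenchedLaw f m x (-n) n y₀ A + backwardProd η N x n +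
            {z : E | R / ρ ^ (n / 2) ≤ dist z y₀}.indicator 1 z) ∂lam := by
          refine lintegral_mono fun z => (quenchedLaw_le_of_hasMergingTime hN x n z y₀ hA).trans ?_
          rw [add_assoc, add_comm (backwardProd η N x n)]
          gcongr
          by_cases hz : R / ρ ^ (n / 2) ≤ dist z y₀ <;> simp [Set.indicator, hz]
      _ = quenchedLaw f m x (-n) n y₀ A + backwardProd η N x n +
            lam {z : E | R / ρ ^ (n / 2) ≤ dist z y₀} := by
          rw [lintegral_add_left measurable_const, lintegral_const, measure_univ, mul_one,
            lintegral_indicator_one hset]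
      _ ≤ quenchedLaw f m x (-n) n y₀ A + backwardProd η N x n + a n := by
          gcongr
          have hpos : 0 < (R / ρ ^ (n / 2)) ^ θ := by positivity
          have hsub : {z : E | R / ρ ^ (n / 2) ≤ dist z y₀} ⊆
              {z | ENNReal.ofReal ((R / ρ ^ (n / 2)) ^ θ) ≤ ENNReal.ofReal (dist y₀ z ^ θ)} := by
            intro z hz
            rw [Set.mem_ofPred_eq, dist_comm] at hz
            exact ENNReal.ofReal_le_ofReal (Real.rpow_le_rpow (by positivity) hz hθ.1.le)
          refine (measure_mono hsub).trans ?_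
          refine (meas_ge_le_lintegral_div (measurable_dist_rpow y₀ θ).aemeasurable
            (by simpa using hpos) ENNReal.ofReal_ne_top).trans ?_
          rw [ha]
          refine ENNReal.div_le_div_right ?_ _
          exact lintegral_dist_rpow_quenchedLaw hf hc hθ y₀ hC hr0 hr1 hrρ hx p n
      _ = _ := by rw [hcdef]; ring
  obtain ⟨π, hπ, hπ1, hπ2⟩ := exists_limit_of_uniform_cauchy (fun n => hprob n y₀) hc0 hcauchy
  refine ⟨π, hπ, fun y => ⟨fun n => c n + ((if R / ρ ^ (n / 2) ≤ dist y y₀ then 1 else 0) +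
    backwardProd η N x n), ?_, fun n A hA => ⟨?_, ?_⟩⟩⟩
  · have := hc0.add ((tendsto_indicator_zero hR hρ hc.ρ_lt_one (dist y y₀)).add hprod)
    simpa using this
  · calc quenchedLaw f m x (-n) n y A ≤ _ := quenchedLaw_le_of_hasMergingTime hN x n y y₀ hA
      _ ≤ π A + c n + _ := by gcongr; exact hπ2 n A hA
      _ = _ := by ring
  · calc π A ≤ quenchedLaw f m x (-n) n y₀ A + c n := hπ1 n A hA
      _ ≤ quenchedLaw f m x (-n) n y A + _ + c n := by
          gcongr; exact quenchedLaw_le_of_hasMergingTime hN x n y₀ y hA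
      _ = _ := by rw [dist_comm y₀ y]; ring

variable {μ : Measure (ℤ → F)} [IsProbabilityMeasure μ]

/-- `Φ` is a version of the limit of the quenched laws started in the remote past. -/
structure IsPullbackLimit (f : E → F → V → E) (m : Measure V) (μ : Measure (ℤ → F))
    (Φ : (ℤ → F) → Measure E) : Prop where
  measurable : Measurable Φ
  prob : ∀ x, IsProbabilityMeasure (Φ x)
  converges : ∀ᵐ x ∂μ, ∀ y, ConvergesUniformly (fun n : ℕ => quenchedLaw f m x (-n) n y) (Φ x)

theorem measurable_quenchedLaw_left (hf : Measurable fun p : E × F × V => f p.1 p.2.1 p.2.2)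
    (s : ℤ) (n : ℕ) (y : E) : Measurable fun x : ℤ → F => quenchedLaw f m x s n y := by
  have h1 : Measurable fun x : ℤ → F => (x, y) := by fun_prop
  have h2 := (measurable_quenchedLaw_prod (m := m) hf s n).comp h1
  exact h2

theorem exists_isPullbackLimit (hf : Measurable fun p : E × F × V => f p.1 p.2.1 p.2.2)
    (hc : ContractiveModConst f R ρ) (hη : Measurable η) (h01 : ∀ x, η x ∈ Set.Ioc (0 : ℝ) 1)
    {N : ℕ} (hN0 : 0 < N) (hN : HasMergingTime f m R ρ η N)
    {θ : ℝ} (hθ : θ ∈ Set.Ioo (0 : ℝ) 1) (y₀ : E) (hμ : MeasurePreserving pathShift μ μ)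
    (hlog : HasLogMoment μ fun x => stepMoment f m y₀ θ (x 0)) :
    ∃ Φ : (ℤ → F) → Measure E, IsPullbackLimit f m μ Φ := by
  have hρ := hc.ρ_pos
  -- With ρ^θ = r⁴ the tolerated moment growth is about r⁻²ⁿ, leaving room for growth r⁻ⁿ.
  set r : ℝ := ρ ^ (θ / 4) with hr
  have hr0 : 0 < r := by positivity
  have hr1 : r < 1 := Real.rpow_lt_one hρ.le hc.ρ_lt_one (by linarith [hθ.1])
  have hrρ : ρ ^ θ = r ^ 4 := by
    rw [hr, ← Real.rpow_mul_natCast hρ.le]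
    congr 1
    push_cast
    ring
  have hgood : ∀ᵐ x ∂μ, ∃ π : Measure E, IsProbabilityMeasure π ∧
      ∀ y, ConvergesUniformly (fun n : ℕ => quenchedLaw f m x (-n) n y) π := by
    filter_upwards [ae_tendsto_backwardProd hμ hη h01 hN0,
      ae_exists_geometric_bound hμ hlog hr0 hr1] with x h1 h2
    obtain ⟨C, hC, hx⟩ := h2
    exact exists_quenched_limit hf hc hN hθ y₀ h1 hC hr0 hr1 hrρ hx
  -- A Dirac mass on a measurable null set turns almost sure convergence into convergence
  -- everywhere, so that Φ is measurable as a pointwise limit.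
  obtain ⟨G, hGsub, hGm, hGc⟩ := exists_measurable_superset_of_null (ae_iff.1 hgood)
  have hG : ∀ x, x ∉ G → ∃ π : Measure E, IsProbabilityMeasure π ∧
      ∀ y, ConvergesUniformly (fun n : ℕ => quenchedLaw f m x (-n) n y) π := by
    intro x hx
    by_contra hne
    exact hx (hGsub hne)
  choose! L hLp hLc using hG
  classical
  obtain ⟨Φ, hΦG, hΦL⟩ : ∃ Φ : (ℤ → F) → Measure E,
      (∀ x ∈ G, Φ x = Measure.dirac y₀) ∧ ∀ x, x ∉ G → Φ x = L x :=
    ⟨fun x => if x ∈ G then Measure.dirac y₀ else L x, fun x hx => if_pos hx,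
      fun x hx => if_neg hx⟩
  have hΦp : ∀ x, IsProbabilityMeasure (Φ x) := by
    intro x
    by_cases hx : x ∈ G
    · rw [hΦG x hx]; infer_instance
    · rw [hΦL x hx]; exact hLp x hx
  refine ⟨Φ, ?_, hΦp, ?_⟩
  · have hq : ∀ n : ℕ, Measurable fun x : ℤ → F => quenchedLaw f m x (-(n : ℤ)) n y₀ := fun n =>
      measurable_quenchedLaw_left hf _ n y₀
    refine measurable_of_tendsto_apply
      (q := fun (n : ℕ) x => if x ∈ G then Measure.dirac y₀ else quenchedLaw f m x (-(n : ℤ)) n y₀)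
      (fun n => Measurable.ite hGm
      (measurable_const (a := Measure.dirac y₀)) (hq n)) fun x A hA => ?_
    by_cases hx : x ∈ G
    · simp only [if_pos hx, hΦG x hx]; exact tendsto_const_nhds
    · simp only [if_neg hx, hΦL x hx]
      have := hLp x hx
      exact (hLc x hx y₀).tendsto_apply hA
  · filter_upwards [measure_eq_zero_iff_ae_notMem.1 hGc] with x hx y
    rw [hΦL x hx]
    exact hLc x hx y

/-- The law from -n followed by the step at time 0 is the law of n + 1 steps in the shifted
environment; both sides are passed to the limit. -/
theorem IsPullbackLimit.bind_transKernel {Φ : (ℤ → F) → Measure E} (hΦ : IsPullbackLimit f m μ Φ)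
    (hf : Measurable fun p : E × F × V => f p.1 p.2.1 p.2.2) (y₀ : E)
    (hμ : MeasurePreserving pathShift μ μ) :
    ∀ᵐ x ∂μ, (Φ x).bind (transKernel f m (x 0)) = Φ (shiftBy 1 x) := by
  filter_upwards [hΦ.converges,
    (measurePreserving_shiftBy hμ 1).quasiMeasurePreserving.ae hΦ.converges] with x h1 h2
  have := hΦ.prob x
  have := hΦ.prob (shiftBy 1 x)
  have := isMarkovKernel_transKernel (m := m) hf (x 0)
  have : ∀ n : ℕ, IsProbabilityMeasure (quenchedLaw f m x (-n) n y₀) := fun n =>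
    isProbabilityMeasure_quenchedLaw hf x _ n y₀
  have h3 := (h1 y₀).bind (transKernel f m (x 0))
  ext A hA
  have h4 := (h2 y₀).tendsto_apply hA
  have h5 := h3.tendsto_apply hA
  refine tendsto_nhds_unique h5 ?_
  refine ((tendsto_add_atTop_iff_nat 1).2 h4).congr fun n => ?_
  rw [quenchedLaw_shiftBy hf, quenchedLaw_succ]
  have e1 : -((n + 1 : ℕ) : ℤ) + 1 = -n := by push_cast; ring
  rw [e1]
  simp

end Backward

/-! ### Two-sided laws are determined by their tails -/

section TailLaws

variable {A H : Type*} [MeasurableSpace A] [MeasurableSpace H]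

/-- The part of a two-sided sequence from time `t` on. -/
def tailFrom {H : Type*} (t : ℤ) (w : ℤ → H) : ℕ → H := fun j => w (t + j)

@[fun_prop]
theorem measurable_tailFrom (t : ℤ) : Measurable (tailFrom t : (ℤ → H) → ℕ → H) :=
  measurable_pi_lambda _ fun _ => measurable_pi_apply _

/-- A finite measure on `A × (ℤ → H)` is determined by its images on `A × (ℕ → H)`. -/
theorem measure_prod_ext_of_map_tailFrom {μ ν : Measure (A × (ℤ → H))} [IsFiniteMeasure μ]
    [IsFiniteMeasure ν]
    (h : ∀ t, μ.map (fun p => (p.1, tailFrom t p.2)) = ν.map (fun p => (p.1, tailFrom t p.2))) :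
    μ = ν := by
  have key : ∀ (I : Finset ℤ) (s : Set A), MeasurableSet s →
      ((μ.restrict (s ×ˢ Set.univ)).map Prod.snd).map I.restrict =
        ((ν.restrict (s ×ˢ Set.univ)).map Prod.snd).map I.restrict := by
    intro I s hs
    -- A finite set of times has a lower bound t, so its coordinates can be read off the tail from
    -- t.
    obtain ⟨t, ht⟩ := I.bddBelow
    have hg : Measurable fun q : A × (ℕ → H) => fun i : I => q.2 ((i : ℤ) - t).toNat := by fun_prop
    have hI : Measurable (I.restrict : (ℤ → H) → _) := Finset.measurable_restrict I
    ext B hB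
    have hC : MeasurableSet ((s ×ˢ Set.univ) ∩
        {q : A × (ℕ → H) | (fun i : I => q.2 ((i : ℤ) - t).toNat) ∈ B}) :=
      (hs.prod MeasurableSet.univ).inter (hg hB)
    have hset : ∀ κ : Measure (A × (ℤ → H)),
        ((κ.restrict (s ×ˢ Set.univ)).map Prod.snd).map I.restrict B =
          κ.map (fun p => (p.1, tailFrom t p.2))
            ((s ×ˢ Set.univ) ∩ {q | (fun i : I => q.2 ((i : ℤ) - t).toNat) ∈ B}) := by
      intro κ
      rw [Measure.map_apply hI hB, Measure.map_apply measurable_snd (hI hB),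
        Measure.restrict_apply (measurable_snd (hI hB)), Measure.map_apply (by fun_prop) hC, Set.inter_comm]
      congr 1
      ext p
      have : (fun i : I => tailFrom t p.2 ((i : ℤ) - t).toNat) = I.restrict p.2 := by
        funext i
        have hi : t ≤ (i : ℤ) := ht i.2
        have hi' : t + (((i : ℤ) - t).toNat : ℤ) = i := by omega
        simp only [tailFrom, Finset.restrict, hi']
      simp only [Set.mem_inter_iff, Set.mem_prod, Set.mem_univ, and_true, Set.mem_preimage,
        Set.mem_ofPred_eq, this]
    rw [hset, hset, h t]
  refine Measure.ext_prod fun {s B} hs hB => ?_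
  have h1 : (μ.restrict (s ×ˢ Set.univ)).map Prod.snd = (ν.restrict (s ×ˢ Set.univ)).map Prod.snd :=
    IsProjectiveLimit.unique (P := fun I => ((ν.restrict (s ×ˢ Set.univ)).map Prod.snd).map I.restrict)
      (fun I => key I s hs) fun I => rfl
  have h2 : ∀ κ : Measure (A × (ℤ → H)),
      κ (s ×ˢ B) = (κ.restrict (s ×ˢ Set.univ)).map Prod.snd B := by
    intro κ
    rw [Measure.map_apply measurable_snd hB, Measure.restrict_apply (measurable_snd hB)]
    congr 1
    ext p
    simp [and_comm]
  rw [h2, h2, h1]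

end TailLaws

/-! ### Weak solutions and uniqueness in law -/

section WeakSolution

/-- A recursion that merges from any two states, in a stationary environment of law `μ`, together
with its pullback limit `Φ`. -/
structure MergingSystem {E F V : Type*} [MetricSpace E] [MeasurableSpace E] [MeasurableSpace F]
    [MeasurableSpace V] (f : E → F → V → E) (m : Measure V) (μ : Measure (ℤ → F)) (R ρ : ℝ)
    (η : F → ℝ) (N : ℕ) (Φ : (ℤ → F) → Measure E) : Prop where
  measurable_step : Measurable fun p : E × F × V => f p.1 p.2.1 p.2.2
  contractive : ContractiveModConst f R ρ
  measurable_η : Measurable η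
  η_mem : ∀ x, η x ∈ Set.Ioc (0 : ℝ) 1
  N_pos : 0 < N
  merging : HasMergingTime f m R ρ η N
  stationary : MeasurePreserving pathShift μ μ
  pullback : IsPullbackLimit f m μ Φ

section Kernel

variable {E F V : Type*} [MetricSpace E] [MeasurableSpace E] [MeasurableSpace F]
  [MeasurableSpace V] {f : E → F → V → E} {m : Measure V} {μ : Measure (ℤ → F)} {R ρ : ℝ}
  {η : F → ℝ} {N : ℕ} {Φ : (ℤ → F) → Measure E}

/-- The kernel given by the pullback limit. -/
def MergingSystem.kernel (H : MergingSystem f m μ R ρ η N Φ) : Kernel (ℤ → F) E :=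
  ⟨Φ, H.pullback.measurable⟩

instance (H : MergingSystem f m μ R ρ η N Φ) : IsMarkovKernel H.kernel :=
  ⟨H.pullback.prob⟩

end Kernel

variable {E F V Ω : Type*} [MetricSpace E] [PolishSpace E] [MeasurableSpace E] [BorelSpace E]
  [MeasurableSpace F] [MeasurableSpace V] [MeasurableSpace Ω]
  {f : E → F → V → E} {m : Measure V} [IsProbabilityMeasure m]
  {μ : Measure (ℤ → F)} [IsProbabilityMeasure μ] {P : Measure Ω} [IsProbabilityMeasure P]
  {X : ℤ → Ω → F} {ε : ℤ → Ω → V} {Y : ℤ → Ω → E}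
  {R ρ : ℝ} {η : F → ℝ} {N : ℕ} {Φ : (ℤ → F) → Measure E}

/-- A solution of the recursion on the whole time line with identically distributed states that
are not influenced by the later noise. -/
structure IsWeakSolution (f : E → F → V → E) (m : Measure V) [IsProbabilityMeasure m]
    (μ : Measure (ℤ → F)) (P : Measure Ω) (X : ℤ → Ω → F) (ε : ℤ → Ω → V) (Y : ℤ → Ω → E) :
    Prop where
  measurable_X : ∀ t, Measurable (X t)
  measurable_ε : ∀ t, Measurable (ε t)
  measurable_Y : ∀ t, Measurable (Y t)
  law_X : pathLaw P X = μ
  fresh : ∀ t, IsFreshNoise P m (fun ω => ((fun s => X s ω : ℤ → F), Y t ω))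
    (fun ω => tailFrom (t + 1) fun s => ε s ω)
  recursion : ∀ t, ∀ᵐ ω ∂P, Y (t + 1) ω = f (Y t ω) (X t ω) (ε (t + 1) ω)
  law_Y : ∀ t, P.map (Y t) = P.map (Y 0)

namespace IsWeakSolution

variable (h : IsWeakSolution f m μ P X ε Y)
include h

theorem measurable_env : Measurable fun ω (s : ℤ) => X s ω := measurable_pi_lambda _ h.measurable_X

theorem measurable_noise (t : ℤ) : Measurable fun ω => tailFrom t fun s => ε s ω :=
  (measurable_tailFrom t).comp (measurable_pi_lambda _ h.measurable_ε)

theorem shift (hμ : MeasurePreserving pathShift μ μ) (r : ℤ) :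
    IsWeakSolution f m μ P (fun t => X (t + r)) (fun t => ε (t + r)) (fun t => Y (t + r)) where
  measurable_X t := h.measurable_X _
  measurable_ε t := h.measurable_ε _
  measurable_Y t := h.measurable_Y _
  law_X := by
    have := (measurePreserving_shiftBy hμ r).map_eq
    rw [← h.law_X, pathLaw, Measure.map_map (measurable_shiftBy r) h.measurable_env] at this
    rw [← h.law_X]
    exact this
  fresh t := by
    have h1 := (h.fresh (t + r)).comp (h.measurable_env.prodMk (h.measurable_Y _))
      (h.measurable_noise _) (g := Prod.map (shiftBy r) id) (by fun_prop)
    convert h1 using 1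
    · rfl
    · funext ω j
      simp only [tailFrom]
      congr 1
      ring
  recursion t := by
    have := h.recursion (t + r)
    simpa only [add_right_comm] using this
  law_Y t := by rw [h.law_Y, h.law_Y (0 + r)]

theorem state_eq (s : ℤ) : ∀ᵐ ω ∂P, ∀ n : ℕ, Y (s + n) ω =
    forwardPath f (shiftBy s fun r => X r ω) (Y s ω) (tailFrom (s + 1) fun r => ε r ω) n := by
  filter_upwards [ae_all_iff.2 h.recursion] with ω hω n
  induction n with
  | zero => simp [forwardPath]
  | succ n ih =>
    have := hω (s + n)
    rw [Nat.cast_succ, ← add_assoc, this, ih, forwardPath]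
    simp only [shiftBy, tailFrom]
    congr 2 <;> ring

/-- The conditional law of the state given the environment and an earlier state. -/
theorem measure_state (hf : Measurable fun p : E × F × V => f p.1 p.2.1 p.2.2) (n : ℕ)
    {A : Set (ℤ → F)} (hA : MeasurableSet A) {B : Set E} (hB : MeasurableSet B) :
    P {ω | (fun s => X s ω) ∈ A ∧ Y 0 ω ∈ B} =
      ∫⁻ ω in {ω | (fun s => X s ω) ∈ A},
        quenchedLaw f m (fun s => X s ω) (-n) n (Y (-n) ω) B ∂P := by
  have hu := h.measurable_env.prodMk (h.measurable_Y (-n))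
  have he := h.measurable_noise (-n + 1)
  have hstep : Measurable fun p : ((ℤ → F) × E) × (ℕ → V) =>
      forwardPath f (shiftBy (-n) p.1.1) p.1.2 p.2 n :=
    (measurable_forwardPath hf n).comp (by fun_prop :
      Measurable fun p : ((ℤ → F) × E) × (ℕ → V) => (shiftBy (-(n : ℤ)) p.1.1, p.1.2, p.2))
  have hS : MeasurableSet {p : ((ℤ → F) × E) × (ℕ → V) | p.1.1 ∈ A ∧
      forwardPath f (shiftBy (-n) p.1.1) p.1.2 p.2 n ∈ B} :=
    (measurable_fst.fst hA).inter (hstep hB)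
  have h1 : P {ω | (fun s => X s ω) ∈ A ∧ Y 0 ω ∈ B} =
      P.map (fun ω => (((fun s => X s ω : ℤ → F), Y (-n) ω), tailFrom (-n + 1) fun s => ε s ω))
        {p | p.1.1 ∈ A ∧ forwardPath f (shiftBy (-n) p.1.1) p.1.2 p.2 n ∈ B} := by
    rw [Measure.map_apply (hu.prodMk he) hS]
    refine measure_congr ?_
    filter_upwards [h.state_eq (-n)] with ω hω
    have := hω n
    rw [neg_add_cancel] at this
    refine propext ?_
    change _ ∧ _ ↔ _ ∧ _
    rw [this]
  have hq : ∀ p : (ℤ → F) × E, noiseLaw m {e | p.1 ∈ A ∧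
      forwardPath f (shiftBy (-n) p.1) p.2 e n ∈ B} =
        {p : (ℤ → F) × E | p.1 ∈ A}.indicator (fun p => quenchedLaw f m p.1 (-n) n p.2 B) p := by
    intro p
    have hp : Measurable fun e => forwardPath f (shiftBy (-n) p.1) p.2 e n :=
      hstep.comp (measurable_prodMk_left (x := p))
    by_cases hpA : p.1 ∈ A
    · rw [Set.indicator_of_mem (by exact hpA), quenchedLaw_eq_map hf, Measure.map_apply hp hB]
      simp only [hpA, true_and]
      rfl
    · rw [Set.indicator_of_notMem (by exact hpA)]
      simp [hpA]
  have hqm : Measurable fun p : (ℤ → F) × E => quenchedLaw f m p.1 (-n) n p.2 B :=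
    (Measure.measurable_coe hB).comp (measurable_quenchedLaw_prod (m := m) hf (-(n : ℤ)) n)
  have hAm : MeasurableSet {p : (ℤ → F) × E | p.1 ∈ A} := measurable_fst hA
  have hAω : MeasurableSet {ω | (fun s => X s ω) ∈ A} := h.measurable_env hA
  rw [h1, h.fresh (-n), Measure.prod_apply hS, ← lintegral_indicator hAω]
  refine (lintegral_congr fun p => hq p).trans ?_
  rw [lintegral_map (hqm.indicator hAm) hu]
  rfl

/-- Y (-n) has the law of Y 0, so it is within R/ρ^⌊n/2⌋ of y₀ with probability tending to one. It
can be replaced by y₀ at vanishing cost, whatever its dependence on the environment, and the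
quenched laws from y₀ converge to Φ. -/
theorem map_state (H : MergingSystem f m μ R ρ η N Φ) (y₀ : E) :
    P.map (fun ω => ((fun s => X s ω : ℤ → F), Y 0 ω)) = μ ⊗ₘ H.kernel := by
  have hf := H.measurable_step
  have hc := H.contractive
  have hη := H.measurable_η
  have h01 := H.η_mem
  have hN0 := H.N_pos
  have hN := H.merging
  have hμ := H.stationary
  have hΦ := H.pullback
  have hx := h.measurable_env
  have hu := hx.prodMk (h.measurable_Y 0)
  have hlaw : P.map (fun ω (s : ℤ) => X s ω) = μ := h.law_X
  have : IsProbabilityMeasure (P.map fun ω => ((fun s => X s ω : ℤ → F), Y 0 ω)) :=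
    Measure.isProbabilityMeasure_map hu.aemeasurable
  have : IsProbabilityMeasure (P.map (Y 0)) :=
    Measure.isProbabilityMeasure_map (h.measurable_Y 0).aemeasurable
  refine Measure.ext_prod fun {A B} hA hB => ?_
  have hAω : MeasurableSet {ω | (fun s => X s ω) ∈ A} := hx hA
  rw [Measure.compProd_apply_prod hA hB, Measure.map_apply hu (hA.prod hB)]
  have hfar : ∀ n : ℕ, Measurable fun y : E =>
      if R / ρ ^ (n / 2) ≤ dist y y₀ then (1 : ℝ≥0∞) else 0 := fun n =>
    Measurable.ite (measurableSet_le measurable_const (measurable_id.dist measurable_const))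
      measurable_const measurable_const
  set a : ℕ → ℝ≥0∞ := fun n => ∫⁻ x in A, quenchedLaw f m x (-n) n y₀ B ∂μ with ha
  -- The merging bound averaged over environment and starting state; identical distribution of the
  -- states fixes the measure in the first integral.
  set c : ℕ → ℝ≥0∞ := fun n => ∫⁻ y, (if R / ρ ^ (n / 2) ≤ dist y y₀ then 1 else 0) ∂(P.map (Y 0)) +
    ∫⁻ x, backwardProd η N x n ∂μ with hcdef
  have hc0 : Tendsto c atTop (𝓝 0) := by
    have t1 : Tendsto (fun n : ℕ => ∫⁻ y, (if R / ρ ^ (n / 2) ≤ dist y y₀ then (1 : ℝ≥0∞) else 0)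
        ∂(P.map (Y 0))) atTop (𝓝 (∫⁻ _, 0 ∂(P.map (Y 0)))) := by
      refine tendsto_lintegral_of_dominated_convergence (fun _ => 1) hfar
        (fun n => Eventually.of_forall fun y => ?_) (by simp) (Eventually.of_forall fun y => ?_)
      · show (if R / ρ ^ (n / 2) ≤ dist y y₀ then (1 : ℝ≥0∞) else 0) ≤ 1
        split_ifs <;> simp
      · exact tendsto_indicator_zero hc.R_pos hc.ρ_pos hc.ρ_lt_one _
    have t2 : Tendsto (fun n : ℕ => ∫⁻ x, backwardProd η N x n ∂μ) atTop (𝓝 (∫⁻ _, 0 ∂μ)) :=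
      tendsto_lintegral_of_dominated_convergence (fun _ => 1) (measurable_backwardProd hη N)
        (fun n => Eventually.of_forall fun x => backwardProd_le_one h01 N x n) (by simp)
        (ae_tendsto_backwardProd hμ hη h01 hN0)
    simpa using t1.add t2
  have ha1 : Tendsto a atTop (𝓝 (∫⁻ x in A, H.kernel x B ∂μ)) := by
    refine tendsto_lintegral_of_dominated_convergence (fun _ => 1)
      (fun n => (Measure.measurable_coe hB).comp (measurable_quenchedLaw_left hf _ n y₀))
      (fun n => Eventually.of_forall fun x => ?_) (by simp) (ae_restrict_of_ae ?_)
    · have := isProbabilityMeasure_quenchedLaw (m := m) hf x (-n) n y₀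
      exact prob_le_one
    · filter_upwards [hΦ.converges] with x hx
      have := hΦ.prob x
      exact (hx y₀).tendsto_apply hB
  have haω : ∀ n, a n = ∫⁻ ω in {ω | (fun s => X s ω) ∈ A},
      quenchedLaw f m (fun s => X s ω) (-n) n y₀ B ∂P := by
    intro n
    have hq : Measurable fun x => quenchedLaw f m x (-n) n y₀ B :=
      (Measure.measurable_coe hB).comp (measurable_quenchedLaw_left hf _ n y₀)
    rw [ha]
    simp only
    rw [← hlaw, setLIntegral_map hA hq hx]
    rfl
  have hcω : ∀ n : ℕ, ∫⁻ ω, ((if R / ρ ^ (n / 2) ≤ dist (Y (-n) ω) y₀ then 1 else 0) +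
      backwardProd η N (fun s => X s ω) n) ∂P = c n := by
    intro n
    have e1 : ∫⁻ y, (if R / ρ ^ (n / 2) ≤ dist y y₀ then (1 : ℝ≥0∞) else 0) ∂(P.map (Y 0)) =
        ∫⁻ ω, (if R / ρ ^ (n / 2) ≤ dist (Y (-n) ω) y₀ then (1 : ℝ≥0∞) else 0) ∂P := by
      rw [← h.law_Y (-n), lintegral_map (hfar n) (h.measurable_Y _)]
    have e2 : ∫⁻ x, backwardProd η N x n ∂μ = ∫⁻ ω, backwardProd η N (fun s => X s ω) n ∂P := by
      rw [← hlaw, lintegral_map (measurable_backwardProd hη N n) hx]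
    rw [hcdef]
    simp only
    have hm : Measurable fun ω => if R / ρ ^ (n / 2) ≤ dist (Y (-n) ω) y₀ then (1 : ℝ≥0∞) else 0 :=
      (hfar n).comp (h.measurable_Y _)
    rw [e1, e2, lintegral_add_left hm]
  have hadd : ∀ n : ℕ, Measurable fun ω => quenchedLaw f m (fun s => X s ω) (-n) n y₀ B := fun n =>
    (Measure.measurable_coe hB).comp ((measurable_quenchedLaw_left hf _ n y₀).comp hx)
  have hadd' : ∀ n : ℕ, Measurable fun ω =>
      quenchedLaw f m (fun s => X s ω) (-n) n (Y (-n) ω) B := fun n => by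
    have h1 : Measurable fun ω => ((fun s => X s ω : ℤ → F), Y (-n) ω) :=
      hx.prodMk (h.measurable_Y (-n))
    have h2 := (measurable_quenchedLaw_prod (m := m) hf (-(n : ℤ)) n).comp h1
    exact (Measure.measurable_coe hB).comp h2
  refine tendsto_nhds_unique (tendsto_of_le_add hc0 (fun n => ?_) fun n => ?_) ha1
  · change a n ≤ P {ω | (fun s => X s ω) ∈ A ∧ Y 0 ω ∈ B} + c n
    rw [h.measure_state hf n hA hB, haω, ← hcω]
    refine le_trans ?_ (add_le_add le_rfl (setLIntegral_le_lintegral {ω | (fun s => X s ω) ∈ A} _))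
    rw [← lintegral_add_left (hadd' n)]
    refine lintegral_mono fun ω => ?_
    rw [dist_comm]
    exact quenchedLaw_le_of_hasMergingTime hN _ n _ _ hB
  · change P {ω | (fun s => X s ω) ∈ A ∧ Y 0 ω ∈ B} ≤ a n + c n
    rw [h.measure_state hf n hA hB, haω, ← hcω]
    refine le_trans ?_ (add_le_add le_rfl (setLIntegral_le_lintegral {ω | (fun s => X s ω) ∈ A} _))
    rw [← lintegral_add_left (hadd n)]
    exact lintegral_mono fun ω => quenchedLaw_le_of_hasMergingTime hN _ n _ _ hB

/-- The law of the environment and the states from time `0` on. -/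
theorem map_tailFrom_zero (H : MergingSystem f m μ R ρ η N Φ) (y₀ : E) :
    P.map (fun ω => ((fun s => X s ω : ℤ → F), tailFrom 0 fun s => Y s ω)) =
      ((μ ⊗ₘ H.kernel).prod (noiseLaw m)).map
        fun p => (p.1.1, fun n => forwardPath f p.1.1 p.1.2 p.2 n) := by
  have hg : Measurable fun p : ((ℤ → F) × E) × (ℕ → V) =>
      (p.1.1, fun n => forwardPath f p.1.1 p.1.2 p.2 n) := by
    refine measurable_fst.fst.prodMk (measurable_pi_lambda _ fun n => ?_)
    exact (measurable_forwardPath H.measurable_step n).comp (by fun_prop :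
      Measurable fun p : ((ℤ → F) × E) × (ℕ → V) => (p.1.1, p.1.2, p.2))
  have hu := h.measurable_env.prodMk (h.measurable_Y 0)
  have he := h.measurable_noise (0 + 1)
  rw [← h.map_state H y₀, ← h.fresh 0, Measure.map_map hg (hu.prodMk he)]
  refine Measure.map_congr ?_
  filter_upwards [h.state_eq 0] with ω hω
  refine Prod.ext rfl (funext fun n => ?_)
  have := hω n
  rw [shiftBy_zero] at this
  exact this

theorem map_tailFrom (H : MergingSystem f m μ R ρ η N Φ) (y₀ : E) (t : ℤ) :
    P.map (fun ω => ((fun s => X s ω : ℤ → F), tailFrom t fun s => Y s ω)) =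
      (((μ ⊗ₘ H.kernel).prod (noiseLaw m)).map
        fun p => (p.1.1, fun n => forwardPath f p.1.1 p.1.2 p.2 n)).map
          (Prod.map (shiftBy (-t)) id) := by
  have hs := h.shift H.stationary t
  have hm : Measurable fun ω => tailFrom 0 fun s => Y (s + t) ω :=
    (measurable_tailFrom 0).comp (measurable_pi_lambda _ hs.measurable_Y)
  rw [← hs.map_tailFrom_zero H y₀, Measure.map_map (by fun_prop) (hs.measurable_env.prodMk hm)]
  congr 1
  funext ω
  refine Prod.ext (funext fun s => ?_) (funext fun n => ?_)
  · change _ = X (s + -t + t) ω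
    rw [neg_add_cancel_right]
  · change Y (t + n) ω = Y (0 + n + t) ω
    rw [zero_add, add_comm]

/-- The joint law of the environment and the states from time t on is expressed through μ, Φ and m
alone, for every t. -/
theorem map_path_eq {Ω' : Type*} [MeasurableSpace Ω'] {P' : Measure Ω'} [IsProbabilityMeasure P']
    {X' : ℤ → Ω' → F} {ε' : ℤ → Ω' → V} {Y' : ℤ → Ω' → E}
    (h' : IsWeakSolution f m μ P' X' ε' Y') (H : MergingSystem f m μ R ρ η N Φ) (y₀ : E) :
    P.map (fun ω => ((fun s => X s ω : ℤ → F), fun s => Y s ω)) =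
      P'.map (fun ω => ((fun s => X' s ω : ℤ → F), fun s => Y' s ω)) := by
  have hm := h.measurable_env.prodMk (measurable_pi_lambda _ h.measurable_Y)
  have hm' := h'.measurable_env.prodMk (measurable_pi_lambda _ h'.measurable_Y)
  refine measure_prod_ext_of_map_tailFrom fun t => ?_
  rw [Measure.map_map (by fun_prop) hm, Measure.map_map (by fun_prop) hm']
  exact (h.map_tailFrom H y₀ t).trans (h'.map_tailFrom H y₀ t).symm

/-- Uniqueness in law. -/
theorem pathLaw_eq {Ω' : Type*} [MeasurableSpace Ω'] {P' : Measure Ω'} [IsProbabilityMeasure P']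
    {X' : ℤ → Ω' → F} {ε' : ℤ → Ω' → V} {Y' : ℤ → Ω' → E}
    (h' : IsWeakSolution f m μ P' X' ε' Y') (H : MergingSystem f m μ R ρ η N Φ) (y₀ : E) :
    pathLaw P (fun t ω => (X t ω, Y t ω)) = pathLaw P' (fun t ω => (X' t ω, Y' t ω)) := by
  have hm := h.measurable_env.prodMk (measurable_pi_lambda _ h.measurable_Y)
  have hm' := h'.measurable_env.prodMk (measurable_pi_lambda _ h'.measurable_Y)
  have hg : Measurable fun (p : (ℤ → F) × (ℤ → E)) (t : ℤ) => (p.1 t, p.2 t) := by fun_prop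
  have := congrArg (fun κ => κ.map fun (p : (ℤ → F) × (ℤ → E)) (t : ℤ) => (p.1 t, p.2 t))
    (h.map_path_eq h' H y₀)
  rw [Measure.map_map hg hm, Measure.map_map hg hm'] at this
  exact this

/-- The shifted process is again a weak solution, so uniqueness in law gives stationarity. -/
theorem stationary_state (H : MergingSystem f m μ R ρ η N Φ) (y₀ : E) :
    IsStationaryProcess P fun t ω => (X t ω, Y t ω) := by
  have hm : Measurable fun ω (t : ℤ) => (X t ω, Y t ω) :=
    measurable_pi_lambda _ fun t => (h.measurable_X t).prodMk (h.measurable_Y t)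
  have hs : Measurable (pathShift : (ℤ → F × E) → ℤ → F × E) :=
    measurable_pi_lambda _ fun _ => measurable_pi_apply _
  refine ⟨hs, Eq.trans ?_ ((h.shift H.stationary 1).pathLaw_eq h H y₀)⟩
  rw [pathLaw, Measure.map_map hs hm]
  rfl

/-- The environment and the two-sided noise are independent. -/
theorem map_env_noise : P.map (fun ω => ((fun s => X s ω : ℤ → F), fun s => ε s ω)) =
    μ.prod (Measure.infinitePi fun _ : ℤ => m) := by
  have hε : Measurable fun ω (s : ℤ) => ε s ω := measurable_pi_lambda _ h.measurable_ε
  have hm := h.measurable_env.prodMk hε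
  have : IsProbabilityMeasure (P.map (fun ω => ((fun s => X s ω : ℤ → F), fun s => ε s ω))) :=
    Measure.isProbabilityMeasure_map hm.aemeasurable
  refine measure_prod_ext_of_map_tailFrom fun t => ?_
  have h1 := (h.fresh (t - 1)).comp (h.measurable_env.prodMk (h.measurable_Y _))
      (h.measurable_noise _) (g := Prod.fst) measurable_fst
  rw [sub_add_cancel] at h1
  have h2 : (Measure.infinitePi fun _ : ℤ => m).map (tailFrom t) = noiseLaw m :=
    Measure.map_infinitePi_infinitePi_of_inj (P := fun _ : ℤ => m) (f := fun j : ℕ => t + (j : ℤ))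
      fun i j hij => by simpa using hij
  have h3 := Measure.map_prod_map μ (Measure.infinitePi fun _ : ℤ => m) measurable_id
    (measurable_tailFrom (H := V) t)
  rw [Measure.map_id, h2] at h3
  rw [Measure.map_map (by fun_prop) hm]
  exact (h1.trans (by rw [← h.law_X]; rfl)).trans h3

/-- Freshness at every time makes the whole two-sided noise i.i.d. and independent of the
environment, and uniqueness supplies stationarity. -/
theorem isStationarySolution (H : MergingSystem f m μ R ρ η N Φ) (y₀ : E) :
    IsStationarySolution f m μ P X ε Y := by
  have hε : Measurable fun ω (s : ℤ) => ε s ω := measurable_pi_lambda _ h.measurable_ε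
  have hX := h.measurable_env
  have hlaw : P.map (fun ω (s : ℤ) => X s ω) = μ := h.law_X
  have hjoint := h.map_env_noise
  have hlε : P.map (fun ω (s : ℤ) => ε s ω) = Measure.infinitePi fun _ : ℤ => m := by
    have := congrArg (fun κ => κ.map Prod.snd) hjoint
    rw [Measure.map_map measurable_snd (hX.prodMk hε), Measure.map_snd_prod, measure_univ,
      one_smul] at this
    exact this
  have hmarg : ∀ t, P.map (ε t) = m := by
    intro t
    have := congrArg (fun κ => κ.map fun e : ℤ → V => e t) hlε
    rw [Measure.map_map (measurable_pi_apply t) hε, Measure.infinitePi_map_eval] at this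
    exact this
  refine ⟨inferInstance, h.measurable_X, h.measurable_ε, h.measurable_Y, h.law_X, hmarg, ?_, ?_, ?_,
    fun t => ?_, h.stationary_state H y₀⟩
  · rw [iIndepFun_iff_map_fun_eq_infinitePi_map h.measurable_ε, hlε]
    simp_rw [hmarg]
  · refine IndepFun.symm ?_
    rw [indepFun_iff_map_prod_eq_prod_map_map hX.aemeasurable hε.aemeasurable, hjoint, hlε, hlaw]
  · intro t
    have hu := hX.prodMk (h.measurable_Y t)
    have he := h.measurable_noise (t + 1)
    have hf := h.fresh t
    have h1 : P.map (fun ω => tailFrom (t + 1) fun s => ε s ω) = noiseLaw m := by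
      have := congrArg (fun κ => κ.map Prod.snd) hf
      have hp := Measure.isProbabilityMeasure_map (μ := P) hu.aemeasurable
      rw [Measure.map_map measurable_snd (hu.prodMk he), Measure.map_snd_prod, measure_univ,
        one_smul] at this
      exact this
    refine (indepFun_iff_map_prod_eq_prod_map_map hu.aemeasurable he.aemeasurable).2 ?_
    rw [h1]
    exact hf
  · have := h.recursion (t - 1)
    simpa only [sub_add_cancel] using this

end IsWeakSolution

/-- Of the stationarity of the pair only the constancy in time of the law of Y is retained. -/
theorem IsStationarySolution.isWeakSolution (h : IsStationarySolution f m μ P X ε Y) :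
    IsWeakSolution f m μ P X ε Y where
  measurable_X := h.measurable_X
  measurable_ε := h.measurable_ε
  measurable_Y := h.measurable_Y
  law_X := h.law_X
  fresh t := by
    have hu : Measurable fun ω => ((fun s => X s ω : ℤ → F), Y t ω) :=
      (measurable_pi_lambda _ h.measurable_X).prodMk (h.measurable_Y t)
    have he : Measurable fun ω (j : ℕ) => ε (t + 1 + j) ω :=
      measurable_pi_lambda _ fun j => h.measurable_ε _
    have h1 := (indepFun_iff_map_prod_eq_prod_map_map hu.aemeasurable he.aemeasurable).1 (h.causal t)
    have h2 : iIndepFun (fun j : ℕ => ε (t + 1 + j)) P :=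
      h.iIndep_ε.precomp (g := fun j : ℕ => t + 1 + (j : ℤ)) fun i j hij => by simpa using hij
    rw [iIndepFun_iff_map_fun_eq_infinitePi_map fun j => h.measurable_ε _] at h2
    simp_rw [h.law_ε] at h2
    rw [h2] at h1
    exact h1
  recursion t := by
    have := h.recursion (t + 1)
    simpa only [add_sub_cancel_right] using this
  law_Y t := by
    have hm : Measurable fun ω (t : ℤ) => (X t ω, Y t ω) :=
      measurable_pi_lambda _ fun t => (h.measurable_X t).prodMk (h.measurable_Y t)
    have h1 := (measurePreserving_shiftBy h.stationary t).map_eq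
    rw [pathLaw, Measure.map_map (measurable_shiftBy t) hm] at h1
    have h2 := congrArg (fun κ => κ.map fun z : ℤ → F × E => (z 0).2) h1
    rw [Measure.map_map (by fun_prop) ((measurable_shiftBy t).comp hm),
      Measure.map_map (by fun_prop) hm] at h2
    have h3 : P.map (Y (0 + t)) = P.map (Y 0) := h2
    rwa [zero_add] at h3

end WeakSolution

/-! ### Existence of stationary solutions -/

section Existence

variable {E F V : Type*} [MetricSpace E] [PolishSpace E] [MeasurableSpace E] [BorelSpace E]
  [MeasurableSpace F] [MeasurableSpace V]
  {f : E → F → V → E} {m : Measure V} [IsProbabilityMeasure m]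
  {μ : Measure (ℤ → F)} [IsProbabilityMeasure μ]
  {R ρ : ℝ} {η : F → ℝ} {N : ℕ} {Φ : (ℤ → F) → Measure E}

/-- One step of the recursion, together with the shifts of the environment and of the noise. -/
def skewStep {E F V : Type*} (f : E → F → V → E) (s : ((ℤ → F) × E) × (ℕ → V)) :
    ((ℤ → F) × E) × (ℕ → V) :=
  ((shiftBy 1 s.1.1, f s.1.2 (s.1.1 0) (s.2 0)), seqTail s.2)

/-- This is Φ(x) P_{x_0} = Φ(shift x), integrated against the shift invariant law μ. -/
theorem MergingSystem.map_step (H : MergingSystem f m μ R ρ η N Φ) (y₀ : E) :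
    ((μ ⊗ₘ H.kernel).prod m).map (fun q => (shiftBy 1 q.1.1, f q.1.2 (q.1.1 0) q.2)) =
      μ ⊗ₘ H.kernel := by
  have hg : Measurable fun q : ((ℤ → F) × E) × V => (shiftBy 1 q.1.1, f q.1.2 (q.1.1 0) q.2) := by
    have h1 : Measurable fun q : ((ℤ → F) × E) × V => f q.1.2 (q.1.1 0) q.2 :=
      H.measurable_step.comp (by fun_prop :
        Measurable fun q : ((ℤ → F) × E) × V => (q.1.2, q.1.1 0, q.2))
    exact (by fun_prop : Measurable fun q : ((ℤ → F) × E) × V => shiftBy 1 q.1.1).prodMk h1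
  have := Measure.isProbabilityMeasure_map (μ := (μ ⊗ₘ H.kernel).prod m) hg.aemeasurable
  refine Measure.ext_prod fun {A B} hA hB => ?_
  have hs := measurePreserving_shiftBy H.stationary 1
  have hΦB : Measurable fun x => Φ x B := (Measure.measurable_coe hB).comp H.pullback.measurable
  have hsA : MeasurableSet (shiftBy 1 ⁻¹' A : Set (ℤ → F)) := hs.measurable hA
  rw [Measure.map_apply hg (hA.prod hB), Measure.prod_apply (hg (hA.prod hB)),
    Measure.lintegral_compProd (measurable_measure_prodMk_left (hg (hA.prod hB))),
    Measure.compProd_apply_prod hA hB]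
  have h2 : ∀ᵐ x ∂μ, ∫⁻ y, m (Prod.mk (x, y) ⁻¹'
      ((fun q : ((ℤ → F) × E) × V => (shiftBy 1 q.1.1, f q.1.2 (q.1.1 0) q.2)) ⁻¹' A ×ˢ B))
        ∂(H.kernel x) = A.indicator (fun x => Φ x B) (shiftBy 1 x) := by
    filter_upwards [H.pullback.bind_transKernel H.measurable_step y₀ H.stationary] with x hx
    by_cases hxA : shiftBy 1 x ∈ A
    · rw [Set.indicator_of_mem hxA, ← hx, Measure.bind_apply hB (Kernel.aemeasurable _)]
      refine lintegral_congr fun y => ?_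
      rw [transKernel_apply f H.measurable_step m (x 0) y B hB]
      congr 1
      ext v
      simp [hxA]
    · rw [Set.indicator_of_notMem hxA]
      refine (lintegral_congr fun y => ?_).trans lintegral_zero
      rw [show Prod.mk (x, y) ⁻¹' ((fun q : ((ℤ → F) × E) × V =>
        (shiftBy 1 q.1.1, f q.1.2 (q.1.1 0) q.2)) ⁻¹' A ×ˢ B) = ∅ from
        Set.eq_empty_of_forall_notMem fun v hv => hxA hv.1, measure_empty]
  rw [lintegral_congr_ae h2, hs.lintegral_comp (hΦB.indicator hA), lintegral_indicator hA]
  rfl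

theorem MergingSystem.measurePreserving_skewStep (H : MergingSystem f m μ R ρ η N Φ) (y₀ : E) :
    MeasurePreserving (skewStep f) ((μ ⊗ₘ H.kernel).prod (noiseLaw m))
      ((μ ⊗ₘ H.kernel).prod (noiseLaw m)) := by
  set Λ := (μ ⊗ₘ H.kernel).prod (noiseLaw m) with hΛ
  have hfst : Λ.map Prod.fst = μ ⊗ₘ H.kernel := by
    rw [hΛ, Measure.map_fst_prod, measure_univ, one_smul]
  have hfresh : IsFreshNoise Λ m Prod.fst Prod.snd := by
    unfold IsFreshNoise
    rw [hfst]
    exact Measure.map_id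
  have hg : Measurable fun q : ((ℤ → F) × E) × V => (shiftBy 1 q.1.1, f q.1.2 (q.1.1 0) q.2) := by
    have h1 : Measurable fun q : ((ℤ → F) × E) × V => f q.1.2 (q.1.1 0) q.2 :=
      H.measurable_step.comp (by fun_prop :
        Measurable fun q : ((ℤ → F) × E) × V => (q.1.2, q.1.1 0, q.2))
    exact (by fun_prop : Measurable fun q : ((ℤ → F) × E) × V => shiftBy 1 q.1.1).prodMk h1
  have hu : Measurable fun s : ((ℤ → F) × E) × (ℕ → V) => (s.1, s.2 0) := by fun_prop
  have he : Measurable fun s : ((ℤ → F) × E) × (ℕ → V) => seqTail s.2 := by fun_prop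
  have h2 := (hfresh.tail measurable_fst measurable_snd).comp hu he hg
  have h3 : Λ.map (fun s => (shiftBy 1 s.1.1, f s.1.2 (s.1.1 0) (s.2 0))) = μ ⊗ₘ H.kernel := by
    have := hfresh.map_head measurable_fst measurable_snd
    rw [hfst] at this
    rw [← H.map_step y₀, ← this, Measure.map_map hg hu]
    rfl
  refine ⟨(hg.comp hu).prodMk he, ?_⟩
  refine Eq.trans h2 ?_
  rw [h3]

/-- In a two-sided orbit of the skew step, the point at time t carries the environment recentred at
t, the state, and the noise after t. The noise at time t is the head of the sequence held at t - 1,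
the variable driving the step into t. -/
theorem MergingSystem.exists_isWeakSolution [StandardBorelSpace F] [StandardBorelSpace V]
    (H : MergingSystem f m μ R ρ η N Φ) (y₀ : E) :
    ∃ Q : Measure (ℤ → ((ℤ → F) × E) × (ℕ → V)), IsProbabilityMeasure Q ∧
      IsWeakSolution f m μ Q (fun t w => (w 0).1.1 t) (fun t w => (w (t - 1)).2 0)
        (fun t w => (w t).1.2) := by
  obtain ⟨Q, hQ, hlaw, hstep⟩ := exists_natural_extension (H.measurePreserving_skewStep y₀)
  refine ⟨Q, hQ, ?_⟩
  have hae : ∀ᵐ w ∂Q, ∀ t, w (t + 1) = skewStep f (w t) := ae_all_iff.2 hstep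
  -- All orbit points carry the same environment up to recentring, which transfers freshness at time
  -- t to the environment read at time 0.
  have henv : ∀ᵐ w ∂Q, ∀ t, (w 0).1.1 = shiftBy (-t) (w t).1.1 := by
    filter_upwards [hae] with w hw t
    induction t with
    | zero => rw [neg_zero, shiftBy_zero]
    | succ i ih =>
      rw [hw, ih]
      simp only [skewStep, shiftBy_shiftBy]
      congr 1
      ring
    | pred i ih =>
      have := hw (-i - 1)
      rw [sub_add_cancel] at this
      rw [ih, this]
      simp only [skewStep, shiftBy_shiftBy]
      congr 1
      ring
  have hnoise : ∀ᵐ w ∂Q, ∀ (t : ℤ) (j i : ℕ), (w (t + j)).2 i = (w t).2 (j + i) := by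
    filter_upwards [hae] with w hw t j
    induction j with
    | zero => simp
    | succ j ih =>
      intro i
      rw [Nat.cast_succ, ← add_assoc, hw]
      simp only [skewStep, seqTail]
      rw [ih, show j + (i + 1) = j + 1 + i by omega]
  have hmt : ∀ t : ℤ, Measurable fun w : ℤ → ((ℤ → F) × E) × (ℕ → V) => w t :=
    fun t => measurable_pi_apply t
  have hfst : ∀ t : ℤ, Q.map (fun w => (w t).1) = μ ⊗ₘ H.kernel := by
    intro t
    have := congrArg (fun κ => κ.map Prod.fst) (hlaw t)
    rw [Measure.map_map measurable_fst (hmt t), Measure.map_fst_prod, measure_univ,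
      one_smul] at this
    exact this
  have hfresh : ∀ t : ℤ, IsFreshNoise Q m (fun w => (w t).1) (fun w => (w t).2) := by
    intro t
    unfold IsFreshNoise
    rw [hfst]
    exact hlaw t
  refine ⟨fun t => by fun_prop, fun t => by fun_prop, fun t => by fun_prop, ?_, fun t => ?_,
    fun t => ?_, fun t => ?_⟩
  · have := congrArg (fun κ => κ.map Prod.fst) (hfst 0)
    rw [Measure.map_map measurable_fst (by fun_prop), ← Measure.fst, Measure.fst_compProd] at this
    exact this
  · have h1 := (hfresh t).comp (by fun_prop) (by fun_prop)
      (g := fun p : (ℤ → F) × E => (shiftBy (-t) p.1, p.2)) (by fun_prop)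
    have h2 : (fun w : ℤ → ((ℤ → F) × E) × (ℕ → V) => (shiftBy (-t) (w t).1.1, (w t).1.2)) =ᵐ[Q]
        fun w => ((fun s => (w 0).1.1 s : ℤ → F), (w t).1.2) := by
      filter_upwards [henv] with w hw
      rw [← hw t]
    have h3 := h1.congr h2
    have h4 : (fun w : ℤ → ((ℤ → F) × E) × (ℕ → V) => (w t).2) =ᵐ[Q]
        fun w => tailFrom (t + 1) fun s => (w (s - 1)).2 0 := by
      filter_upwards [hnoise] with w hw
      funext j
      have := hw t j 0
      have e : t + 1 + (j : ℤ) - 1 = t + j := by ring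
      rw [add_zero] at this
      simp only [tailFrom]
      rw [e, this]
    refine Eq.trans (Measure.map_congr ?_) h3
    filter_upwards [h4] with w hw
    rw [hw]
  · filter_upwards [hae, henv] with w hw hx
    rw [hw t, hx t]
    simp [skewStep, shiftBy]
  · have h1 : ∀ s : ℤ, Q.map (fun w => (w s).1.2) = (μ ⊗ₘ H.kernel).map Prod.snd := by
      intro s
      rw [← hfst s, Measure.map_map measurable_snd (by fun_prop)]
      rfl
    rw [h1, h1]

variable {Ω : Type*} [MeasurableSpace Ω] {P : Measure Ω} [IsProbabilityMeasure P]
  {X : ℤ → Ω → F} {ε : ℤ → Ω → V} {Y : ℤ → Ω → E}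

theorem map_comp_congr {Ω' S T : Type*} [MeasurableSpace Ω'] [MeasurableSpace S]
    [MeasurableSpace T] {P' : Measure Ω'} {u : Ω → S} {u' : Ω' → S} (heq : P'.map u' = P.map u)
    (hu' : Measurable u') (hu : Measurable u) {g : S → T} (hg : Measurable g) :
    P'.map (fun ω => g (u' ω)) = P.map fun ω => g (u ω) := by
  have := congrArg (fun κ => κ.map g) heq
  rwa [Measure.map_map hg hu, Measure.map_map hg hu'] at this

/-- Being a weak solution only depends on the joint law. -/
theorem IsWeakSolution.of_map_eq (h : IsWeakSolution f m μ P X ε Y)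
    (hf : Measurable fun p : E × F × V => f p.1 p.2.1 p.2.2)
    {Ω' : Type*} [MeasurableSpace Ω'] {P' : Measure Ω'}
    {X' : ℤ → Ω' → F} {ε' : ℤ → Ω' → V} {Y' : ℤ → Ω' → E} (hX' : ∀ t, Measurable (X' t))
    (hε' : ∀ t, Measurable (ε' t)) (hY' : ∀ t, Measurable (Y' t))
    (heq : P'.map (fun ω => ((fun s => X' s ω : ℤ → F), (fun s => ε' s ω : ℤ → V), fun s => Y' s ω))
      = P.map (fun ω => ((fun s => X s ω : ℤ → F), (fun s => ε s ω : ℤ → V), fun s => Y s ω))) :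
    IsWeakSolution f m μ P' X' ε' Y' := by
  have hT := h.measurable_env.prodMk ((measurable_pi_lambda _ h.measurable_ε).prodMk
    (measurable_pi_lambda _ h.measurable_Y))
  have hT' := (measurable_pi_lambda _ hX').prodMk ((measurable_pi_lambda _ hε').prodMk
    (measurable_pi_lambda _ hY'))
  refine ⟨hX', hε', hY', ?_, fun t => ?_, fun t => ?_, fun t => ?_⟩
  · rw [← h.law_X]
    exact map_comp_congr heq hT' hT measurable_fst
  · have h1 := map_comp_congr heq hT' hT (g := fun p => ((p.1, p.2.2 t), tailFrom (t + 1) p.2.1)) (by fun_prop)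
    have h2 := map_comp_congr heq hT' hT (g := fun p => (p.1, p.2.2 t)) (by fun_prop)
    refine h1.trans ((h.fresh t).trans ?_)
    rw [← h2]
  · have hS : MeasurableSet {p : (ℤ → F) × (ℤ → V) × (ℤ → E) |
        p.2.2 (t + 1) = f (p.2.2 t) (p.1 t) (p.2.1 (t + 1))} := by
      have h1 : Measurable fun p : (ℤ → F) × (ℤ → V) × (ℤ → E) =>
          f (p.2.2 t) (p.1 t) (p.2.1 (t + 1)) :=
        hf.comp (by fun_prop : Measurable fun p : (ℤ → F) × (ℤ → V) × (ℤ → E) =>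
          (p.2.2 t, p.1 t, p.2.1 (t + 1)))
      exact measurableSet_eq_fun (by fun_prop) h1
    have h1 := (ae_map_iff hT.aemeasurable hS).2 (h.recursion t)
    rw [← heq] at h1
    exact (ae_map_iff hT'.aemeasurable hS).1 h1
  · have h1 : ∀ t, P'.map (Y' t) = P.map (Y t) := fun t =>
      map_comp_congr heq hT' hT (g := fun p => p.2.2 t) (by fun_prop)
    rw [h1, h1, h.law_Y]

/-- Glue two one-sided sequences. -/
def glue {V : Type*} (a b : ℕ → V) : ℤ → V
  | Int.ofNat n => a n
  | Int.negSucc n => b n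

theorem glue_restrict {V : Type*} (e : ℤ → V) :
    glue (fun n => e n) (fun n => e (Int.negSucc n)) = e := by
  funext t
  cases t <;> rfl

@[fun_prop]
theorem measurable_glue : Measurable fun p : (ℕ → V) × (ℕ → V) => glue p.1 p.2 := by
  refine measurable_pi_lambda _ fun t => ?_
  cases t with
  | ofNat n => exact (measurable_pi_apply n).comp measurable_fst
  | negSucc n => exact (measurable_pi_apply n).comp measurable_snd

/-- A weak solution driven by a given environment and a given one-sided noise exists on an
extension of the probability space. -/
theorem MergingSystem.exists_isWeakSolution_extension [StandardBorelSpace F] [StandardBorelSpace V]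
    (H : MergingSystem f m μ R ρ η N Φ) (y₀ : E) (hX : ∀ t, Measurable (X t)) {e : ℕ → Ω → V}
    (he : ∀ n, Measurable (e n))
    (hlaw : P.map (fun ω => ((fun s => X s ω : ℤ → F), fun n => e n ω)) = μ.prod (noiseLaw m)) :
    ∃ P' : Measure (Ω × (ℕ → V) × (ℤ → E)), IsProbabilityMeasure P' ∧
      MeasurePreserving Prod.fst P' P ∧
      IsWeakSolution f m μ P' (fun t ω => X t ω.1)
        (fun t ω => glue (fun n => e n ω.1) ω.2.1 t) (fun t ω => ω.2.2 t) := by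
  obtain ⟨Q, hQ, h⟩ := H.exists_isWeakSolution y₀
  set W := ℤ → ((ℤ → F) × E) × (ℕ → V)
  -- The first component collects what Ω already carries, the environment and the noise from time 0
  -- on; the second holds what is added, the noise at negative times and the states.
  set T : W → ((ℤ → F) × (ℕ → V)) × ((ℕ → V) × (ℤ → E)) := fun w =>
    ((fun t => (w 0).1.1 t, fun n : ℕ => (w ((n : ℤ) - 1)).2 0),
      (fun n => (w (Int.negSucc n - 1)).2 0), fun t => (w t).1.2) with hT
  have hTm : Measurable T := by fun_prop
  have hZ : Measurable fun ω => ((fun s => X s ω : ℤ → F), fun n => e n ω) :=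
    (measurable_pi_lambda _ hX).prodMk (measurable_pi_lambda _ he)
  have hM := Measure.isProbabilityMeasure_map (μ := Q) hTm.aemeasurable
  have hfst : (Q.map T).map Prod.fst = P.map (fun ω => ((fun s => X s ω : ℤ → F), fun n => e n ω)) := by
    -- Freshness at time -1 gives the joint law of the environment and the noise from time 0 on.
    have h1 := (h.fresh (-1)).comp (h.measurable_env.prodMk (h.measurable_Y _))
      (h.measurable_noise _) (g := Prod.fst) measurable_fst
    have h2 : Q.map (fun w (s : ℤ) => (w 0).1.1 s) = μ := h.law_X
    unfold IsFreshNoise at h1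
    simp only at h1
    rw [h2] at h1
    rw [hlaw, ← h1, Measure.map_map measurable_fst hTm]
    congr 1
    funext w
    refine Prod.ext rfl (funext fun n => ?_)
    simp [hT, tailFrom]
  have : Nonempty V := m.nonempty_of_neZero
  have : Nonempty E := ⟨y₀⟩
  obtain ⟨P', hP', hmp, hjoint⟩ := exists_extension P hZ (Q.map T) hfst
  refine ⟨P', hP', hmp, ?_⟩
  have hglue : Measurable fun ω : Ω × (ℕ → V) × (ℤ → E) => glue (fun n => e n ω.1) ω.2.1 :=
    measurable_glue.comp (((measurable_pi_lambda _ he).comp measurable_fst).prodMk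
      measurable_snd.fst)
  refine h.of_map_eq H.measurable_step (fun t => (hX t).comp measurable_fst)
    (fun t => (measurable_pi_apply t).comp hglue) (fun t => by fun_prop) ?_
  have hG : Measurable fun p : ((ℤ → F) × (ℕ → V)) × ((ℕ → V) × (ℤ → E)) =>
      (p.1.1, glue p.1.2 p.2.1, p.2.2) :=
    measurable_fst.fst.prodMk ((measurable_glue.comp (measurable_fst.snd.prodMk
      measurable_snd.fst)).prodMk measurable_snd.snd)
  have h3 := congrArg (fun κ => κ.map fun p : ((ℤ → F) × (ℕ → V)) × ((ℕ → V) × (ℤ → E)) =>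
      (p.1.1, glue p.1.2 p.2.1, p.2.2)) hjoint
  have hJ : Measurable fun ω : Ω × (ℕ → V) × (ℤ → E) =>
      (((fun s => X s ω.1 : ℤ → F), fun n => e n ω.1), ω.2) :=
    (hZ.comp measurable_fst).prodMk measurable_snd
  rw [Measure.map_map hG hJ, Measure.map_map hG hTm] at h3
  refine Eq.trans h3 ?_
  congr 1
  funext w
  refine Prod.ext rfl (Prod.ext ?_ rfl)
  exact glue_restrict fun t => (w (t - 1)).2 0

end Existence

/-! ### Ergodicity through uniqueness -/

section Ergodicity

open scoped symmDiff

variable {E F V Ω : Type*} [MetricSpace E] [PolishSpace E] [MeasurableSpace E] [BorelSpace E]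
  [MeasurableSpace F] [MeasurableSpace V] [MeasurableSpace Ω]
  {f : E → F → V → E} {m : Measure V} [IsProbabilityMeasure m]
  {μ : Measure (ℤ → F)} [IsProbabilityMeasure μ] {P : Measure Ω} [IsProbabilityMeasure P]
  {X : ℤ → Ω → F} {ε : ℤ → Ω → V} {Y : ℤ → Ω → E}
  {R ρ : ℝ} {η : F → ℝ} {N : ℕ} {Φ : (ℤ → F) → Measure E}

namespace IsWeakSolution

variable (h : IsWeakSolution f m μ P X ε Y)
include h

/-- Freezing the index at n records the states at times s, …, s + n in a space that does not depend
on n. -/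
theorem measurable_recentStates (s : ℤ) (n : ℕ) : Measurable fun ω =>
    ((fun r => X r ω : ℤ → F), fun i : ℕ => Y (s + (min i n : ℕ)) ω) :=
  h.measurable_env.prodMk (measurable_pi_lambda _ fun _ => h.measurable_Y _)

/-- The later noise is fresh for the environment together with the states in a window. -/
theorem fresh_recentStates (hf : Measurable fun p : E × F × V => f p.1 p.2.1 p.2.2) (s : ℤ) (n : ℕ) :
    IsFreshNoise P m (fun ω => ((fun r => X r ω : ℤ → F), fun i : ℕ => Y (s + (min i n : ℕ)) ω))
      (fun ω => tailFrom (s + n + 1) fun r => ε r ω) := by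
  induction n with
  | zero =>
    have := (h.fresh s).comp (h.measurable_env.prodMk (h.measurable_Y s)) (h.measurable_noise _)
      (g := fun p : (ℤ → F) × E => (p.1, fun _ : ℕ => p.2)) (by fun_prop)
    simpa using this
  | succ n ih =>
    have hu := h.measurable_recentStates s n
    have he := h.measurable_noise (s + n + 1)
    have hg : Measurable fun p : ((ℤ → F) × (ℕ → E)) × V =>
        (p.1.1, fun i : ℕ => if i ≤ n then p.1.2 i else f (p.1.2 n) (p.1.1 (s + n)) p.2) := by
      refine measurable_fst.fst.prodMk (measurable_pi_lambda _ fun i => ?_)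
      split_ifs
      · fun_prop
      · exact hf.comp (by fun_prop : Measurable fun p : ((ℤ → F) × (ℕ → E)) × V =>
          (p.1.2 n, p.1.1 (s + n), p.2))
    have hue : Measurable fun ω => (((fun r => X r ω : ℤ → F),
        fun i : ℕ => Y (s + (min i n : ℕ)) ω), tailFrom (s + n + 1) (fun r => ε r ω) 0) :=
      hu.prodMk ((measurable_pi_apply 0).comp he)
    have h1 := ((ih.tail hu he).comp hue (by fun_prop) hg).congr
      (u' := fun ω => ((fun r => X r ω : ℤ → F), fun i : ℕ => Y (s + (min i (n + 1) : ℕ)) ω)) ?_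
    · convert h1 using 1
      funext ω j
      simp only [tailFrom, seqTail]
      congr 1
      push_cast
      ring
    · filter_upwards [h.recursion (s + n)] with ω hω
      refine Prod.ext rfl (funext fun i => ?_)
      simp only
      split_ifs with hi
      · rw [min_eq_left hi, min_eq_left (by omega)]
      · rw [min_self, min_eq_right (by omega), Nat.cast_succ, ← add_assoc, hω]
        simp [tailFrom]

/-- Shift invariant events are approximated by events of the past. -/
theorem exists_approx_past (hst : IsStationaryProcess P fun t ω => (X t ω, Y t ω))
    {A : Set (ℤ → F × E)} (hA : MeasurableSet A) (hinv : pathShift ⁻¹' A = A) (t : ℤ)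
    {δ : ℝ≥0∞} (hδ : 0 < δ) :
    ∃ (n : ℕ) (G : Set ((ℤ → F) × (ℕ → E))), MeasurableSet G ∧
      P ({ω | ((fun r => X r ω : ℤ → F), fun i : ℕ => Y (t - n + (min i n : ℕ)) ω) ∈ G} ∆
        {ω | (fun s => (X s ω, Y s ω)) ∈ A}) < δ := by
  have hZ : Measurable fun ω (s : ℤ) => (X s ω, Y s ω) :=
    measurable_pi_lambda _ fun s => (h.measurable_X s).prodMk (h.measurable_Y s)
  have hQ : IsProbabilityMeasure (pathLaw P fun s ω => (X s ω, Y s ω)) :=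
    Measure.isProbabilityMeasure_map hZ.aemeasurable
  obtain ⟨C, hC, hCA⟩ := exists_measure_symmDiff_lt_of_generateFrom_isSetRing
    (μ := pathLaw P fun s ω => (X s ω, Y s ω)) isSetRing_measurableCylinders
    ⟨{Set.univ}, Set.countable_singleton _, by
      simpa using univ_mem_measurableCylinders fun _ : ℤ => F × E, by simp⟩
    generateFrom_measurableCylinders.symm hA hδ
  obtain ⟨I, S, hS, rfl⟩ := (mem_measurableCylinders _).1 hC
  have hI : Measurable (I.restrict : (ℤ → F × E) → I → F × E) := Finset.measurable_restrict I
  have hCm : MeasurableSet (cylinder I S) := hI hS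
  have hinv' : ∀ k : ℕ, shiftBy (k : ℤ) ⁻¹' A = A := by
    intro k
    induction k with
    | zero =>
      ext z
      simp [shiftBy_zero]
    | succ k ih =>
      ext z
      have e : shiftBy ((k + 1 : ℕ) : ℤ) z = shiftBy (k : ℤ) (pathShift z) := by
        funext r
        simp only [shiftBy, pathShift]
        congr 1
        push_cast
        ring
      rw [Set.mem_preimage, e, ← Set.mem_preimage (f := shiftBy (k : ℤ)), ih,
        ← Set.mem_preimage (f := pathShift), hinv]
  have hinv'' : ∀ k : ℕ, shiftBy (-(k : ℤ)) ⁻¹' A = A := by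
    intro k
    conv_lhs => rw [← hinv' k]
    ext z
    rw [Set.mem_preimage, Set.mem_preimage, shiftBy_shiftBy]
    simp [shiftBy_zero]
  obtain ⟨a, ha⟩ := I.bddBelow
  obtain ⟨b, hb⟩ := I.bddAbove
  -- By invariance the cylinder may be shifted k steps into the past, after which its times are at
  -- most t; n is chosen so that the window ending at t reaches back to a - k.
  set k : ℕ := (b - t).toNat with hk
  set n : ℕ := (t - a + k).toNat with hn
  have hg : Measurable fun (q : (ℤ → F) × (ℕ → E)) (i : I) =>
      (q.1 ((i : ℤ) - k), q.2 ((i : ℤ) - k - (t - n)).toNat) := by fun_prop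
  refine ⟨n, _, hg hS, lt_of_le_of_lt (le_of_eq ?_) hCA⟩
  have hms := measurePreserving_shiftBy hst (-(k : ℤ))
  have hCA' : MeasurableSet (cylinder I S ∆ A) := hCm.symmDiff hA
  rw [← hms.measure_preimage hCA'.nullMeasurableSet, pathLaw,
    Measure.map_apply hZ (hms.measurable hCA')]
  congr 1
  rw [Set.preimage_symmDiff, Set.preimage_symmDiff, hinv'']
  congr 1
  ext ω
  rw [Set.mem_preimage, Set.mem_preimage, mem_cylinder]
  change (fun i : I => _) ∈ S ↔ _
  refine iff_of_eq (congrArg (· ∈ S) (funext fun i => ?_))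
  have h1 : a ≤ (i : ℤ) := ha i.2
  have h2 : (i : ℤ) ≤ b := hb i.2
  have h3 : t - n + (min ((i : ℤ) + -k - (t - n)).toNat n : ℕ) = (i : ℤ) + -k := by
    rw [min_eq_left (by omega)]
    omega
  have h4 : (i : ℤ) - k = i + -k := sub_eq_add_neg _ _
  simp only [Finset.restrict, shiftBy, h3, h4]

/-- Shift invariant events are independent of the later noise, jointly with the environment and
the state. -/
theorem measure_invariant_inter (hf : Measurable fun p : E × F × V => f p.1 p.2.1 p.2.2)
    (hst : IsStationaryProcess P fun t ω => (X t ω, Y t ω))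
    {A : Set (ℤ → F × E)} (hA : MeasurableSet A) (hinv : pathShift ⁻¹' A = A) (t : ℤ)
    {C : Set ((ℤ → F) × E)} (hC : MeasurableSet C) {D : Set (ℕ → V)} (hD : MeasurableSet D) :
    P ({ω | (fun s => (X s ω, Y s ω)) ∈ A} ∩ {ω | ((fun s => X s ω : ℤ → F), Y t ω) ∈ C} ∩
        {ω | tailFrom (t + 1) (fun s => ε s ω) ∈ D}) =
      P ({ω | (fun s => (X s ω, Y s ω)) ∈ A} ∩ {ω | ((fun s => X s ω : ℤ → F), Y t ω) ∈ C}) *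
        noiseLaw m D := by
  set A₀ := {ω | (fun s => (X s ω, Y s ω)) ∈ A}
  set C₀ := {ω | ((fun s => X s ω : ℤ → F), Y t ω) ∈ C}
  set D₀ := {ω | tailFrom (t + 1) (fun s => ε s ω) ∈ D}
  -- For an approximating event of the past the factorization is freshness; it survives the limit
  -- because each replacement costs at most the measure of a symmetric difference.
  have happ : ∀ δ : ℝ≥0∞, 0 < δ → ∃ G : Set Ω, P (G ∩ C₀ ∩ D₀) = P (G ∩ C₀) * noiseLaw m D ∧
      P (G ∆ A₀) < δ := by
    intro δ hδ
    obtain ⟨n, G, hG, hGA⟩ := h.exists_approx_past hst hA hinv t hδ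
    refine ⟨_, ?_, hGA⟩
    have h1 := h.fresh_recentStates hf (t - n) n
    rw [sub_add_cancel] at h1
    have hu := h.measurable_recentStates (t - n) n
    have he := h.measurable_noise (t + 1)
    have hC' : MeasurableSet {q : (ℤ → F) × (ℕ → E) | (q.1, q.2 n) ∈ C} :=
      (by fun_prop : Measurable fun q : (ℤ → F) × (ℕ → E) => (q.1, q.2 n)) hC
    have hset : {ω | ((fun r => X r ω : ℤ → F), fun i : ℕ => Y (t - n + (min i n : ℕ)) ω) ∈ G} ∩ C₀ =
        (fun ω => ((fun r => X r ω : ℤ → F), fun i : ℕ => Y (t - n + (min i n : ℕ)) ω)) ⁻¹'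
          (G ∩ {q | (q.1, q.2 n) ∈ C}) := by
      ext ω
      simp [C₀]
    rw [hset, ← Measure.map_apply hu (hG.inter hC'), ← Measure.prod_prod, ← h1,
      Measure.map_apply (hu.prodMk he) ((hG.inter hC').prod hD)]
    rfl
  have hν : noiseLaw m D ≤ 1 := prob_le_one
  have hcmp : ∀ {G G' W : Set Ω} {δ : ℝ≥0∞}, P (G ∆ G') ≤ δ → P (G ∩ W) ≤ P (G' ∩ W) + δ := by
    intro G G' W δ hδ
    refine (measure_mono (t := (G' ∩ W) ∪ (G ∆ G')) ?_).trans
      ((measure_union_le _ _).trans (add_le_add le_rfl hδ))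
    intro ω hω
    by_cases hG' : ω ∈ G'
    · exact Or.inl ⟨hG', hω.2⟩
    · exact Or.inr (Or.inl ⟨hω.1, hG'⟩)
  refine le_antisymm ?_ ?_
  all_goals
    refine ENNReal.le_of_forall_pos_le_add fun δ hδ _ => ?_
    obtain ⟨G, hG, hGA⟩ := happ (δ / 2) (by simpa using hδ.ne')
    have hGA' : P (A₀ ∆ G) ≤ δ / 2 := by rw [symmDiff_comm]; exact hGA.le
  · calc P (A₀ ∩ C₀ ∩ D₀) = P (A₀ ∩ (C₀ ∩ D₀)) := by rw [Set.inter_assoc]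
      _ ≤ P (G ∩ (C₀ ∩ D₀)) + δ / 2 := hcmp hGA'
      _ = P (G ∩ C₀) * noiseLaw m D + δ / 2 := by rw [← Set.inter_assoc, hG]
      _ ≤ (P (A₀ ∩ C₀) + δ / 2) * noiseLaw m D + δ / 2 := by gcongr; exact hcmp hGA.le
      _ ≤ P (A₀ ∩ C₀) * noiseLaw m D + (δ / 2 * 1 + δ / 2) := by
          rw [add_mul, add_assoc]; gcongr
      _ = _ := by rw [mul_one, ENNReal.add_halves]
  · calc P (A₀ ∩ C₀) * noiseLaw m D ≤ (P (G ∩ C₀) + δ / 2) * noiseLaw m D := by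
          gcongr; exact hcmp hGA'
      _ ≤ P (G ∩ (C₀ ∩ D₀)) + δ / 2 * 1 := by
          rw [← Set.inter_assoc, hG, add_mul]; gcongr
      _ ≤ (P (A₀ ∩ (C₀ ∩ D₀)) + δ / 2) + δ / 2 * 1 := by gcongr; exact hcmp hGA.le
      _ = _ := by rw [mul_one, add_assoc, ENNReal.add_halves, Set.inter_assoc]

/-- Conditioning on a shift invariant event gives a weak solution. -/
theorem cond (hf : Measurable fun p : E × F × V => f p.1 p.2.1 p.2.2)
    (hμ : Ergodic pathShift μ) (hst : IsStationaryProcess P fun t ω => (X t ω, Y t ω))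
    {A : Set (ℤ → F × E)} (hA : MeasurableSet A) (hinv : pathShift ⁻¹' A = A)
    (hA0 : P {ω | (fun s => (X s ω, Y s ω)) ∈ A} ≠ 0) :
    IsWeakSolution f m μ P[|{ω | (fun s => (X s ω, Y s ω)) ∈ A}] X ε Y := by
  have hZ : Measurable fun ω (s : ℤ) => (X s ω, Y s ω) :=
    measurable_pi_lambda _ fun s => (h.measurable_X s).prodMk (h.measurable_Y s)
  have hA₀ : MeasurableSet {ω | (fun s => (X s ω, Y s ω)) ∈ A} := hZ hA
  have hP := cond_isProbabilityMeasure hA0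
  set A₀ := {ω | (fun s => (X s ω, Y s ω)) ∈ A}
  have hac : P[|A₀] ≪ P := cond_absolutelyContinuous
  have hstat : MeasurePreserving pathShift (pathLaw P[|A₀] fun t ω => (X t ω, Y t ω))
      (pathLaw P[|A₀] fun t ω => (X t ω, Y t ω)) := by
    refine ⟨hst.measurable, ?_⟩
    ext B hB
    have hmB := hst.measurable hB
    rw [Measure.map_apply hst.measurable hB, pathLaw, Measure.map_apply hZ hmB,
      Measure.map_apply hZ hB, cond_apply hA₀, cond_apply hA₀]
    congr 1
    have h1 : A₀ ∩ (fun ω (s : ℤ) => (X s ω, Y s ω)) ⁻¹' (pathShift ⁻¹' B) =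
        (fun ω (s : ℤ) => (X s ω, Y s ω)) ⁻¹' (pathShift ⁻¹' (A ∩ B)) := by
      rw [Set.preimage_inter, hinv]
      rfl
    have h2 := hst.measure_preimage (hA.inter hB).nullMeasurableSet
    rw [pathLaw, Measure.map_apply hZ (hst.measurable (hA.inter hB)),
      Measure.map_apply hZ (hA.inter hB)] at h2
    rw [h1, h2]
    rfl
  refine ⟨h.measurable_X, h.measurable_ε, h.measurable_Y, ?_, fun t => ?_,
    fun t => hac.ae_le (h.recursion t), fun t => ?_⟩
  · have : IsProbabilityMeasure (pathLaw P[|A₀] X) :=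
      Measure.isProbabilityMeasure_map h.measurable_env.aemeasurable
    -- The conditioned environment law is shift invariant and absolutely continuous with respect to
    -- the ergodic law μ, hence equal to it.
    refine hμ.eq_of_absolutelyContinuous (ν := pathLaw P[|A₀] X) ⟨hμ.measurable, ?_⟩ ?_
    · have h1 := congrArg (fun κ => κ.map fun (z : ℤ → F × E) (s : ℤ) => (z s).1) hstat.map_eq
      have hp : Measurable fun (z : ℤ → F × E) (s : ℤ) => (z s).1 := by fun_prop
      rw [Measure.map_map hp hst.measurable, pathLaw, Measure.map_map (hp.comp hst.measurable) hZ,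
        Measure.map_map hp hZ] at h1
      rw [pathLaw, Measure.map_map hμ.measurable h.measurable_env]
      exact h1
    · rw [← h.law_X]
      exact hac.map h.measurable_env
  · have hu := h.measurable_env.prodMk (h.measurable_Y t)
    have he := h.measurable_noise (t + 1)
    have := Measure.isProbabilityMeasure_map (μ := P[|A₀]) (hu.prodMk he).aemeasurable
    refine Measure.ext_prod fun {C D} hC hD => ?_
    rw [Measure.prod_prod, Measure.map_apply (hu.prodMk he) (hC.prod hD), Measure.map_apply hu hC,
      cond_apply hA₀, cond_apply hA₀, mul_assoc]
    congr 1
    refine Eq.trans ?_ (h.measure_invariant_inter hf hst hA hinv t hC hD)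
    rw [Set.inter_assoc]
    rfl
  · have h1 := (measurePreserving_shiftBy hstat t).map_eq
    rw [pathLaw, Measure.map_map (measurable_shiftBy t) hZ] at h1
    have h2 := congrArg (fun κ => κ.map fun z : ℤ → F × E => (z 0).2) h1
    rw [Measure.map_map (by fun_prop) ((measurable_shiftBy t).comp hZ),
      Measure.map_map (by fun_prop) hZ] at h2
    have h3 : P[|A₀].map (Y (0 + t)) = P[|A₀].map (Y 0) := h2
    rwa [zero_add] at h3

/-- Conditioning on an invariant event of positive probability does not change the path law, by
uniqueness, although it gives the event probability one. -/
theorem ergodic (hμ : Ergodic pathShift μ) (H : MergingSystem f m μ R ρ η N Φ) (y₀ : E) :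
    Ergodic pathShift (pathLaw P fun t ω => (X t ω, Y t ω)) := by
  have hst := h.stationary_state H y₀
  have hZ : Measurable fun ω (s : ℤ) => (X s ω, Y s ω) :=
    measurable_pi_lambda _ fun s => (h.measurable_X s).prodMk (h.measurable_Y s)
  refine ⟨hst, ⟨fun A hA hinv => eventuallyConst_set.2 ?_⟩⟩
  have hQ : IsProbabilityMeasure (pathLaw P fun s ω => (X s ω, Y s ω)) :=
    Measure.isProbabilityMeasure_map hZ.aemeasurable
  by_cases hA0 : P {ω | (fun s => (X s ω, Y s ω)) ∈ A} = 0
  · right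
    refine measure_eq_zero_iff_ae_notMem.1 ?_
    rw [pathLaw, Measure.map_apply hZ hA]
    exact hA0
  · left
    have hP := cond_isProbabilityMeasure hA0
    have h1 := (h.cond H.measurable_step hμ hst hA hinv hA0).pathLaw_eq h H y₀
    refine mem_ae_iff_prob_eq_one hA |>.2 ?_
    rw [← h1, pathLaw, Measure.map_apply hZ hA]
    exact cond_apply_self hA0 (measure_ne_top _ _)

end IsWeakSolution

end Ergodicity

/-! ### The merging coupling of trajectories -/

section Coupling

variable {E F V : Type*} [MetricSpace E] [PolishSpace E] [MeasurableSpace E] [BorelSpace E]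
  [MeasurableSpace F] [MeasurableSpace V]
  {f : E → F → V → E} {m : Measure V} [IsProbabilityMeasure m]
  {μ : Measure (ℤ → F)} [IsProbabilityMeasure μ]
  {R ρ : ℝ} {η : F → ℝ} {N : ℕ}

/-- The environment together with the states of the recursion started at `y`. -/
def trajectory {E F V : Type*} (f : E → F → V → E) (y : E) (p : (ℤ → F) × (ℕ → V)) :
    (ℤ → F) × (ℕ → E) :=
  (p.1, fun n => forwardPath f p.1 y p.2 n)

theorem measurable_trajectory (hf : Measurable fun p : E × F × V => f p.1 p.2.1 p.2.2) (y : E) :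
    Measurable (trajectory f y : (ℤ → F) × (ℕ → V) → (ℤ → F) × (ℕ → E)) :=
  measurable_fst.prodMk (measurable_pi_lambda _ fun n => (measurable_forwardPath hf n).comp
    (by fun_prop : Measurable fun p : (ℤ → F) × (ℕ → V) => (p.1, y, p.2)))

/-- The Markov property in noise form: the state at time n uses only the first n noise variables. -/
theorem isFreshNoise_forwardPath (hf : Measurable fun p : E × F × V => f p.1 p.2.1 p.2.2)
    (x : ℤ → F) (y : E) (n : ℕ) :
    IsFreshNoise (noiseLaw m) m (fun e => forwardPath f x y e n) (fun e j => e (n + j)) := by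
  have hu : ∀ n, Measurable fun e : ℕ → V => forwardPath f x y e n := fun n =>
    (measurable_forwardPath hf n).comp (by fun_prop : Measurable fun e : ℕ → V => (x, y, e))
  induction n with
  | zero =>
    unfold IsFreshNoise
    simp only [forwardPath, zero_add, Measure.map_const, measure_univ, one_smul]
    rw [Measure.dirac_prod]
  | succ n ih =>
    have he : Measurable fun (e : ℕ → V) (j : ℕ) => e (n + j) := by fun_prop
    have hg : Measurable fun q : E × V => f q.1 (x n) q.2 :=
      hf.comp (by fun_prop : Measurable fun q : E × V => (q.1, x n, q.2))
    have := (ih.tail (hu n) he).comp ((hu n).prodMk ((measurable_pi_apply 0).comp he)) (by fun_prop) hg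
    convert this using 1
    · rfl
    funext e j
    simp only [seqTail]
    rw [show n + 1 + j = n + (j + 1) by omega]

/-- The probability that the environment lies in `A` and the trajectory from time `n` on in `B`. -/
theorem measure_trajectory (hf : Measurable fun p : E × F × V => f p.1 p.2.1 p.2.2) (y : E) (n : ℕ)
    {A : Set (ℤ → F)} (hA : MeasurableSet A) {B : Set ((ℤ → F) × (ℕ → E))} (hB : MeasurableSet B) :
    ((μ.prod (noiseLaw m)).map (trajectory f y)) {s | (s.1, fun j => s.2 (n + j)) ∈ B ∧ s.1 ∈ A} =
      ∫⁻ x in A, ∫⁻ z, noiseLaw m {e | trajectory f z (shiftBy n x, e) ∈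
        {s | (x, s.2) ∈ B}} ∂(quenchedLaw f m x 0 n y) ∂μ := by
  have hs : Measurable fun s : (ℤ → F) × (ℕ → E) => (s.1, fun j : ℕ => s.2 (n + j)) := by fun_prop
  have hS : MeasurableSet {s : (ℤ → F) × (ℕ → E) | (s.1, fun j => s.2 (n + j)) ∈ B ∧ s.1 ∈ A} :=
    (hs hB).inter (measurable_fst hA)
  have ht := measurable_trajectory (F := F) hf y
  rw [Measure.map_apply ht hS, Measure.prod_apply (ht hS), ← lintegral_indicator hA]
  refine lintegral_congr fun x => ?_
  by_cases hx : x ∈ A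
  · rw [Set.indicator_of_mem hx]
    have hu : Measurable fun e : ℕ → V => forwardPath f x y e n :=
      (measurable_forwardPath hf n).comp (by fun_prop : Measurable fun e : ℕ → V => (x, y, e))
    have he : Measurable fun (e : ℕ → V) (j : ℕ) => e (n + j) := by fun_prop
    have hG : Measurable fun q : E × (ℕ → V) =>
        (x, fun j => forwardPath f (shiftBy n x) q.1 q.2 j) := by
      refine measurable_const.prodMk (measurable_pi_lambda _ fun j => ?_)
      exact (measurable_forwardPath hf j).comp (by fun_prop :
        Measurable fun q : E × (ℕ → V) => (shiftBy (n : ℤ) x, q.1, q.2))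
    have h1 := congrArg (fun κ => κ ((fun q : E × (ℕ → V) =>
        (x, fun j => forwardPath f (shiftBy n x) q.1 q.2 j)) ⁻¹' B))
      (isFreshNoise_forwardPath (m := m) hf x y n)
    simp only at h1
    have hq : quenchedLaw f m x 0 n y = (noiseLaw m).map fun e => forwardPath f x y e n := by
      rw [quenchedLaw_eq_map hf, shiftBy_zero]
    rw [← hq, Measure.map_apply (hu.prodMk he) (hG hB), Measure.prod_apply (hG hB)] at h1
    refine Eq.trans ?_ h1
    congr 1
    ext e
    change ((x, fun j => forwardPath f x y e (n + j)) ∈ B ∧ x ∈ A) ↔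
      (x, fun j => forwardPath f (shiftBy n x) (forwardPath f x y e n) (fun i => e (n + i)) j) ∈ B
    simp only [hx, and_true, forwardPath_add]
  · rw [Set.indicator_of_notMem hx]
    refine measure_mono_null (t := ∅) (fun e he => hx he.2) measure_empty

theorem measurable_mergingBound (hη : Measurable η) (s : ℤ) (n : ℕ) (r : ℝ) :
    Measurable fun x => mergingBound η R ρ N x s n r := by
  unfold mergingBound
  refine measurable_const.add (Finset.measurable_prod _ fun j _ => ?_)
  exact (measurable_const.sub (hη.comp (measurable_pi_apply _))).ennreal_ofReal

/-- A coupling of the trajectories started at two states above the same environment, which merges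
at the stated rate conditionally on the environment. -/
theorem exists_merging_coupling [StandardBorelSpace F]
    (hf : Measurable fun p : E × F × V => f p.1 p.2.1 p.2.2) (hη : Measurable η)
    (hN : HasMergingTime f m R ρ η N) (y y' : E) :
    ∃ M : Measure ((ℤ → F) × (ℕ → E) × (ℕ → E)), IsProbabilityMeasure M ∧
      M.map (fun p => (p.1, p.2.1)) = (μ.prod (noiseLaw m)).map (trajectory f y) ∧
      M.map (fun p => (p.1, p.2.2)) = (μ.prod (noiseLaw m)).map (trajectory f y') ∧
      ∀ n A, MeasurableSet A → M {p | p.1 ∈ A ∧ p.2.1 n ≠ p.2.2 n} ≤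
        ∫⁻ x in A, mergingBound η R ρ N x 0 n (dist y y') ∂μ := by
  set L := (μ.prod (noiseLaw m)).map (trajectory f y) with hL
  set L' := (μ.prod (noiseLaw m)).map (trajectory f y') with hL'
  have ht := measurable_trajectory (F := F) hf y
  have ht' := measurable_trajectory (F := F) hf y'
  have hLp : IsProbabilityMeasure L := Measure.isProbabilityMeasure_map ht.aemeasurable
  have hLp' : IsProbabilityMeasure L' := Measure.isProbabilityMeasure_map ht'.aemeasurable
  have hχ : L.map Prod.fst = L'.map Prod.fst := by
    rw [hL, hL', Measure.map_map measurable_fst ht, Measure.map_map measurable_fst ht']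
    rfl
  -- Dropping the current state while keeping the environment: ψ^[n] retains exactly the trajectory
  -- from time n on.
  set ψ : (ℤ → F) × (ℕ → E) → (ℤ → F) × (ℕ → E) := Prod.map id seqTail with hψ
  have hψn : ∀ n s, ψ^[n] s = (s.1, fun j => s.2 (n + j)) := by
    intro n
    induction n with
    | zero => intro s; simp
    | succ n ih =>
      intro s
      rw [Function.iterate_succ_apply, ih]
      refine Prod.ext rfl (funext fun j => ?_)
      simp only [hψ, Prod.map, seqTail]
      rw [show n + j + 1 = n + 1 + j by omega]
  obtain ⟨κ, hκ1, hκ2, hκχ, hκn⟩ := exists_maximal_coupling (L := L) (L' := L') (ψ := ψ)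
    (by fun_prop) measurable_fst (fun s => rfl) hχ
  have hκp : IsProbabilityMeasure κ := by
    refine ⟨?_⟩
    rw [← hLp.measure_univ, ← hκ1, Measure.map_apply measurable_fst MeasurableSet.univ,
      Set.preimage_univ]
  have hΘ : Measurable fun p : ((ℤ → F) × (ℕ → E)) × ((ℤ → F) × (ℕ → E)) =>
      (p.1.1, p.1.2, p.2.2) := by fun_prop
  refine ⟨κ.map fun p => (p.1.1, p.1.2, p.2.2),
    Measure.isProbabilityMeasure_map hΘ.aemeasurable, ?_, ?_, ?_⟩
  · rw [Measure.map_map (by fun_prop) hΘ, ← hκ1]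
    rfl
  · rw [Measure.map_map (by fun_prop) hΘ, ← hκ2]
    refine Measure.map_congr ?_
    filter_upwards [hκχ] with p hp
    exact Prod.ext hp rfl
  · intro n A hA
    obtain ⟨B, hB, hBA⟩ := hκn n
    have h1 := hBA A hA
    simp only [hψn] at h1
    rw [hL, hL', measure_trajectory hf y n hA hB, measure_trajectory hf y' n hA hB] at h1
    have hg : ∀ x, Measurable fun z => noiseLaw m {e | trajectory f z (shiftBy n x, e) ∈
        {s : (ℤ → F) × (ℕ → E) | (x, s.2) ∈ B}} := by
      intro x
      have hG : Measurable fun q : E × (ℕ → V) =>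
          (x, fun j => forwardPath f (shiftBy n x) q.1 q.2 j) := by
        refine measurable_const.prodMk (measurable_pi_lambda _ fun j => ?_)
        exact (measurable_forwardPath hf j).comp (by fun_prop :
          Measurable fun q : E × (ℕ → V) => (shiftBy (n : ℤ) x, q.1, q.2))
      exact measurable_measure_prodMk_left (hG hB)
    -- The probability of a future event, as a function of the state z at time n, is a [0,1]-valued
    -- test function for the merging estimate.
    have h2 : ∫⁻ x in A, ∫⁻ z, noiseLaw m {e | trajectory f z (shiftBy n x, e) ∈
          {s : (ℤ → F) × (ℕ → E) | (x, s.2) ∈ B}} ∂(quenchedLaw f m x 0 n y) ∂μ ≤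
        ∫⁻ x in A, mergingBound η R ρ N x 0 n (dist y y') ∂μ +
          ∫⁻ x in A, ∫⁻ z, noiseLaw m {e | trajectory f z (shiftBy n x, e) ∈
            {s : (ℤ → F) × (ℕ → E) | (x, s.2) ∈ B}} ∂(quenchedLaw f m x 0 n y') ∂μ := by
      rw [← lintegral_add_left (measurable_mergingBound hη 0 n (dist y y'))]
      refine lintegral_mono fun x => ?_
      rw [add_comm]
      exact hN x 0 n y y' _ (hg x) fun z => prob_le_one
    have hfin : ∫⁻ x in A, ∫⁻ z, noiseLaw m {e | trajectory f z (shiftBy n x, e) ∈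
            {s : (ℤ → F) × (ℕ → E) | (x, s.2) ∈ B}} ∂(quenchedLaw f m x 0 n y') ∂μ ≠ ∞ := by
      rw [← measure_trajectory hf y' n hA hB]
      exact measure_ne_top L' _
    have h3 := ENNReal.le_of_add_le_add_right hfin (h1.trans h2)
    have hM : MeasurableSet {p : (ℤ → F) × (ℕ → E) × (ℕ → E) | p.1 ∈ A ∧ p.2.1 n ≠ p.2.2 n} := by
      refine (measurable_fst hA).inter (MeasurableSet.compl ?_)
      exact measurableSet_eq_fun (by fun_prop) (by fun_prop)
    rw [Measure.map_apply hΘ hM]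
    refine le_trans (measure_mono ?_) h3
    rintro p ⟨hpA, hpn⟩
    -- States that differ at time n force the trajectories from n on to differ.
    refine ⟨fun heq => hpn ?_, hpA⟩
    have := congrFun (congrArg Prod.snd heq) 0
    simpa using this

/-- The merging coupling on an extension of a given probability space. -/
theorem exists_merging_extension [StandardBorelSpace F]
    (hf : Measurable fun p : E × F × V => f p.1 p.2.1 p.2.2) (hη : Measurable η)
    (hN : HasMergingTime f m R ρ η N) (y y' : E) {Ω : Type*} [MeasurableSpace Ω] {P : Measure Ω}
    [IsProbabilityMeasure P] {X : Ω → ℤ → F} (hX : Measurable X) (hlaw : P.map X = μ) :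
    ∃ P' : Measure (Ω × (ℕ → E) × (ℕ → E)), IsProbabilityMeasure P' ∧
      MeasurePreserving Prod.fst P' P ∧
      P'.map (fun ω => (X ω.1, ω.2.1)) = (μ.prod (noiseLaw m)).map (trajectory f y) ∧
      P'.map (fun ω => (X ω.1, ω.2.2)) = (μ.prod (noiseLaw m)).map (trajectory f y') ∧
      ∀ n : ℕ, ∀ᵐ ω ∂P', tvDist (quenchedLaw f m (X ω.1) 0 n y) (quenchedLaw f m (X ω.1) 0 n y') ≤
          ENNReal.ofReal ((P'⟦{ω | ω.2.1 n ≠ ω.2.2 n} |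
            MeasurableSpace.comap (fun ω => X ω.1) inferInstance⟧) ω) ∧
        (P'⟦{ω | ω.2.1 n ≠ ω.2.2 n} |
            MeasurableSpace.comap (fun ω => X ω.1) inferInstance⟧) ω ≤
          (mergingBound η R ρ N (X ω.1) 0 n (dist y y')).toReal := by
  obtain ⟨M, hM, hM1, hM2, hMn⟩ := exists_merging_coupling (μ := μ) hf hη hN y y'
  have ht : ∀ z, Measurable (trajectory f z : (ℤ → F) × (ℕ → V) → (ℤ → F) × (ℕ → E)) :=
    measurable_trajectory hf
  have hfst : M.map Prod.fst = P.map X := by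
    have := congrArg (fun κ => κ.map Prod.fst) hM1
    rw [Measure.map_map measurable_fst (by fun_prop), Measure.map_map measurable_fst (ht y)] at this
    rw [hlaw]
    refine Eq.trans this ?_
    change (μ.prod (noiseLaw m)).map Prod.fst = μ
    rw [Measure.map_fst_prod, measure_univ, one_smul]
  have : Nonempty E := ⟨y⟩
  obtain ⟨P', hP', hmp, hjoint⟩ := exists_extension P hX M hfst
  have hXm : Measurable fun ω : Ω × (ℕ → E) × (ℕ → E) => X ω.1 := hX.comp measurable_fst
  have hJ : Measurable fun ω : Ω × (ℕ → E) × (ℕ → E) => (X ω.1, ω.2) := hXm.prodMk measurable_snd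
  refine ⟨P', hP', hmp, ?_, ?_, fun n => ?_⟩
  · rw [← hM1, ← hjoint, Measure.map_map (by fun_prop) hJ]
    rfl
  · rw [← hM2, ← hjoint, Measure.map_map (by fun_prop) hJ]
    rfl
  -- Given the environment, the time-n marginal of k couples the two quenched laws, which bounds
  -- `tvDist` from above; the upper bound on k follows from its integrated form over all environment
  -- events.
  set k : Kernel (ℤ → F) ((ℕ → E) × (ℕ → E)) :=
    condDistrib (fun ω : Ω × (ℕ → E) × (ℕ → E) => ω.2) (fun ω => X ω.1) P' with hk
  have hXlaw : P'.map (fun ω => X ω.1) = μ := by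
    rw [← hlaw, ← hmp.map_eq, Measure.map_map hX measurable_fst]
    rfl
  have hμk : μ ⊗ₘ k = M := by
    rw [← hjoint, ← hXlaw]
    exact compProd_map_condDistrib measurable_snd.aemeasurable
  set D : Set ((ℕ → E) × (ℕ → E)) := {w | w.1 n ≠ w.2 n} with hDdef
  have hD : MeasurableSet D :=
    (measurableSet_eq_fun (by fun_prop : Measurable fun w : (ℕ → E) × (ℕ → E) => w.1 n)
      (by fun_prop)).compl
  have hce := condDistrib_ae_eq_condExp (μ := P') (Y := fun ω : Ω × (ℕ → E) × (ℕ → E) => ω.2)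
    hXm measurable_snd hD
  have hbound : ∀ᵐ x ∂μ, k x D ≤ mergingBound η R ρ N x 0 n (dist y y') := by
    refine ae_le_of_forall_setLIntegral_le_of_sigmaFinite (Kernel.measurable_coe k hD)
      fun A hA _ => ?_
    rw [← Measure.compProd_apply_prod hA hD, hμk]
    exact hMn n A hA
  have hq : ∀ z, Measurable fun x : ℤ → F => quenchedLaw f m x 0 n z := fun z =>
    measurable_quenchedLaw_left hf 0 n z
  have hmarg : ∀ (z : E) (g : (ℕ → E) × (ℕ → E) → E), Measurable g →
      M.map (fun p => (p.1, g p.2)) = (μ.prod (noiseLaw m)).map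
        (fun p => (p.1, forwardPath f p.1 z p.2 n)) →
      ∀ᵐ x ∂μ, (k x).map g = quenchedLaw f m x 0 n z := by
    intro z g hg hMg
    set q : Kernel (ℤ → F) E := ⟨fun x => quenchedLaw f m x 0 n z, hq z⟩ with hqdef
    have hqM : IsMarkovKernel q := ⟨fun x => isProbabilityMeasure_quenchedLaw hf x 0 n z⟩
    have h1 : μ ⊗ₘ (k.map g) = μ ⊗ₘ q := by
      have := Kernel.IsMarkovKernel.map k hg
      refine Measure.ext_prod fun {A B} hA hB => ?_
      have hAB : MeasurableSet (A ×ˢ B) := hA.prod hB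
      have hfp : Measurable fun p : (ℤ → F) × (ℕ → V) => (p.1, forwardPath f p.1 z p.2 n) :=
        measurable_fst.prodMk ((measurable_forwardPath hf n).comp
          (by fun_prop : Measurable fun p : (ℤ → F) × (ℕ → V) => (p.1, z, p.2)))
      have e1 : (μ ⊗ₘ (k.map g)) (A ×ˢ B) = M.map (fun p => (p.1, g p.2)) (A ×ˢ B) := by
        rw [Measure.map_apply (by fun_prop) hAB, ← hμk, Measure.compProd_apply_prod hA hB,
          show (fun p : (ℤ → F) × (ℕ → E) × (ℕ → E) => (p.1, g p.2)) ⁻¹' A ×ˢ B =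
            A ×ˢ (g ⁻¹' B) from rfl, Measure.compProd_apply_prod hA (hg hB)]
        simp_rw [Kernel.map_apply' k hg _ hB]
      rw [e1, hMg, Measure.map_apply hfp hAB, Measure.prod_apply (hfp hAB),
        Measure.compProd_apply_prod hA hB, ← lintegral_indicator hA]
      refine lintegral_congr fun x => ?_
      by_cases hx : x ∈ A
      · rw [Set.indicator_of_mem hx]
        change _ = quenchedLaw f m x 0 n z B
        have hxm : Measurable fun e => forwardPath f x z e n :=
          (measurable_forwardPath hf n).comp (by fun_prop : Measurable fun e : ℕ → V => (x, z, e))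
        rw [quenchedLaw_eq_map hf, shiftBy_zero, Measure.map_apply hxm hB]
        congr 1
        ext e
        simp [hx]
      · rw [Set.indicator_of_notMem hx]
        exact measure_mono_null (t := ∅) (fun e he => hx he.1) measure_empty
    have := Kernel.IsMarkovKernel.map k hg
    filter_upwards [Kernel.ae_eq_of_compProd_eq h1] with x hx
    rw [← Kernel.map_apply k hg, hx]
    rfl
  have hm1 := hmarg y (fun w => w.1 n) (by fun_prop) (by
    have h1 := congrArg (fun κ => κ.map fun p : (ℤ → F) × (ℕ → E) => (p.1, p.2 n)) hM1
    rw [Measure.map_map (by fun_prop) (by fun_prop), Measure.map_map (by fun_prop) (ht y)] at h1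
    exact h1)
  have hm2 := hmarg y' (fun w => w.2 n) (by fun_prop) (by
    have h1 := congrArg (fun κ => κ.map fun p : (ℤ → F) × (ℕ → E) => (p.1, p.2 n)) hM2
    rw [Measure.map_map (by fun_prop) (by fun_prop), Measure.map_map (by fun_prop) (ht y')] at h1
    exact h1)
  have hall : ∀ᵐ x ∂μ, tvDist (quenchedLaw f m x 0 n y) (quenchedLaw f m x 0 n y') ≤ k x D ∧
      k x D ≤ mergingBound η R ρ N x 0 n (dist y y') := by
    filter_upwards [hbound, hm1, hm2] with x h1 h2 h3
    refine ⟨?_, h1⟩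
    have hpair : Measurable fun w : (ℕ → E) × (ℕ → E) => (w.1 n, w.2 n) := by fun_prop
    refine (iInf₂_le ((k x).map fun w => (w.1 n, w.2 n)) ⟨?_, ?_⟩).trans (le_of_eq ?_)
    · have hdiag : MeasurableSet {p : E × E | p.1 ≠ p.2} :=
        (measurableSet_eq_fun measurable_fst measurable_snd).compl
      rw [Measure.map_apply hpair hdiag]
      rfl
    · rw [Measure.map_map measurable_fst hpair, ← h2]
      rfl
    · rw [Measure.map_map measurable_snd hpair, ← h3]
      rfl
  rw [← hXlaw] at hall
  filter_upwards [hce, ae_of_ae_map hXm.aemeasurable hall] with ω h1 h2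
  have h3 : (k (X ω.1)).real D = (P'⟦{ω | ω.2.1 n ≠ ω.2.2 n} |
    MeasurableSpace.comap (fun ω => X ω.1) inferInstance⟧) ω := h1
  rw [← h3]
  refine ⟨?_, ENNReal.toReal_mono ?_ h2.2⟩
  · rw [Measure.real, ENNReal.ofReal_toReal (measure_ne_top _ _)]
    exact h2.1
  · refine ENNReal.add_ne_top.2 ⟨?_, ENNReal.prod_ne_top fun _ _ => ENNReal.ofReal_ne_top⟩
    split_ifs <;> simp

theorem toReal_mergingBound (h01 : ∀ x, η x ∈ Set.Ioc (0 : ℝ) 1) (x : ℤ → F) (n : ℕ) (r : ℝ) :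
    (mergingBound η R ρ N x 0 n r).toReal = (if R / ρ ^ (n / 2) ≤ r then (1 : ℝ) else 0) +
      ∏ j ∈ Finset.Icc 1 (((n + 1) / 2) / N), (1 - η (x ((n / 2 + j * N - 1 : ℕ) : ℤ))) := by
  rw [mergingBound, ENNReal.toReal_add, ENNReal.toReal_prod]
  · congr 1
    · split_ifs <;> simp
    · refine Finset.prod_congr rfl fun j _ => ?_
      rw [zero_add, ENNReal.toReal_ofReal (sub_nonneg.2 (h01 _).2)]
  · split_ifs <;> simp
  · exact ENNReal.prod_ne_top fun _ _ => ENNReal.ofReal_ne_top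

end Coupling

/-! ### Assembling the proposition -/

/-- An i.i.d. sequence independent of the environment, seen from time `s` on. -/
theorem map_env_noise_of_indep {F V Ω : Type*} [MeasurableSpace F] [MeasurableSpace V]
    [MeasurableSpace Ω] {P : Measure Ω} [IsProbabilityMeasure P] {X : ℤ → Ω → F} {ε : ℕ → Ω → V}
    (hX : ∀ t, Measurable (X t)) (hε : ∀ n, Measurable (ε n)) (hεindep : iIndepFun ε P)
    (hεident : ∀ n, IdentDistrib (ε n) (ε 0) P P)
    (hεX : IndepFun (fun ω n => ε n ω) (fun ω t => X t ω) P) [IsProbabilityMeasure (P.map (ε 0))]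
    (s : ℕ) :
    P.map (fun ω => ((fun t => X t ω : ℤ → F), fun n => ε (n + s) ω)) =
      (pathLaw P X).prod (noiseLaw (P.map (ε 0))) := by
  have hXm : Measurable fun ω (t : ℤ) => X t ω := measurable_pi_lambda _ hX
  have hεm : Measurable fun ω (n : ℕ) => ε (n + s) ω := measurable_pi_lambda _ fun n => hε _
  have h1 : IndepFun (fun ω (t : ℤ) => X t ω) (fun ω (n : ℕ) => ε (n + s) ω) P :=
    hεX.symm.comp (φ := id) (ψ := fun (e : ℕ → V) (n : ℕ) => e (n + s)) measurable_id (by fun_prop)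
  have h2 : iIndepFun (fun n : ℕ => ε (n + s)) P :=
    hεindep.precomp (g := fun n : ℕ => n + s) (add_left_injective s)
  rw [iIndepFun_iff_map_fun_eq_infinitePi_map fun n => hε _] at h2
  simp_rw [(hεident _).map_eq] at h2
  rw [(indepFun_iff_map_prod_eq_prod_map_map hXm.aemeasurable hεm.aemeasurable).1 h1, h2]
  rfl

theorem measurable_stepMoment {E F V : Type*} [MetricSpace E] [PolishSpace E] [MeasurableSpace E]
    [BorelSpace E] [MeasurableSpace F] [MeasurableSpace V] {f : E → F → V → E} {m : Measure V}
    [SFinite m] (hf : Measurable fun p : E × F × V => f p.1 p.2.1 p.2.2) (y₀ : E) (θ : ℝ) :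
    Measurable fun x : F => stepMoment f m y₀ θ x := by
  have h1 : Measurable fun p : F × V => f y₀ p.1 p.2 :=
    hf.comp (by fun_prop : Measurable fun p : F × V => (y₀, p.1, p.2))
  have h2 : Measurable fun p : F × V => ENNReal.ofReal (dist y₀ (f y₀ p.1 p.2) ^ θ) :=
    (measurable_dist_rpow y₀ θ).comp h1
  exact h2.lintegral_prod_right'

theorem proposition1 {E : Type u} {F : Type v} {Ω : Type w}
    [MetricSpace E] [PolishSpace E] [MeasurableSpace E] [BorelSpace E]
    [TopologicalSpace F] [PolishSpace F] [MeasurableSpace F] [BorelSpace F]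
    [MeasurableSpace Ω] (P : Measure Ω) [IsProbabilityMeasure P]
    (k : ℕ)
    (f : E → F → EuclideanSpace ℝ (Fin k) → E)
    (hf : Measurable fun p : E × F × EuclideanSpace ℝ (Fin k) => f p.1 p.2.1 p.2.2)
    -- the stationary environment
    (X : ℤ → Ω → F) (hX : ∀ t, Measurable (X t)) (hXstat : IsStationaryProcess P X)
    -- the i.i.d. noise, independent of the environment
    (ε : ℕ → Ω → EuclideanSpace ℝ (Fin k)) (hε : ∀ n, Measurable (ε n))
    (hεindep : iIndepFun ε P) (hεident : ∀ n, IdentDistrib (ε n) (ε 0) P P)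
    (hεX : IndepFun (fun ω n => ε n ω) (fun ω t => X t ω) P)
    -- the two assumptions
    (R ρ : ℝ) (hcontr : ContractiveModConst f R ρ)
    (η : F → ℝ) (hmin : LocalMinorization f (P.map (ε 0)) R ρ η)
    -- the log-moment condition
    (y₀ : E) (θ : ℝ) (hθ : θ ∈ Set.Ioo (0 : ℝ) 1)
    (hlog : HasLogMoment P fun ω =>
      ∫⁻ e, ENNReal.ofReal (dist y₀ (f y₀ (X 0 ω) e) ^ θ) ∂(P.map (ε 0))) :
    -- 1. the coupling and the total variation bound
    (∃ N : ℕ, 0 < N ∧ ∀ y y' : E, y ≠ y' →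
      ∃ (Ω' : Type (max u w)) (_ : MeasurableSpace Ω') (P' : Measure Ω') (φ : Ω' → Ω)
        (Y Y' : ℕ → Ω' → E),
        IsProbabilityMeasure P' ∧ MeasurePreserving φ P' P ∧
        (∀ n, Measurable (Y n)) ∧ (∀ n, Measurable (Y' n)) ∧
        P'.map (fun ω => ((fun t => X t (φ ω) : ℤ → F), (fun n => Y n ω : ℕ → E))) =
          P.map (fun ω => ((fun t => X t ω : ℤ → F), (fun n => chain f X ε y n ω : ℕ → E))) ∧
        P'.map (fun ω => ((fun t => X t (φ ω) : ℤ → F), (fun n => Y' n ω : ℕ → E))) =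
          P.map (fun ω => ((fun t => X t ω : ℤ → F), (fun n => chain f X ε y' n ω : ℕ → E))) ∧
        ∀ n : ℕ, ∀ᵐ ω ∂P',
          tvDist (quenchedLaw f (P.map (ε 0)) (fun t => X t (φ ω)) 0 n y)
              (quenchedLaw f (P.map (ε 0)) (fun t => X t (φ ω)) 0 n y') ≤
            ENNReal.ofReal ((P'⟦{ω' | Y n ω' ≠ Y' n ω'} |
              MeasurableSpace.comap (fun ω' => (fun t => X t (φ ω') : ℤ → F)) inferInstance⟧) ω) ∧
          (P'⟦{ω' | Y n ω' ≠ Y' n ω'} |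
              MeasurableSpace.comap (fun ω' => (fun t => X t (φ ω') : ℤ → F)) inferInstance⟧) ω ≤
            (if R / ρ ^ (n / 2) ≤ dist y y' then (1 : ℝ) else 0) +
              ∏ j ∈ Finset.Icc 1 (((n + 1) / 2) / N),
                (1 - η (X (((n / 2 + j * N - 1 : ℕ) : ℤ)) (φ ω)))) ∧
    -- 2. convergence of the backward iterates
    (∃ π : ℤ → Ω → Measure E,
      (∀ t, Measurable (π t)) ∧ (∀ t ω, IsProbabilityMeasure (π t ω)) ∧
      (∀ s t, IdentDistrib (π s) (π t) P P) ∧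
      (∀ (t : ℤ) (y : E), ∀ᵐ ω ∂P, Tendsto
        (fun n : ℕ => tvDist
          (quenchedLaw f (P.map (ε 0)) (fun s => X s ω) (t - n) n y) (π t ω)) atTop (𝓝 0)) ∧
      (∀ t : ℤ, ∀ᵐ ω ∂P,
        (π (t - 1) ω).bind (transKernel f (P.map (ε 0)) (X (t - 1) ω)) = π t ω)) ∧
    -- 3. existence, uniqueness in law and ergodicity of the stationary solution
    (∃ Q : Measure (ℤ → F × E),
      (∃ (Ω' : Type (max u w)) (_ : MeasurableSpace Ω') (P' : Measure Ω') (φ : Ω' → Ω)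
        (ε' : ℤ → Ω' → EuclideanSpace ℝ (Fin k)) (Y : ℤ → Ω' → E),
        MeasurePreserving φ P' P ∧ (∀ (n : ℕ) (ω : Ω'), ε' n ω = ε n (φ ω)) ∧
        IsStationarySolution f (P.map (ε 0)) (pathLaw P X) P' (fun t ω => X t (φ ω)) ε' Y ∧
        pathLaw P' (fun t ω => (X t (φ ω), Y t ω)) = Q) ∧
      (∀ (Ω' : Type z) (_ : MeasurableSpace Ω') (P' : Measure Ω')
        (X' : ℤ → Ω' → F) (ε' : ℤ → Ω' → EuclideanSpace ℝ (Fin k)) (Y : ℤ → Ω' → E),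
        IsStationarySolution f (P.map (ε 0)) (pathLaw P X) P' X' ε' Y →
        pathLaw P' (fun t ω => (X' t ω, Y t ω)) = Q) ∧
      (IsErgodicProcess P X → Ergodic pathShift Q)) := by
  have hm : IsProbabilityMeasure (P.map (ε 0)) :=
    Measure.isProbabilityMeasure_map (hε 0).aemeasurable
  set m := P.map (ε 0) with hm_def
  have hXm : Measurable fun ω (t : ℤ) => X t ω := measurable_pi_lambda _ hX
  have hμ : IsProbabilityMeasure (pathLaw P X) := Measure.isProbabilityMeasure_map hXm.aemeasurable
  have hη := hmin.measurable_η
  have h01 := hmin.η_mem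
  obtain ⟨N, hN0, hN⟩ := exists_hasMergingTime hf hcontr hmin
  have hlog' : HasLogMoment (pathLaw P X) fun x => stepMoment f m y₀ θ (x 0) := by
    have hS : Measurable fun x : ℤ → F => stepMoment f m y₀ θ (x 0) :=
      (measurable_stepMoment hf y₀ θ).comp (measurable_pi_apply 0)
    refine ⟨(ae_map_iff hXm.aemeasurable (hS (measurableSet_singleton ∞).compl)).2 hlog.1, ?_⟩
    refine (integrable_map_measure ?_ hXm.aemeasurable).2 hlog.2
    exact (Real.continuous_posLog.measurable.comp hS.ennreal_toReal).aestronglyMeasurable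
  obtain ⟨Φ, hΦ⟩ := exists_isPullbackLimit hf hcontr hη h01 hN0 hN hθ y₀ hXstat hlog'
  have H : MergingSystem f m (pathLaw P X) R ρ η N Φ :=
    ⟨hf, hcontr, hη, h01, hN0, hN, hXstat, hΦ⟩
  have hshift : ∀ t, Measurable fun ω => shiftBy t fun s => X s ω := fun t =>
    (measurable_shiftBy t).comp hXm
  have hshift_law : ∀ t, P.map (fun ω => shiftBy t fun s => X s ω) = pathLaw P X := by
    intro t
    have := (measurePreserving_shiftBy hXstat t).map_eq
    rw [pathLaw, Measure.map_map (measurable_shiftBy t) hXm] at this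
    exact this
  -- The random measure at time t is Φ evaluated at the environment recentred at t.
  refine ⟨⟨N, hN0, fun y y' _ => ?_⟩, ⟨fun t ω => Φ (shiftBy t fun s => X s ω), ?_, ?_, ?_, ?_, ?_⟩,
    ?_⟩
  · obtain ⟨P', hP', hmp, h1, h2, h3⟩ := exists_merging_extension (μ := pathLaw P X) hf hη hN y y' hXm rfl
    have hchain : ∀ y, P.map (fun ω => ((fun t => X t ω : ℤ → F),
        (fun n => chain f X ε y n ω : ℕ → E))) =
          ((pathLaw P X).prod (noiseLaw m)).map (trajectory f y) := by
      intro y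
      -- Offset 1: the first step of the chain uses ε 1.
      rw [← map_env_noise_of_indep hX hε hεindep hεident hεX 1,
        Measure.map_map (measurable_trajectory hf y)
          (hXm.prodMk (measurable_pi_lambda _ fun n => hε _))]
      congr 1
      funext ω
      exact Prod.ext rfl (funext fun n => chain_eq_forwardPath f X ε y n ω)
    refine ⟨Ω × (ℕ → E) × (ℕ → E), inferInstance, P', Prod.fst, fun n ω => ω.2.1 n,
      fun n ω => ω.2.2 n, hP', hmp, fun n => by fun_prop, fun n => by fun_prop, ?_, ?_, fun n => ?_⟩
    · rw [hchain]
      exact h1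
    · rw [hchain]
      exact h2
    · filter_upwards [h3 n] with ω hω
      refine ⟨hω.1, hω.2.trans (le_of_eq ?_)⟩
      exact toReal_mergingBound h01 _ n _
  · exact fun t => hΦ.measurable.comp (hshift t)
  · exact fun t ω => hΦ.prob _
  · intro s t
    refine ⟨(hΦ.measurable.comp (hshift s)).aemeasurable, (hΦ.measurable.comp (hshift t)).aemeasurable,
      ?_⟩
    have : ∀ t, P.map (fun ω => Φ (shiftBy t fun s => X s ω)) = (pathLaw P X).map Φ := by
      intro t
      rw [← hshift_law t, Measure.map_map hΦ.measurable (hshift t)]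
      rfl
    rw [this, this]
  · intro t y
    have h1 : ∀ᵐ x ∂(P.map fun ω => shiftBy t fun s => X s ω), ∀ y,
        ConvergesUniformly (fun n : ℕ => quenchedLaw f m x (-n) n y) (Φ x) := by
      rw [hshift_law]
      exact hΦ.converges
    filter_upwards [ae_of_ae_map (hshift t).aemeasurable h1] with ω hω
    have h2 := hω y
    have h3 : ∀ n : ℕ, quenchedLaw f m (shiftBy t fun s => X s ω) (-n) n y =
        quenchedLaw f m (fun s => X s ω) (t - n) n y := by
      intro n
      rw [quenchedLaw_shiftBy hf, neg_add_eq_sub]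
    simp_rw [h3] at h2
    have := hΦ.prob (shiftBy t fun s => X s ω)
    have : ∀ n : ℕ, IsProbabilityMeasure (quenchedLaw f m (fun s => X s ω) (t - n) n y) := fun n =>
      isProbabilityMeasure_quenchedLaw hf _ _ n y
    exact h2.tendsto_tvDist
  · intro t
    have h1 : ∀ᵐ x ∂(P.map fun ω => shiftBy (t - 1) fun s => X s ω),
        (Φ x).bind (transKernel f m (x 0)) = Φ (shiftBy 1 x) := by
      rw [hshift_law]
      exact hΦ.bind_transKernel hf y₀ hXstat
    filter_upwards [ae_of_ae_map (hshift (t - 1)).aemeasurable h1] with ω hω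
    rw [shiftBy_shiftBy] at hω
    simpa [shiftBy] using hω
  -- Offset 0: the two-sided noise must agree with ε at all n ≥ 0.
  · obtain ⟨P', hP', hmp, hW⟩ := H.exists_isWeakSolution_extension y₀ hX hε
      (map_env_noise_of_indep hX hε hεindep hεident hεX 0)
    refine ⟨_, ⟨Ω × (ℕ → EuclideanSpace ℝ (Fin k)) × (ℤ → E), inferInstance, P', Prod.fst,
      fun t ω => glue (fun n => ε n ω.1) ω.2.1 t, fun t ω => ω.2.2 t, hmp, fun n ω => rfl,
      hW.isStationarySolution H y₀, rfl⟩, ?_, fun hXerg => hW.ergodic hXerg H y₀⟩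
    intro Ω' _ P'' X' ε' Y hS
    have := hS.isProbabilityMeasure
    exact hS.isWeakSolution.pathLaw_eq hW H y₀
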